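/- **Lemma 1.** Let $k$ be a field of characteristic $0$. For a $\mathbb Z$-graded $k$-vector space $\mathcal L$ let $C(\mathcal L)=\bigoplus_{n\ge1}S^n(s^{-1}\mathcal L)$ be the cofree cocommutative coalgebra (without counit) cogenerated by $s^{-1}\mathcal L$, where $(s^{-1}\mathcal L)^{i-1}=\mathcal L^{i}$, and let $\mathrm{pr}:C(\mathcal L)\to\mathcal L$ be the projection onto cogenerators. Identify the arity-$n$ part of $C(\mathcal L)$ with the graded exterior power $\wedge^n\mathcal L$ by $\gamma_1\wedge\dots\wedge\gamma_n\leftrightarrow(-1)^{\sum_i(n-i)(|\gamma_i|-1)}s^{-1}\gamma_1\cdots s^{-1}\gamma_n$. An $L_\infty$-algebra structure on $\mathcal L$ is a degree $1$ coderivation $Q$ of $C(\mathcal L)$ with $Q^2=0$; its structure maps are $Q_n=\mathrm{pr}\circ Q|_{\wedge^n\mathcal L}$. An $L_\infty$-morphism $(\mathcal L,Q)\to(\mathcal L^\diamond,Q^\diamond)$ is a degree $0$ coalgebra morphism $F:C(\mathcal L)\to C(\mathcal L^\diamond)$ with $Q^\diamond F=FQ$; its structure maps are $F_n=\mathrm{pr}\circ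 F|_{\wedge^n\mathcal L}$, and $F$ is a quasi-isomorphism if $F_1:(\mathcal L,Q_1)\to(\mathcal L^\diamond,Q^\diamond_1)$ induces an isomorphism on cohomology. The graded space $\mathcal U=s\,\mathrm{Hom}(C(\mathcal L),\mathcal L^\diamond)$ carries the convolution $L_\infty$-structure $Q^{\mathcal U}$: in terms of degrees $|f|$ in $\mathrm{Hom}(C(\mathcal L),s^{-1}\mathcal L^\diamond)$, $Q_1^{\mathcal U}f=Q^\diamond_1f-(-1)^{|f|}fQ$, and for $n\ge2$, $Q^{\mathcal U}_n(f_1,\dots,f_n)(X)$ is $(-1)^{\sum_i(n-i)|f_i|}$ times $\mathrm{pr}\,Q^\diamond$ applied to the product in $S^n(s^{-1}\mathcal L^\diamond)$ of $(f_1\otimes\dots\otimes f_n)(\Delta^{(n)}X)$. A Maurer–Cartan element is $\pi\in\mathcal U^1$ with $\sum_{n\ge1}\frac1{n!}Q^{\mathcal U}_n(\pi,\dots,\pi)=0$. Let $F$ be an $L_\infty$-quasi-isomorphism from $(\mathcal L,Q)$ to $(\mathcal L^\diamond,Q^\diamond)$, let $n\ge1$, and let $\widetilde H:\wedge^n\mathcal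 L\to\mathcal L^\diamond$ be any linear map of degree $-n$. Then there is an $L_\infty$-quasi-isomorphism $\widetilde F$ from $(\mathcal L,Q)$ to $(\mathcal L^\diamond,Q^\diamond)$ such that $\widetilde F_m=F_m$ for all $m<n$ and, for all $\gamma_i\in\mathcal L^{k_i}$, $$\widetilde F_n(\gamma_1,\dots,\gamma_n)=F_n(\gamma_1,\dots,\gamma_n)+Q^\diamond_1\widetilde H(\gamma_1,\dots,\gamma_n)-\sum_{i=1}^n(-1)^{n+k_1+\dots+k_{i-1}}\widetilde H(\gamma_1,\dots,\gamma_{i-1},Q_1\gamma_i,\gamma_{i+1},\dots,\gamma_n).$$ Moreover, $\widetilde F$ can be chosen as the time-$1$ endpoint of a gauge flow starting at $F$: let $\xi\in\mathcal U^0$ be the map equal to $\widetilde H$ on $\wedge^n\mathcal L$ and to $0$ on $\wedge^m\mathcal L$ for $m\ne n$. There are $L_\infty$-morphisms $\Phi_t$ ($t\in k$) with $\Phi_0=F$ and $\Phi_1=\widetilde F$ such that the elements $\alpha_t=\mathrm{pr}\circ\Phi_t\in\mathcal U^1$ are Maurer–Cartan, are polynomial in $t$ on each $\wedge^m\mathcal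 L$ (of degree bounded in terms of $m$), and satisfy $$\frac{d}{dt}\alpha_t=\sum_{m\ge0}\frac1{m!}Q^{\mathcal U}_{m+1}(\alpha_t,\dots,\alpha_t,\xi).$$ -/

import Mathlib

open scoped TensorProduct

noncomputable section

namespace LInfty

section Coalgebra

variable {k : Type*} [Field k] {L : Type*} [AddCommGroup L] [Module k L]
variable (𝓛 : ℤ → Submodule k L)

/-- The defining relations of the free graded commutative algebra on `s⁻¹L`: an element of
`L` of degree `i` has degree `i - 1` in `s⁻¹L`, and `x y = (-1)^((i-1)(j-1)) y x`. -/
inductive Rel : TensorAlgebra k L → TensorAlgebra k L → Prop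
  | swap (i j : ℤ) (x y : L) (hx : x ∈ 𝓛 i) (hy : y ∈ 𝓛 j) :
      Rel (TensorAlgebra.ι k x * TensorAlgebra.ι k y)
        ((-1 : k) ^ ((i - 1) * (j - 1)) • (TensorAlgebra.ι k y * TensorAlgebra.ι k x))

/-- The ring congruence generated by the relations. -/
def symCon : RingCon (TensorAlgebra k L) := ringConGen (Rel 𝓛)

/-- The free unital graded commutative algebra `S(s⁻¹L)`. -/
def Sym : Type _ := (symCon 𝓛).Quotient

instance : Ring (Sym 𝓛) := inferInstanceAs <| Ring (symCon 𝓛).Quotient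

instance : Algebra k (Sym 𝓛) := inferInstanceAs <| Algebra k (symCon 𝓛).Quotient

/-- The quotient map from the tensor algebra. -/
def mk : TensorAlgebra k L →ₐ[k] Sym 𝓛 := (symCon 𝓛).mkₐ k

/-- The inclusion of generators `s⁻¹L → S(s⁻¹L)`. -/
def ι : L →ₗ[k] Sym 𝓛 :=
  (mk 𝓛).toLinearMap ∘ₗ TensorAlgebra.ι k

/-- The product `s⁻¹γ₀ ⋯ s⁻¹γₙ₋₁` in `S(s⁻¹L)`. -/
def word {n : ℕ} (γ : Fin n → L) : Sym 𝓛 := (List.ofFn fun j => ι 𝓛 (γ j)).prod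

theorem ι_mul_ι {i j : ℤ} {x y : L} (hx : x ∈ 𝓛 i) (hy : y ∈ 𝓛 j) :
    ι 𝓛 x * ι 𝓛 y = (-1 : k) ^ ((i - 1) * (j - 1)) • (ι 𝓛 y * ι 𝓛 x) := by
  have h : mk 𝓛 _ = mk 𝓛 _ :=
    Quotient.sound <| RingCon.le_ringConGen _ _ (Rel.swap i j x y hx hy)
  simpa only [ι, LinearMap.comp_apply, AlgHom.toLinearMap_apply, map_mul, map_smul] using h

/-- The universal property of `S(s⁻¹L)`. -/
def lift {A : Type*} [Ring A] [Algebra k A] (f : L →ₗ[k] A)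
    (hf : ∀ (i j : ℤ) (x y : L), x ∈ 𝓛 i → y ∈ 𝓛 j →
      f x * f y = (-1 : k) ^ ((i - 1) * (j - 1)) • (f y * f x)) : Sym 𝓛 →ₐ[k] A :=
  RingCon.liftₐ (symCon 𝓛) (TensorAlgebra.lift k f) (by
    refine RingCon.ringConGen_le.2 fun a b h => ?_
    obtain ⟨i, j, x, y, hx, hy⟩ := h
    simpa using hf i j x y hx hy)

@[simp] theorem lift_ι {A : Type*} [Ring A] [Algebra k A] (f : L →ₗ[k] A) (hf) (x : L) :
    lift 𝓛 f hf (ι 𝓛 x) = f x := by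
  exact TensorAlgebra.lift_ι_apply f x

theorem hom_ext {A : Type*} [Ring A] [Algebra k A] {f g : Sym 𝓛 →ₐ[k] A}
    (h : ∀ x, f (ι 𝓛 x) = g (ι 𝓛 x)) : f = g := by
  have h' : f.comp (mk 𝓛) = g.comp (mk 𝓛) := TensorAlgebra.hom_ext (LinearMap.ext h)
  ext X
  obtain ⟨X, rfl⟩ := Quotient.exists_rep X
  exact DFunLike.congr_fun h' X

/-- The component of degree `d` of `S(s⁻¹L)`. -/
def symDeg (d : ℤ) : Submodule k (Sym 𝓛) :=
  Submodule.span k {X | ∃ (n : ℕ) (γ : Fin n → L) (κ : Fin n → ℤ),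
    (∀ j, γ j ∈ 𝓛 (κ j)) ∧ ∑ j, (κ j - 1) = d ∧ X = word 𝓛 γ}

/-- The augmentation `S(s⁻¹L) → k`. -/
def aug : Sym 𝓛 →ₐ[k] k := lift 𝓛 0 (by simp)

/-- The space `⨁_{n ≥ 1} Sⁿ(s⁻¹L)` (the augmentation ideal) underlying the cofree
coalgebra `C(L)`. -/
abbrev C : Type _ := LinearMap.ker (aug 𝓛).toLinearMap

/-- The inclusion of `C(L)` in `S(s⁻¹L)`. -/
def incl : C 𝓛 →ₗ[k] Sym 𝓛 := Submodule.subtype _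

/-- The projection of `S(s⁻¹L)` onto `C(L)` along the constants. -/
def red : Sym 𝓛 →ₗ[k] C 𝓛 :=
  LinearMap.codRestrict _ (LinearMap.id - Algebra.linearMap k (Sym 𝓛) ∘ₗ (aug 𝓛).toLinearMap)
    (by intro X; simp)

/-- The projection `S(s⁻¹L) → L` onto the words of length one. -/
def symProj : Sym 𝓛 →ₗ[k] L :=
  letI : Module kᵐᵒᵖ L := Module.compHom _ ((RingHom.id k).fromOpposite mul_comm)
  haveI : IsCentralScalar k L := ⟨fun _ _ => rfl⟩
  (TrivSqZeroExt.sndHom k L) ∘ₗ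
    (lift 𝓛 (TrivSqZeroExt.inrHom k L) (by intros; simp)).toLinearMap

/-- The projection `pr : C(L) → L` onto cogenerators. -/
def pr : C 𝓛 →ₗ[k] L := symProj 𝓛 ∘ₗ incl 𝓛

variable [DirectSum.Decomposition 𝓛]

/-- The linear map which multiplies `x ∈ Lⁱ` by `(-1)^(e(i-1))`. -/
def shiftSign (e : ℤ) : L →ₗ[k] L :=
  DirectSum.toModule k ℤ L (fun i => (-1 : k) ^ (e * (i - 1)) • (𝓛 i).subtype) ∘ₗ
    (DirectSum.decomposeLinearEquiv 𝓛).toLinearMap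

theorem shiftSign_of_mem (e : ℤ) {i : ℤ} {x : L} (hx : x ∈ 𝓛 i) :
    shiftSign 𝓛 e x = (-1 : k) ^ (e * (i - 1)) • x := by
  lift x to 𝓛 i using hx
  rw [shiftSign, LinearMap.comp_apply, LinearEquiv.coe_coe, DirectSum.decomposeLinearEquiv_apply,
    DirectSum.decompose_coe, ← DirectSum.lof_eq_of k, DirectSum.toModule_lof]
  simp

/-- The algebra automorphism of `S(s⁻¹L)` which multiplies an element of degree `d`
by `(-1)^(e d)`. -/
def sgn (e : ℤ) : Sym 𝓛 →ₐ[k] Sym 𝓛 :=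
  lift 𝓛 (ι 𝓛 ∘ₗ shiftSign 𝓛 e) (by
    intro i j x y hx hy
    simp only [LinearMap.comp_apply, shiftSign_of_mem 𝓛 e hx, shiftSign_of_mem 𝓛 e hy,
      map_smul, smul_mul_smul_comm, ι_mul_ι 𝓛 hx hy]
    rw [smul_comm, mul_comm ((-1 : k) ^ (e * (i - 1)))])

theorem sgn_ι (e : ℤ) {i : ℤ} {x : L} (hx : x ∈ 𝓛 i) :
    sgn 𝓛 e (ι 𝓛 x) = (-1 : k) ^ (e * (i - 1)) • ι 𝓛 x := by
  simp [sgn, shiftSign_of_mem 𝓛 e hx]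

theorem sgn_sgn_comm (e e' : ℤ) (X : Sym 𝓛) : sgn 𝓛 e (sgn 𝓛 e' X) = sgn 𝓛 e' (sgn 𝓛 e X) := by
  suffices h : (sgn 𝓛 e).comp (sgn 𝓛 e') = (sgn 𝓛 e').comp (sgn 𝓛 e) from
    DFunLike.congr_fun h X
  apply hom_ext
  intro x
  induction x using DirectSum.Decomposition.inductionOn 𝓛 with
  | zero => simp
  | homogeneous x => simp [sgn_ι 𝓛 _ x.2, smul_smul, mul_comm]
  | add x y hx hy => simp only [map_add, hx, hy]

/-- Left multiplication by `v ⊗ 1 + 1 ⊗ v` on the graded tensor square of `S(s⁻¹L)`: for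
`v ∈ Lⁱ` it sends `a ⊗ b` to `v a ⊗ b + (-1)^((i-1)|a|) a ⊗ v b`. -/
def primMul : L →ₗ[k] Module.End k (Sym 𝓛 ⊗[k] Sym 𝓛) :=
  DirectSum.toModule k ℤ _ (fun i =>
      (LinearMap.rTensorHom (Sym 𝓛) ∘ₗ LinearMap.mul k (Sym 𝓛) ∘ₗ ι 𝓛 +
        TensorProduct.mapBilinear (RingHom.id k) (Sym 𝓛) (Sym 𝓛) (Sym 𝓛) (Sym 𝓛)
          (sgn 𝓛 (i - 1)).toLinearMap ∘ₗ LinearMap.mul k (Sym 𝓛) ∘ₗ ι 𝓛) ∘ₗ (𝓛 i).subtype) ∘ₗ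
    (DirectSum.decomposeLinearEquiv 𝓛).toLinearMap

theorem primMul_tmul {i : ℤ} {v : L} (hv : v ∈ 𝓛 i) (a b : Sym 𝓛) :
    primMul 𝓛 v (a ⊗ₜ b) = (ι 𝓛 v * a) ⊗ₜ b + sgn 𝓛 (i - 1) a ⊗ₜ (ι 𝓛 v * b) := by
  lift v to 𝓛 i using hv
  rw [primMul, LinearMap.comp_apply, LinearEquiv.coe_coe, DirectSum.decomposeLinearEquiv_apply,
    DirectSum.decompose_coe, ← DirectSum.lof_eq_of k, DirectSum.toModule_lof]
  simp

theorem primMul_comm (i j : ℤ) (u v : L) (hu : u ∈ 𝓛 i) (hv : v ∈ 𝓛 j) :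
    primMul 𝓛 u * primMul 𝓛 v =
      (-1 : k) ^ ((i - 1) * (j - 1)) • (primMul 𝓛 v * primMul 𝓛 u) := by
  have hsq : (-1 : k) ^ ((i - 1) * (j - 1)) * (-1 : k) ^ ((i - 1) * (j - 1)) = 1 := by
    rw [← mul_zpow]; simp
  apply TensorProduct.ext'
  intro a b
  simp only [Module.End.mul_apply, LinearMap.smul_apply, primMul_tmul 𝓛 hu, primMul_tmul 𝓛 hv,
    map_add, map_mul, sgn_ι 𝓛 _ hu, sgn_ι 𝓛 _ hv, smul_add, ← mul_assoc, ι_mul_ι 𝓛 hu hv,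
    smul_mul_assoc, TensorProduct.smul_tmul', TensorProduct.tmul_smul]
  rw [mul_comm (j - 1) (i - 1), smul_smul, hsq, one_smul, sgn_sgn_comm 𝓛 (i - 1) (j - 1)]
  abel

/-- The coproduct of `S(s⁻¹L)`: the morphism of algebras to the graded tensor square with
`v ↦ v ⊗ 1 + 1 ⊗ v` on generators. -/
def symComul : Sym 𝓛 →ₗ[k] Sym 𝓛 ⊗[k] Sym 𝓛 :=
  LinearMap.applyₗ ((1 : Sym 𝓛) ⊗ₜ[k] (1 : Sym 𝓛)) ∘ₗ
    (lift 𝓛 (primMul 𝓛) (primMul_comm 𝓛)).toLinearMap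

/-- The coproduct of `C(L)`: the part of the coproduct of `S(s⁻¹L)` in which both tensor
factors are non-constant. -/
def comul : C 𝓛 →ₗ[k] C 𝓛 ⊗[k] C 𝓛 :=
  TensorProduct.map (red 𝓛) (red 𝓛) ∘ₗ symComul 𝓛 ∘ₗ incl 𝓛

/-- Multiplication by `(-1)^(e d)` on the degree `d` component of `C(L)`. -/
def csgn (e : ℤ) : C 𝓛 →ₗ[k] C 𝓛 := red 𝓛 ∘ₗ (sgn 𝓛 e).toLinearMap ∘ₗ incl 𝓛

/-- The component on `∧ⁿL` of a linear map `f` on `C(L)`, through the identification of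
`γ₁ ∧ ⋯ ∧ γₙ` with `(-1)^(∑ (n-i)(|γᵢ|-1)) s⁻¹γ₁ ⋯ s⁻¹γₙ`. The component for `n = 0` is zero. -/
def component {W : Type*} [AddCommGroup W] [Module k W] (f : C 𝓛 →ₗ[k] W) (n : ℕ)
    (γ : Fin n → L) : W :=
  f (red 𝓛 (word 𝓛 fun j => shiftSign 𝓛 ((n : ℤ) - 1 - (j : ℕ)) (γ j)))

end Coalgebra

section Algebras

variable {k : Type*} [Field k] {L : Type*} [AddCommGroup L] [Module k L]
variable {L' : Type*} [AddCommGroup L'] [Module k L']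

/-- An `L∞`-algebra structure on a graded vector space: a codifferential of degree one on the
cofree coalgebra `C(L)`. -/
structure LInfinityAlgebra (𝓛 : ℤ → Submodule k L) [DirectSum.Decomposition 𝓛] where
  /-- the codifferential -/
  Q : C 𝓛 →ₗ[k] C 𝓛
  degree_one : ∀ (d : ℤ) (X : C 𝓛), (X : Sym 𝓛) ∈ symDeg 𝓛 d → (Q X : Sym 𝓛) ∈ symDeg 𝓛 (d + 1)
  /-- `Δ Q = (Q ⊗ 1 + 1 ⊗ Q) Δ`, where `(1 ⊗ Q)(a ⊗ b) = (-1)^|a| a ⊗ Q b` -/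
  coderivation : comul 𝓛 ∘ₗ Q =
    (TensorProduct.map Q LinearMap.id + TensorProduct.map (csgn 𝓛 1) Q) ∘ₗ comul 𝓛
  square_zero : Q ∘ₗ Q = 0

variable {𝓛 : ℤ → Submodule k L} [DirectSum.Decomposition 𝓛]
variable {𝓛' : ℤ → Submodule k L'} [DirectSum.Decomposition 𝓛']

/-- The structure maps `Qₙ : ∧ⁿL → L`. -/
def LInfinityAlgebra.structureMap (A : LInfinityAlgebra 𝓛) (n : ℕ) (γ : Fin n → L) : L :=
  component 𝓛 (pr 𝓛 ∘ₗ A.Q) n γ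

/-- The differential `Q₁ : L → L`. -/
def LInfinityAlgebra.Q₁ (A : LInfinityAlgebra 𝓛) (x : L) : L := A.structureMap 1 fun _ => x

/-- An `L∞`-morphism: a morphism of differential graded coalgebras `C(L) → C(L')`. -/
structure LInfinityMorphism (A : LInfinityAlgebra 𝓛) (B : LInfinityAlgebra 𝓛') where
  /-- the underlying linear map -/
  map : C 𝓛 →ₗ[k] C 𝓛'
  degree_zero : ∀ (d : ℤ) (X : C 𝓛), (X : Sym 𝓛) ∈ symDeg 𝓛 d → (map X : Sym 𝓛') ∈ symDeg 𝓛' d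
  comul_map : comul 𝓛' ∘ₗ map = TensorProduct.map map map ∘ₗ comul 𝓛
  Q_map : B.Q ∘ₗ map = map ∘ₗ A.Q

variable {A : LInfinityAlgebra 𝓛} {B : LInfinityAlgebra 𝓛'}

/-- The composition `pr ∘ F : C(L) → L'` of an `L∞`-morphism with the projection onto
cogenerators. -/
def LInfinityMorphism.proj (F : LInfinityMorphism A B) : C 𝓛 →ₗ[k] L' := pr 𝓛' ∘ₗ F.map

/-- The structure maps `Fₙ : ∧ⁿL → L'`. -/
def LInfinityMorphism.structureMap (F : LInfinityMorphism A B) (n : ℕ) (γ : Fin n → L) : L' :=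
  component 𝓛 F.proj n γ

/-- `F` is a quasi-isomorphism: `F₁ : (L, Q₁) → (L', Q₁)` is injective and surjective on the
cohomology in each degree. -/
def LInfinityMorphism.IsQuasiIso (F : LInfinityMorphism A B) : Prop :=
  ∀ i : ℤ,
    (∀ x ∈ 𝓛 i, A.Q₁ x = 0 → (∃ y ∈ 𝓛' (i - 1), B.Q₁ y = F.structureMap 1 fun _ => x) →
      ∃ y ∈ 𝓛 (i - 1), A.Q₁ y = x) ∧
    (∀ x' ∈ 𝓛' i, B.Q₁ x' = 0 → ∃ x ∈ 𝓛 i, A.Q₁ x = 0 ∧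
      ∃ y ∈ 𝓛' (i - 1), x' = (F.structureMap 1 fun _ => x) + B.Q₁ y)

variable (𝓛 𝓛') in
/-- The multilinear map `f` is homogeneous of degree `d`. -/
def HasDegree {n : ℕ} (f : MultilinearMap k (fun _ : Fin n => L) L') (d : ℤ) : Prop :=
  ∀ (γ : Fin n → L) (κ : Fin n → ℤ), (∀ i, γ i ∈ 𝓛 (κ i)) → f γ ∈ 𝓛' (∑ i, κ i + d)

variable (𝓛) in
/-- The multilinear map `f` is a map on the graded exterior power `∧ⁿL`:
`f(…, γ, γ', …) = -(-1)^(|γ||γ'|) f(…, γ', γ, …)`. -/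
def IsAntisymmetric {n : ℕ} (f : MultilinearMap k (fun _ : Fin n => L) L') : Prop :=
  ∀ (γ : Fin n → L) (κ : Fin n → ℤ), (∀ i, γ i ∈ 𝓛 (κ i)) →
    ∀ i j : Fin n, (i : ℕ) + 1 = j →
      f γ = -((-1 : k) ^ (κ i * κ j) • f (γ ∘ Equiv.swap i j))

/-! ### The convolution algebra `U = s Hom(C(L), L')`

Its elements are linear maps `C(L) → L'`; an element of degree `κ` raises degrees by `κ - 1`
as a map to `s⁻¹L'`. -/

variable (𝓛 𝓛') in
/-- `f` is an element of degree `κ` of `U`. -/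
def UDegree (κ : ℤ) (f : C 𝓛 →ₗ[k] L') : Prop :=
  ∀ (d : ℤ) (X : C 𝓛), (X : Sym 𝓛) ∈ symDeg 𝓛 d → f X ∈ 𝓛' (d + κ)

variable (𝓛 𝓛') in
/-- For `fᵢ` of degree `κᵢ` in `U` (given as a list of pairs `(κᵢ, fᵢ)`), the map
`X ↦ (f₁ ⊗ ⋯ ⊗ fₙ)(Δ⁽ⁿ⁾ X)`, with the Koszul signs, followed by the multiplication to
`Sⁿ(s⁻¹L')`. -/
def convProd : List (ℤ × (C 𝓛 →ₗ[k] L')) → (C 𝓛 →ₗ[k] Sym 𝓛')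
  | [] => 0
  | [p] => ι 𝓛' ∘ₗ p.2
  | p :: q :: l => LinearMap.mul' k (Sym 𝓛') ∘ₗ
      TensorProduct.map
        (ι 𝓛' ∘ₗ p.2 ∘ₗ csgn 𝓛 ((q :: l).map fun r => r.1 - 1).sum)
        (convProd (q :: l)) ∘ₗ
      comul 𝓛

/-- The exponent `∑ (n-i)(κᵢ-1)` of the sign relating graded symmetric operations on the
desuspension and graded antisymmetric operations. -/
def decalage {W : Type*} : List (ℤ × W) → ℤ
  | [] => 0
  | p :: l => l.length * (p.1 - 1) + decalage l

variable (A B) in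
/-- The structure maps `Qₙ(f₁, …, fₙ)` of the `L∞`-algebra `U` on elements `fᵢ` of degrees `κᵢ`,
given as a list of pairs `(κᵢ, fᵢ)`. For `n = 1` this is the differential of `Hom(C(L), L')`,
for `n ≥ 2` the convolution with the `n`-th structure map of `L'`. -/
def bracket (l : List (ℤ × (C 𝓛 →ₗ[k] L'))) : C 𝓛 →ₗ[k] L' :=
  (-1 : k) ^ decalage l • (pr 𝓛' ∘ₗ B.Q ∘ₗ red 𝓛' ∘ₗ convProd 𝓛 𝓛' l) -
    match l with
    | [p] => (-1 : k) ^ (p.1 - 1) • (p.2 ∘ₗ A.Q)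
    | _ => 0

/-- The series `∑ f m` converges to `v` in the discrete sense: its partial sums are eventually
equal to `v`. -/
def SumsTo {W : Type*} [AddCommMonoid W] (f : ℕ → W) (v : W) : Prop :=
  ∃ N, ∀ M ≥ N, ∑ m ∈ Finset.range M, f m = v

variable (A B) in
/-- `π` is a Maurer-Cartan element of `U`: it has degree one and
`∑_{n ≥ 1} (1/n!) Qₙ(π, …, π) = 0`. -/
def IsMaurerCartan (π : C 𝓛 →ₗ[k] L') : Prop :=
  UDegree 𝓛 𝓛' 1 π ∧ ∀ X : C 𝓛,
    SumsTo (fun n => ((n + 1).factorial : k)⁻¹ • bracket A B (List.replicate (n + 1) (1, π)) X) 0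

variable (A B) in
/-- `η = Q₁^π(ξ) = ∑_{m ≥ 0} (1/m!) Q_{m+1}(π, …, π, ξ)`, the differential of `U` twisted by `π`
applied to an element `ξ` of degree zero. -/
def IsTwistedDifferential (π ξ η : C 𝓛 →ₗ[k] L') : Prop :=
  ∀ X : C 𝓛, SumsTo
    (fun m => (m.factorial : k)⁻¹ • bracket A B (List.replicate m (1, π) ++ [(0, ξ)]) X) (η X)

variable (A B) in
/-- `α` is a path of Maurer-Cartan elements of `U` with `dα_t/dt = Q₁^{α_t}(ξ)`. Here
`α_t = ∑ tʲ aⱼ`, where for each `m` only finitely many `aⱼ` are nonzero on words of length `m`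
(that is, the path is polynomial in `t` modulo each step of the filtration of `U`). -/
def IsGaugeFlow (ξ : C 𝓛 →ₗ[k] L') (α : k → (C 𝓛 →ₗ[k] L')) : Prop :=
  (∀ t, IsMaurerCartan A B (α t)) ∧
  ∃ a : ℕ → (C 𝓛 →ₗ[k] L'),
    (∀ m : ℕ, ∃ N, ∀ j ≥ N, ∀ γ : Fin m → L, a j (red 𝓛 (word 𝓛 γ)) = 0) ∧
    (∀ t X, SumsTo (fun j => t ^ j • a j X) (α t X)) ∧
    ∀ t, ∃ η : C 𝓛 →ₗ[k] L',
      (∀ X, SumsTo (fun j => ((j + 1 : k) * t ^ j) • a (j + 1) X) (η X)) ∧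
      IsTwistedDifferential A B (α t) ξ η

end Algebras

end LInfty

end

/-! The gauge flow is nonlinear in the cogenerator projection `α`, but it becomes linear when lifted
to maps of coalgebras. Extend everything to the unital coalgebra `S(s⁻¹L)`, the codifferentials by
zero and the morphisms by `1 ↦ 1`. For `ξ` of degree `-1` as a map to `s⁻¹L'`, the signed
convolution `h(Φ) = (Φ ∘ parity) * ξ` (`coderAlong`) is linear in `Φ`, and for a coalgebra morphism
`Φ` it is the coderivation along `Φ` with corestriction `ξ`. Put `D(Φ) = Q' h(Φ) + h(Φ) Q`
(`gaugeOp`). The equation `dΦ/dt = D(Φ)` is solved by `exp(tD) F`, whose Taylor coefficients are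
`gaugeCoeff`.

This exponential is a morphism of differential graded coalgebras. It commutes with the
codifferentials because they square to zero. It respects coproducts because `D` satisfies a Leibniz
rule (`symComul_gaugeOp`), which rests on cocommutativity. It is locally finite because convolution
with `ξ` uses up `n` letters while a codifferential never lengthens words: the `j`-th coefficient
vanishes on words shorter than `j n` (`vanishesBelow_gaugeCoeff`), so the flow is polynomial in `t`
on each word length.

To return to the convolution algebra, note that in characteristic zero the identity of `S(s⁻¹L)` is
the convolution exponential of the projection onto generators (`sum_wordProj`). Hence a coalgebra
morphism is the exponential of its projection `α`. Through this formula the corestriction of `Q' Φ =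
Φ Q` is the Maurer-Cartan equation for `α`, and the corestriction of `D(Φ)` is the twisted
differential of `ξ`.

On words shorter than `n` only the initial value `F` survives. On words of length `n` the term
`D(F)` also survives; there `h(F)` is just `ξ`, and `ξ Q` sees only the length-preserving part of
`Q`, the derivation extending `Q₁`. This is the stated formula. The linear component changes only
for `n = 1`, and then by a chain homotopy, so the endpoint is again a quasi-isomorphism. -/

noncomputable section

namespace LInfty

/-! ### Generators, parity and augmentation of `S(s⁻¹L)` -/

section Basic

variable {k : Type*} [Field k] {L : Type*} [AddCommGroup L] [Module k L]
variable {𝓛 : ℤ → Submodule k L}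

theorem mk_surjective : Function.Surjective (mk 𝓛) := fun X => Quotient.exists_rep X

variable [DirectSum.Decomposition 𝓛]

theorem generator_induction {P : L → Prop} (add : ∀ x y, P x → P y → P (x + y))
    (hom : ∀ (i : ℤ) (v : L), v ∈ 𝓛 i → P v) (x : L) : P x := by
  induction x using DirectSum.Decomposition.inductionOn 𝓛 with
  | zero => exact hom 0 0 (zero_mem _)
  | homogeneous x => exact hom _ _ x.2
  | add x y hx hy => exact add _ _ hx hy

theorem sym_induction {P : Sym 𝓛 → Prop} (one : P 1) (add : ∀ X Y, P X → P Y → P (X + Y))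
    (smul : ∀ (c : k) X, P X → P (c • X))
    (mul : ∀ (i : ℤ) (v : L), v ∈ 𝓛 i → ∀ X, P X → P (ι 𝓛 v * X)) (X : Sym 𝓛) : P X := by
  -- Stability of `P` under left multiplication by every tensor is what an induction on the tensor
  -- algebra can prove, since it composes in the product case.
  have key : ∀ (a : TensorAlgebra k L) (X : Sym 𝓛), P X → P (mk 𝓛 a * X) := by
    intro a
    induction a using TensorAlgebra.induction with
    | algebraMap r =>
      intro X hX
      rw [AlgHom.commutes, ← Algebra.smul_def]
      exact smul r X hX
    | ι x =>
      intro X hX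
      exact generator_induction (𝓛 := 𝓛) (P := fun x => P (ι 𝓛 x * X))
        (fun x y hx hy => by rw [map_add, add_mul]; exact add _ _ hx hy)
        (fun i v hv => mul i v hv X hX) x
    | mul a b ha hb =>
      intro X hX
      rw [map_mul, mul_assoc]
      exact ha _ (hb _ hX)
    | add a b ha hb =>
      intro X hX
      rw [map_add, add_mul]
      exact add _ _ (ha _ hX) (hb _ hX)
  obtain ⟨a, rfl⟩ := mk_surjective X
  simpa using key a 1 one

theorem sym_linearMap_ext {W : Type*} [AddCommGroup W] [Module k W] {f g : Sym 𝓛 →ₗ[k] W}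
    (one : f 1 = g 1)
    (mul : ∀ (i : ℤ) (v : L), v ∈ 𝓛 i → ∀ X, f X = g X → f (ι 𝓛 v * X) = g (ι 𝓛 v * X)) :
    f = g :=
  LinearMap.ext fun X => sym_induction (P := fun X => f X = g X) one
    (fun X Y hX hY => by rw [map_add, map_add, hX, hY])
    (fun c X hX => by rw [map_smul, map_smul, hX]) mul X

omit [DirectSum.Decomposition 𝓛] in
@[simp] theorem aug_ι (v : L) : aug 𝓛 (ι 𝓛 v) = 0 := by simp [aug]

omit [DirectSum.Decomposition 𝓛] in
theorem symProj_ι_mul (v : L) (X : Sym 𝓛) : symProj 𝓛 (ι 𝓛 v * X) = aug 𝓛 X • v := by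
  -- The same right action as in the definition of `symProj`, so that the two sides unfold to the
  -- same square-zero extension.
  let _ : Module kᵐᵒᵖ L := Module.compHom _ ((RingHom.id k).fromOpposite mul_comm)
  have _ : IsCentralScalar k L := ⟨fun _ _ => rfl⟩
  have h : (TrivSqZeroExt.fstHom k k L).comp
      (lift 𝓛 (TrivSqZeroExt.inrHom k L) (by intros; simp)) = aug 𝓛 := by
    apply hom_ext
    intro x
    simp
  have h' := DFunLike.congr_fun h X
  simp only [AlgHom.comp_apply, TrivSqZeroExt.fstHom_apply] at h'
  simp only [symProj, LinearMap.comp_apply, AlgHom.toLinearMap_apply, map_mul, lift_ι,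
    TrivSqZeroExt.sndHom_apply, TrivSqZeroExt.snd_mul, TrivSqZeroExt.inrHom_apply,
    TrivSqZeroExt.fst_inr, TrivSqZeroExt.snd_inr, h', zero_smul, zero_add]
  rfl

omit [DirectSum.Decomposition 𝓛] in
@[simp] theorem symProj_one : symProj 𝓛 1 = 0 :=
  let _ : Module kᵐᵒᵖ L := Module.compHom _ ((RingHom.id k).fromOpposite mul_comm)
  have _ : IsCentralScalar k L := ⟨fun _ _ => rfl⟩
  congrArg TrivSqZeroExt.snd (map_one (lift 𝓛 (TrivSqZeroExt.inrHom k L) (by intros; simp)))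

omit [DirectSum.Decomposition 𝓛] in
@[simp] theorem symProj_ι (v : L) : symProj 𝓛 (ι 𝓛 v) = v := by
  simpa using symProj_ι_mul (𝓛 := 𝓛) v 1

theorem symProj_mul (X Y : Sym 𝓛) :
    symProj 𝓛 (X * Y) = aug 𝓛 X • symProj 𝓛 Y + aug 𝓛 Y • symProj 𝓛 X := by
  induction X using sym_induction with
  | one => simp
  | add X Z hX hZ => rw [add_mul, map_add, hX, hZ, map_add, map_add]; module
  | smul c X hX => rw [smul_mul_assoc, map_smul, hX, map_smul, map_smul, smul_eq_mul]; module
  | mul i v hv X hX => simp [mul_assoc, symProj_ι_mul, mul_comm, smul_smul]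

theorem sgn_sgn (e e' : ℤ) (X : Sym 𝓛) : sgn 𝓛 e (sgn 𝓛 e' X) = sgn 𝓛 (e + e') X := by
  suffices h : (sgn 𝓛 e).comp (sgn 𝓛 e') = sgn 𝓛 (e + e') from DFunLike.congr_fun h X
  apply hom_ext
  intro x
  induction x using generator_induction (𝓛 := 𝓛) with
  | add x y hx hy => rw [map_add, map_add, map_add, hx, hy]
  | hom i v hv =>
    rw [AlgHom.comp_apply, sgn_ι 𝓛 e' hv, map_smul, sgn_ι 𝓛 e hv, sgn_ι 𝓛 _ hv, smul_smul,
      ← zpow_add₀ (neg_ne_zero.2 one_ne_zero)]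
    congr 2
    ring

theorem sgn_of_even {e : ℤ} (he : Even e) (X : Sym 𝓛) : sgn 𝓛 e X = X := by
  suffices h : sgn 𝓛 e = AlgHom.id k _ from DFunLike.congr_fun h X
  apply hom_ext
  intro x
  induction x using generator_induction (𝓛 := 𝓛) with
  | add x y hx hy => rw [map_add, map_add, map_add, hx, hy]
  | hom i v hv =>
    rw [sgn_ι 𝓛 e hv, (he.mul_right _).neg_one_zpow, one_smul, AlgHom.id_apply]

theorem sgn_of_odd {e : ℤ} (he : Odd e) (X : Sym 𝓛) : sgn 𝓛 e X = sgn 𝓛 1 X := by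
  obtain ⟨j, rfl⟩ := he
  rw [← sgn_sgn, sgn_of_even (even_two_mul j)]

@[simp] theorem parity_parity (X : Sym 𝓛) : sgn 𝓛 1 (sgn 𝓛 1 X) = X := by
  rw [sgn_sgn, sgn_of_even ⟨1, rfl⟩]

@[simp] theorem aug_sgn (e : ℤ) (X : Sym 𝓛) : aug 𝓛 (sgn 𝓛 e X) = aug 𝓛 X := by
  suffices h : (aug 𝓛).comp (sgn 𝓛 e) = aug 𝓛 from DFunLike.congr_fun h X
  apply hom_ext
  intro x
  simp [sgn]

/-- The left multiplication by a generator which is homogeneous, hence even or odd. -/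
theorem generator_parity {i : ℤ} {v : L} (hv : v ∈ 𝓛 i) :
    (Even (i - 1) ∧ sgn 𝓛 1 (ι 𝓛 v) = ι 𝓛 v ∧ (∀ x, ι 𝓛 x * ι 𝓛 v = ι 𝓛 v * ι 𝓛 x) ∧
      ∀ a b, primMul 𝓛 v (a ⊗ₜ b) = (ι 𝓛 v * a) ⊗ₜ b + a ⊗ₜ (ι 𝓛 v * b)) ∨
    (Odd (i - 1) ∧ sgn 𝓛 1 (ι 𝓛 v) = -ι 𝓛 v ∧
      (∀ x, sgn 𝓛 1 (ι 𝓛 x) * ι 𝓛 v = ι 𝓛 v * ι 𝓛 x) ∧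
      ∀ a b, primMul 𝓛 v (a ⊗ₜ b) = (ι 𝓛 v * a) ⊗ₜ b + sgn 𝓛 1 a ⊗ₜ (ι 𝓛 v * b)) := by
  rcases Int.even_or_odd (i - 1) with h | h
  · refine Or.inl ⟨h, ?_, fun x => ?_, fun a b => ?_⟩
    · rw [sgn_ι 𝓛 1 hv, one_mul, h.neg_one_zpow, one_smul]
    · induction x using generator_induction (𝓛 := 𝓛) with
 | add x y hx hy => rw [map_add, add_mul, mul_add, hx, hy]
 | hom j x hx =>
        rw [ι_mul_ι 𝓛 hx hv, (h.mul_left _).neg_one_zpow, one_smul]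
    · rw [primMul_tmul 𝓛 hv, sgn_of_even h]
  · refine Or.inr ⟨h, ?_, fun x => ?_, fun a b => ?_⟩
    · rw [sgn_ι 𝓛 1 hv, one_mul, h.neg_one_zpow, neg_one_smul]
    · induction x using generator_induction (𝓛 := 𝓛) with
 | add x y hx hy => rw [map_add, map_add, add_mul, mul_add, hx, hy]
 | hom j x hx =>
        rw [sgn_ι 𝓛 1 hx, smul_mul_assoc, ι_mul_ι 𝓛 hx hv, smul_smul, one_mul,
          ← zpow_add₀ (neg_ne_zero.2 one_ne_zero), Even.neg_one_zpow, one_smul]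
        have : j - 1 + (j - 1) * (i - 1) = (j - 1) * ((i - 1) + 1) := by ring
        rw [this]
        exact (h.add_odd odd_one).mul_left _
    · rw [primMul_tmul 𝓛 hv, sgn_of_odd h]

@[simp] theorem symComul_one : symComul 𝓛 1 = 1 ⊗ₜ 1 := by
  simp [symComul, LinearMap.comp_apply]

@[simp] theorem symComul_ι_mul (v : L) (X : Sym 𝓛) :
    symComul 𝓛 (ι 𝓛 v * X) = primMul 𝓛 v (symComul 𝓛 X) := by
  simp [symComul, LinearMap.comp_apply]

end Basic

/-! ### Counit and coassociativity of the unital coalgebra -/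

section Coalgebra

variable {k : Type*} [Field k] {L : Type*} [AddCommGroup L] [Module k L]
variable {𝓛 : ℤ → Submodule k L} [DirectSum.Decomposition 𝓛]

/-- An identity between linear maps on `S ⊗ S` passes from `Z` to `primMul v Z` once it
does so on pure tensors. -/
theorem apply_symComul_ι_mul {W W' : Type*} [AddCommGroup W] [Module k W] [AddCommGroup W']
    [Module k W'] (f : Sym 𝓛 ⊗[k] Sym 𝓛 →ₗ[k] W) (f' : Sym 𝓛 ⊗[k] Sym 𝓛 →ₗ[k] W')
    (g : W' →ₗ[k] W) (v : L) (X : Sym 𝓛)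
    (h : ∀ a b, f (primMul 𝓛 v (a ⊗ₜ b)) = g (f' (a ⊗ₜ b))) :
    f (symComul 𝓛 (ι 𝓛 v * X)) = g (f' (symComul 𝓛 X)) := by
  rw [symComul_ι_mul]
  have : f ∘ₗ primMul 𝓛 v = g ∘ₗ f' := TensorProduct.ext' h
  exact DFunLike.congr_fun this _

theorem symComul_sgn (e : ℤ) (X : Sym 𝓛) : symComul 𝓛 (sgn 𝓛 e X) =
    TensorProduct.map (sgn 𝓛 e).toLinearMap (sgn 𝓛 e).toLinearMap (symComul 𝓛 X) := by
  suffices h : symComul 𝓛 ∘ₗ (sgn 𝓛 e).toLinearMap =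
    TensorProduct.map (sgn 𝓛 e).toLinearMap (sgn 𝓛 e).toLinearMap ∘ₗ symComul 𝓛 from
    DFunLike.congr_fun h X
  refine sym_linearMap_ext (by simp) fun i v hv X hX => ?_
  simp only [LinearMap.comp_apply, AlgHom.toLinearMap_apply] at hX ⊢
  rw [map_mul, sgn_ι 𝓛 e hv, smul_mul_assoc, map_smul, symComul_ι_mul, hX,
    apply_symComul_ι_mul _ (TensorProduct.map (sgn 𝓛 e).toLinearMap (sgn 𝓛 e).toLinearMap)
      ((-1 : k) ^ (e * (i - 1)) • primMul 𝓛 v)]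
  · rfl
  · intro a b
    simp only [primMul_tmul 𝓛 hv, map_add, TensorProduct.map_tmul, AlgHom.toLinearMap_apply,
      map_mul, sgn_ι 𝓛 e hv, LinearMap.smul_apply, smul_add, smul_mul_assoc,
      TensorProduct.smul_tmul', TensorProduct.tmul_smul, sgn_sgn_comm 𝓛 e]

theorem rTensor_aug_symComul (X : Sym 𝓛) :
    TensorProduct.lid k _ ((aug 𝓛).toLinearMap.rTensor _ (symComul 𝓛 X)) = X := by
  suffices h : (TensorProduct.lid k _).toLinearMap ∘ₗ (aug 𝓛).toLinearMap.rTensor _ ∘ₗ symComul 𝓛 =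
    LinearMap.id from DFunLike.congr_fun h X
  refine sym_linearMap_ext (by simp) fun i v hv X hX => ?_
  refine (apply_symComul_ι_mul ((TensorProduct.lid k _).toLinearMap ∘ₗ
    (aug 𝓛).toLinearMap.rTensor _) ((TensorProduct.lid k _).toLinearMap ∘ₗ
    (aug 𝓛).toLinearMap.rTensor _) (LinearMap.mulLeft k (ι 𝓛 v)) v X ?_).trans ?_
  · intro a b
    simp [primMul_tmul 𝓛 hv]
  · exact congrArg (ι 𝓛 v * ·) hX

theorem lTensor_aug_symComul (X : Sym 𝓛) :
    TensorProduct.rid k _ ((aug 𝓛).toLinearMap.lTensor _ (symComul 𝓛 X)) = X := by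
  suffices h : (TensorProduct.rid k _).toLinearMap ∘ₗ (aug 𝓛).toLinearMap.lTensor _ ∘ₗ symComul 𝓛 =
    LinearMap.id from DFunLike.congr_fun h X
  refine sym_linearMap_ext (by simp) fun i v hv X hX => ?_
  refine (apply_symComul_ι_mul ((TensorProduct.rid k _).toLinearMap ∘ₗ
    (aug 𝓛).toLinearMap.lTensor _) ((TensorProduct.rid k _).toLinearMap ∘ₗ
    (aug 𝓛).toLinearMap.lTensor _) (LinearMap.mulLeft k (ι 𝓛 v)) v X ?_).trans ?_
  · intro a b
    simp [primMul_tmul 𝓛 hv]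
  · exact congrArg (ι 𝓛 v * ·) hX

theorem symComul_coassoc (X : Sym 𝓛) :
    TensorProduct.assoc k _ _ _ ((symComul 𝓛).rTensor _ (symComul 𝓛 X)) =
      (symComul 𝓛).lTensor _ (symComul 𝓛 X) := by
  suffices h : (TensorProduct.assoc k _ _ _).toLinearMap ∘ₗ (symComul 𝓛).rTensor _ ∘ₗ symComul 𝓛 =
    (symComul 𝓛).lTensor _ ∘ₗ symComul 𝓛 from DFunLike.congr_fun h X
  refine sym_linearMap_ext (by simp) fun i v hv X hX => ?_
  -- `M` is left multiplication by `v ⊗ 1 ⊗ 1 + 1 ⊗ v ⊗ 1 + 1 ⊗ 1 ⊗ v`. Both iterated coproducts of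
  -- `v X` are `M` applied to those of `X`.
  let M : Sym 𝓛 ⊗[k] (Sym 𝓛 ⊗[k] Sym 𝓛) →ₗ[k] Sym 𝓛 ⊗[k] (Sym 𝓛 ⊗[k] Sym 𝓛) :=
    TensorProduct.map (LinearMap.mulLeft k (ι 𝓛 v)) LinearMap.id +
      TensorProduct.map (sgn 𝓛 (i - 1)).toLinearMap (primMul 𝓛 v)
  have h1 := apply_symComul_ι_mul ((symComul 𝓛).lTensor (Sym 𝓛)) ((symComul 𝓛).lTensor _) M v X (by
    intro a b
    simp [primMul_tmul 𝓛 hv, M])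
  have h2 := apply_symComul_ι_mul
    ((TensorProduct.assoc k _ _ _).toLinearMap ∘ₗ (symComul 𝓛).rTensor (Sym 𝓛))
    ((TensorProduct.assoc k _ _ _).toLinearMap ∘ₗ (symComul 𝓛).rTensor _) M v X (by
    intro a b
    simp only [primMul_tmul 𝓛 hv, LinearMap.comp_apply, map_add, LinearMap.rTensor_tmul,
      symComul_ι_mul, symComul_sgn]
    have : ∀ Z : Sym 𝓛 ⊗[k] Sym 𝓛,
        (TensorProduct.assoc k _ _ _) (primMul 𝓛 v Z ⊗ₜ[k] b) + (TensorProduct.assoc k _ _ _)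
          ((TensorProduct.map (sgn 𝓛 (i - 1)).toLinearMap (sgn 𝓛 (i - 1)).toLinearMap Z) ⊗ₜ[k]
            (ι 𝓛 v * b)) = M ((TensorProduct.assoc k _ _ _) (Z ⊗ₜ[k] b)) := by
      intro Z
      induction Z using TensorProduct.induction_on with
      | zero => simp
      | add Z Z' hZ hZ' =>
        simp only [map_add, TensorProduct.add_tmul, ← hZ, ← hZ']
        abel
      | tmul x y =>
        simp [M, primMul_tmul 𝓛 hv, TensorProduct.add_tmul, TensorProduct.tmul_add, add_assoc]
    exact this _)
  exact h2.trans ((congrArg M hX).trans h1.symm)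

end Coalgebra

/-! ### Graded cocommutativity and right multiplication by generators -/

section Cocommutative

variable {k : Type*} [Field k] {L : Type*} [AddCommGroup L] [Module k L]
variable (𝓛 : ℤ → Submodule k L) [DirectSum.Decomposition 𝓛]

/-- The parity automorphism `X ↦ (-1)^|X| X`. -/
def parity : Sym 𝓛 →ₗ[k] Sym 𝓛 := (sgn 𝓛 1).toLinearMap

/-- The graded flip `a ⊗ b ↦ (-1)^(|a||b|) b ⊗ a`, which depends only on parities. -/
def gradedFlip : Sym 𝓛 ⊗[k] Sym 𝓛 →ₗ[k] Sym 𝓛 ⊗[k] Sym 𝓛 :=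
  -- With `p` the parity, `(1 + p ⊗ 1 + 1 ⊗ p - p ⊗ p) / 2` is `-1` on odd ⊗ odd and `1` on the
  -- other three types, which is the Koszul sign.
  (TensorProduct.comm k _ _).toLinearMap ∘ₗ ((2 : k)⁻¹ • (LinearMap.id +
    TensorProduct.map (parity 𝓛) LinearMap.id + TensorProduct.map LinearMap.id (parity 𝓛) -
      TensorProduct.map (parity 𝓛) (parity 𝓛)))

variable {𝓛}

theorem parity_apply (X : Sym 𝓛) : parity 𝓛 X = sgn 𝓛 1 X := rfl

theorem gradedFlip_tmul (a b : Sym 𝓛) : gradedFlip 𝓛 (a ⊗ₜ b) = (2 : k)⁻¹ •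
    (b ⊗ₜ a + b ⊗ₜ sgn 𝓛 1 a + sgn 𝓛 1 b ⊗ₜ a - sgn 𝓛 1 b ⊗ₜ sgn 𝓛 1 a) := by
  simp [gradedFlip, parity]

section

variable [CharZero k]

theorem smul_two_inv_cancel {W : Type*} [AddCommGroup W] [Module k W] (w : W) :
    (2 : k)⁻¹ • (w + w) = w := by
  rw [← two_smul k w, smul_smul, inv_mul_cancel₀ two_ne_zero, one_smul]

theorem gradedFlip_even {b : Sym 𝓛} (hb : sgn 𝓛 1 b = b) (a : Sym 𝓛) :
    gradedFlip 𝓛 (a ⊗ₜ b) = b ⊗ₜ a := by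
  rw [gradedFlip_tmul, hb]
  convert smul_two_inv_cancel (k := k) (b ⊗ₜ[k] a) using 2
  abel

theorem gradedFlip_odd {b : Sym 𝓛} (hb : sgn 𝓛 1 b = -b) (a : Sym 𝓛) :
    gradedFlip 𝓛 (a ⊗ₜ b) = b ⊗ₜ sgn 𝓛 1 a := by
  rw [gradedFlip_tmul, hb, TensorProduct.neg_tmul, TensorProduct.neg_tmul]
  convert smul_two_inv_cancel (k := k) (b ⊗ₜ[k] sgn 𝓛 1 a) using 2
  abel

end

theorem gradedFlip_primMul {i : ℤ} {v : L} (hv : v ∈ 𝓛 i) (a b : Sym 𝓛) :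
    gradedFlip 𝓛 (primMul 𝓛 v (a ⊗ₜ b)) = primMul 𝓛 v (gradedFlip 𝓛 (a ⊗ₜ b)) := by
  rcases generator_parity hv with ⟨-, hs, -, hp⟩ | ⟨-, hs, -, hp⟩
  · simp only [hp, map_add, gradedFlip_tmul, map_smul, map_sub, map_mul, hs]
    rw [← smul_add]
    congr 1
    abel
  · simp only [hp, map_add, gradedFlip_tmul, map_smul, map_sub, map_mul, hs, parity_parity,
      neg_mul, TensorProduct.tmul_neg, TensorProduct.neg_tmul]
    rw [← smul_add]
    congr 1
    abel

/-- The flip fixes `1 ⊗ 1` and commutes with multiplication by the primitive element `v ⊗ 1 + 1 ⊗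
v`, and the coproduct is generated from these. -/
theorem symComul_cocomm [CharZero k] (X : Sym 𝓛) :
    gradedFlip 𝓛 (symComul 𝓛 X) = symComul 𝓛 X := by
  suffices h : gradedFlip 𝓛 ∘ₗ symComul 𝓛 = symComul 𝓛 from DFunLike.congr_fun h X
  refine sym_linearMap_ext ?_ fun i v hv X hX => ?_
  · simp [gradedFlip_even (map_one (sgn 𝓛 1))]
  · refine (apply_symComul_ι_mul (gradedFlip 𝓛) (gradedFlip 𝓛) (primMul 𝓛 v) v X
      (gradedFlip_primMul hv)).trans ?_
    rw [symComul_ι_mul]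
    exact congrArg (primMul 𝓛 v) hX

/-- Naturality of the flip for an odd `f` and an even `g`; the parity on `b` is the sign for moving
`f` past it. It serves to carry an odd corestriction across an even map. -/
theorem gradedFlip_map {L' : Type*} [AddCommGroup L'] [Module k L']
    {𝓛' : ℤ → Submodule k L'} [DirectSum.Decomposition 𝓛'] {f g : Sym 𝓛 →ₗ[k] Sym 𝓛'}
    (hf : ∀ X, sgn 𝓛' 1 (f X) = -f (sgn 𝓛 1 X)) (hg : ∀ X, sgn 𝓛' 1 (g X) = g (sgn 𝓛 1 X))
    (b c : Sym 𝓛) :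
    gradedFlip 𝓛' (g (sgn 𝓛 1 b) ⊗ₜ f c) = TensorProduct.map f g (gradedFlip 𝓛 (b ⊗ₜ c)) := by
  simp only [gradedFlip_tmul, hf, hg, parity_parity, map_smul, map_add, map_sub,
    TensorProduct.map_tmul, TensorProduct.neg_tmul]
  congr 1
  abel

variable (𝓛)

/-- Right multiplication of the graded tensor square by `v ⊗ 1 + 1 ⊗ v`, as a linear map in
both arguments. -/
def rightPrimMul : (Sym 𝓛 ⊗[k] Sym 𝓛) ⊗[k] L →ₗ[k] Sym 𝓛 ⊗[k] Sym 𝓛 :=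
  ((LinearMap.mul' k (Sym 𝓛)).rTensor _ ∘ₗ (TensorProduct.assoc k _ _ _).symm.toLinearMap ∘ₗ
    (gradedFlip 𝓛 ∘ₗ (ι 𝓛).lTensor _).lTensor _ +
    (LinearMap.mul' k (Sym 𝓛) ∘ₗ (ι 𝓛).lTensor _).lTensor _) ∘ₗ
    (TensorProduct.assoc k _ _ _).toLinearMap

variable {𝓛} [CharZero k]

theorem rightPrimMul_tmul {i : ℤ} {v : L} (hv : v ∈ 𝓛 i) (a b : Sym 𝓛) :
    rightPrimMul 𝓛 ((a ⊗ₜ b) ⊗ₜ v) =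
      (a * ι 𝓛 v) ⊗ₜ sgn 𝓛 (i - 1) b + a ⊗ₜ (b * ι 𝓛 v) := by
  rcases generator_parity hv with ⟨he, hs, -, -⟩ | ⟨he, hs, -, -⟩
  · simp [rightPrimMul, gradedFlip_even hs, sgn_of_even he]
  · simp [rightPrimMul, gradedFlip_odd hs, sgn_of_odd he]

/-- The coproduct is defined by recursion on left factors, whereas `coderAlong` multiplies by `ξ` on
the right. The two kinds of multiplication by primitive elements commute, so the recursion also
yields the rule for right factors. -/
theorem symComul_mul_ι (X : Sym 𝓛) (v : L) :
    symComul 𝓛 (X * ι 𝓛 v) = rightPrimMul 𝓛 (symComul 𝓛 X ⊗ₜ v) := by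
  induction v using generator_induction (𝓛 := 𝓛) with
  | add x y hx hy => rw [map_add, mul_add, map_add, TensorProduct.tmul_add, map_add, hx, hy]
  | hom i v hv =>
  suffices h : symComul 𝓛 ∘ₗ LinearMap.mulRight k (ι 𝓛 v) =
      rightPrimMul 𝓛 ∘ₗ (TensorProduct.mk k _ _).flip v ∘ₗ symComul 𝓛 from DFunLike.congr_fun h X
  refine sym_linearMap_ext ?_ fun j u hu X hX => ?_
  · have := symComul_ι_mul (𝓛 := 𝓛) v 1
    rw [mul_one, symComul_one, primMul_tmul 𝓛 hv] at this
    simp [rightPrimMul_tmul hv, this]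
  · have h1 := apply_symComul_ι_mul (rightPrimMul 𝓛 ∘ₗ (TensorProduct.mk k _ _).flip v)
      (rightPrimMul 𝓛 ∘ₗ (TensorProduct.mk k _ _).flip v) (primMul 𝓛 u) u X (by
      intro a b
      simp only [primMul_tmul 𝓛 hu, LinearMap.comp_apply, LinearMap.flip_apply, map_add,
        TensorProduct.mk_apply, rightPrimMul_tmul hv, map_mul, sgn_ι 𝓛 _ hu, sgn_ι 𝓛 _ hv,
        TensorProduct.smul_tmul', TensorProduct.tmul_smul, mul_smul_comm, smul_mul_assoc, mul_assoc, mul_comm (j - 1)]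
      abel)
    simp only [LinearMap.comp_apply, LinearMap.mulRight_apply] at hX h1 ⊢
    rw [h1, mul_assoc, symComul_ι_mul, hX]

end Cocommutative

/-! ### The convolution algebra of linear maps -/

section Convolution

variable {k : Type*} [Field k] {L : Type*} [AddCommGroup L] [Module k L]
variable {𝓛 : ℤ → Submodule k L} [DirectSum.Decomposition 𝓛]
variable {R : Type*} [Ring R] [Algebra k R]

/-- The convolution product (without signs) of linear maps from `S(s⁻¹L)` to an algebra. -/
def conv (f g : Sym 𝓛 →ₗ[k] R) : Sym 𝓛 →ₗ[k] R :=
  LinearMap.mul' k R ∘ₗ TensorProduct.map f g ∘ₗ symComul 𝓛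

variable (𝓛 R) in
/-- The unit of the convolution product. -/
def convOne : Sym 𝓛 →ₗ[k] R := Algebra.linearMap k R ∘ₗ (aug 𝓛).toLinearMap

theorem conv_apply (f g : Sym 𝓛 →ₗ[k] R) (X : Sym 𝓛) :
    conv f g X = LinearMap.mul' k R (TensorProduct.map f g (symComul 𝓛 X)) := rfl

omit [DirectSum.Decomposition 𝓛] in
theorem convOne_apply (X : Sym 𝓛) : convOne 𝓛 R X = algebraMap k R (aug 𝓛 X) := rfl

@[simp] theorem conv_one_apply (f g : Sym 𝓛 →ₗ[k] R) : conv f g 1 = f 1 * g 1 := by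
  simp [conv_apply]

theorem conv_add_left (f f' g : Sym 𝓛 →ₗ[k] R) : conv (f + f') g = conv f g + conv f' g := by
  simp only [conv, TensorProduct.map_add_left, LinearMap.add_comp, LinearMap.comp_add]

theorem conv_add_right (f g g' : Sym 𝓛 →ₗ[k] R) : conv f (g + g') = conv f g + conv f g' := by
  simp only [conv, TensorProduct.map_add_right, LinearMap.add_comp, LinearMap.comp_add]

theorem conv_smul_left (c : k) (f g : Sym 𝓛 →ₗ[k] R) : conv (c • f) g = c • conv f g := by
  simp only [conv, TensorProduct.map_smul_left, LinearMap.smul_comp, LinearMap.comp_smul]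

theorem conv_sub_left (f f' g : Sym 𝓛 →ₗ[k] R) : conv (f - f') g = conv f g - conv f' g := by
  rw [eq_sub_iff_add_eq, ← conv_add_left, sub_add_cancel]

theorem conv_sub_right (f g g' : Sym 𝓛 →ₗ[k] R) : conv f (g - g') = conv f g - conv f g' := by
  rw [eq_sub_iff_add_eq, ← conv_add_right, sub_add_cancel]

@[simp] theorem conv_zero_right (g : Sym 𝓛 →ₗ[k] R) : conv g 0 = 0 := by
  simp [conv]

theorem conv_assoc (f g h : Sym 𝓛 →ₗ[k] R) : conv (conv f g) h = conv f (conv g h) := by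
  ext X
  have h1 : ∀ Z : Sym 𝓛 ⊗[k] Sym 𝓛, LinearMap.mul' k R (TensorProduct.map (conv f g) h Z) =
      (LinearMap.mul' k R ∘ₗ TensorProduct.map f (LinearMap.mul' k R ∘ₗ TensorProduct.map g h))
        (TensorProduct.assoc k _ _ _ ((symComul 𝓛).rTensor _ Z)) := by
    intro Z
    induction Z using TensorProduct.induction_on with
    | zero => simp
    | add Z Z' hZ hZ' => simp only [map_add, hZ, hZ']
    | tmul a b =>
      simp only [TensorProduct.map_tmul, conv_apply, LinearMap.rTensor_tmul]
      induction symComul 𝓛 a using TensorProduct.induction_on with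
      | zero => simp
      | add Z Z' hZ hZ' =>
        simp only [map_add, TensorProduct.add_tmul, hZ, hZ'] at hZ hZ' ⊢
      | tmul x y => simp [mul_assoc]
  have h2 : ∀ Z : Sym 𝓛 ⊗[k] Sym 𝓛, LinearMap.mul' k R (TensorProduct.map f (conv g h) Z) =
      (LinearMap.mul' k R ∘ₗ TensorProduct.map f (LinearMap.mul' k R ∘ₗ TensorProduct.map g h))
        ((symComul 𝓛).lTensor _ Z) := by
    intro Z
    induction Z using TensorProduct.induction_on with
    | zero => simp
    | add Z Z' hZ hZ' => simp only [map_add, hZ, hZ']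
    | tmul a b => simp [conv_apply]
  rw [conv_apply, h1, symComul_coassoc, ← h2, conv_apply]

theorem convOne_conv (f : Sym 𝓛 →ₗ[k] R) : conv (convOne 𝓛 R) f = f := by
  ext X
  have h : ∀ Z : Sym 𝓛 ⊗[k] Sym 𝓛, LinearMap.mul' k R (TensorProduct.map (convOne 𝓛 R) f Z) =
      f (TensorProduct.lid k _ ((aug 𝓛).toLinearMap.rTensor _ Z)) := by
    intro Z
    induction Z using TensorProduct.induction_on with
    | zero => simp
    | add Z Z' hZ hZ' => simp only [map_add, hZ, hZ']
    | tmul a b => simp [convOne_apply, ← Algebra.smul_def]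
  rw [conv_apply, h, rTensor_aug_symComul]

theorem conv_convOne (f : Sym 𝓛 →ₗ[k] R) : conv f (convOne 𝓛 R) = f := by
  ext X
  have h : ∀ Z : Sym 𝓛 ⊗[k] Sym 𝓛, LinearMap.mul' k R (TensorProduct.map f (convOne 𝓛 R) Z) =
      f (TensorProduct.rid k _ ((aug 𝓛).toLinearMap.lTensor _ Z)) := by
    intro Z
    induction Z using TensorProduct.induction_on with
    | zero => simp
    | add Z Z' hZ hZ' => simp only [map_add, hZ, hZ']
    | tmul a b =>
      simp [convOne_apply, ← Algebra.smul_def, ← Algebra.commutes (aug 𝓛 b) (f a)]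
  rw [conv_apply, h, lTensor_aug_symComul]

theorem algHom_comp_conv {R' : Type*} [Ring R'] [Algebra k R'] (φ : R →ₐ[k] R')
    (f g : Sym 𝓛 →ₗ[k] R) :
    φ.toLinearMap ∘ₗ conv f g = conv (φ.toLinearMap ∘ₗ f) (φ.toLinearMap ∘ₗ g) := by
  simp only [conv, ← LinearMap.comp_assoc]
  congr 1
  exact TensorProduct.ext' fun a b => by simp

theorem conv_comp_of_comul {L' : Type*} [AddCommGroup L'] [Module k L']
    {𝓛' : ℤ → Submodule k L'} [DirectSum.Decomposition 𝓛'] {Φ : Sym 𝓛 →ₗ[k] Sym 𝓛'}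
    (hΦ : symComul 𝓛' ∘ₗ Φ = TensorProduct.map Φ Φ ∘ₗ symComul 𝓛) (f g : Sym 𝓛' →ₗ[k] R) :
    conv f g ∘ₗ Φ = conv (f ∘ₗ Φ) (g ∘ₗ Φ) := by
  simp only [conv, LinearMap.comp_assoc, hΦ, TensorProduct.map_comp]

/-- Precomposition with an odd coderivation is a graded derivation of convolution; the parity comes
from moving `D` past the first tensor factor. -/
theorem conv_comp_coderivation {D : Sym 𝓛 →ₗ[k] Sym 𝓛}
    (hD : symComul 𝓛 ∘ₗ D =
      (TensorProduct.map D LinearMap.id + TensorProduct.map (parity 𝓛) D) ∘ₗ symComul 𝓛)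
    (f g : Sym 𝓛 →ₗ[k] R) :
    conv f g ∘ₗ D = conv (f ∘ₗ D) g + conv (f ∘ₗ parity 𝓛) (g ∘ₗ D) := by
  simp only [conv, LinearMap.comp_assoc, hD, TensorProduct.map_comp, LinearMap.add_comp,
    LinearMap.comp_add]
  simp only [← LinearMap.comp_assoc, ← TensorProduct.map_comp, LinearMap.comp_id]

/-- Powers for the convolution product. -/
def convPow (f : Sym 𝓛 →ₗ[k] R) : ℕ → (Sym 𝓛 →ₗ[k] R)
  | 0 => convOne 𝓛 R
  | m + 1 => conv f (convPow f m)

theorem convPow_comp_of_comul {L' : Type*} [AddCommGroup L'] [Module k L']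
    {𝓛' : ℤ → Submodule k L'} [DirectSum.Decomposition 𝓛'] {Φ : Sym 𝓛 →ₗ[k] Sym 𝓛'}
    (hΦ : symComul 𝓛' ∘ₗ Φ = TensorProduct.map Φ Φ ∘ₗ symComul 𝓛)
    (hε : ∀ X, aug 𝓛' (Φ X) = aug 𝓛 X) (f : Sym 𝓛' →ₗ[k] R) (m : ℕ) :
    convPow f m ∘ₗ Φ = convPow (f ∘ₗ Φ) m := by
  induction m with
  | zero => ext X; simp [convPow, convOne_apply, hε]
  | succ m ih => simp only [convPow, conv_comp_of_comul hΦ, ih]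

end Convolution

/-! ### Homogeneous words and the filtration by word length -/

section Words

variable {k : Type*} [Field k] {L : Type*} [AddCommGroup L] [Module k L]
variable (𝓛 : ℤ → Submodule k L)

/-- `X` is a product of `m` homogeneous generators, of total degree `d`. -/
inductive IsHomWord : ℕ → ℤ → Sym 𝓛 → Prop
  | one : IsHomWord 0 0 1
  | mul {m : ℕ} {d i : ℤ} {v : L} {X : Sym 𝓛} (hv : v ∈ 𝓛 i) (hX : IsHomWord m d X) :
      IsHomWord (m + 1) (i - 1 + d) (ι 𝓛 v * X)

variable {𝓛}

theorem word_succ {m : ℕ} (γ : Fin (m + 1) → L) :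
    word 𝓛 γ = ι 𝓛 (γ 0) * word 𝓛 (fun j => γ j.succ) := by
  simp [word, List.ofFn_succ]

@[simp] theorem word_zero (γ : Fin 0 → L) : word 𝓛 γ = 1 := by simp [word]

theorem isHomWord_word {m : ℕ} {γ : Fin m → L} {κ : Fin m → ℤ} (h : ∀ j, γ j ∈ 𝓛 (κ j)) :
    IsHomWord 𝓛 m (∑ j, (κ j - 1)) (word 𝓛 γ) := by
  induction m with
  | zero => simpa using IsHomWord.one
  | succ m ih =>
    rw [word_succ, Fin.sum_univ_succ]
    exact .mul (h 0) (ih fun j => h j.succ)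

theorem IsHomWord.exists_word {m : ℕ} {d : ℤ} {X : Sym 𝓛} (hX : IsHomWord 𝓛 m d X) :
    ∃ (γ : Fin m → L) (κ : Fin m → ℤ), (∀ j, γ j ∈ 𝓛 (κ j)) ∧ ∑ j, (κ j - 1) = d ∧
      X = word 𝓛 γ := by
  induction hX with
  | one => exact ⟨Fin.elim0, Fin.elim0, fun j => j.elim0, by simp, by simp⟩
  | @mul m d i v X hv hX ih =>
    obtain ⟨γ, κ, h, rfl, rfl⟩ := ih
    refine ⟨Fin.cons v γ, Fin.cons i κ, fun j => ?_, ?_, ?_⟩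
    · refine Fin.cases ?_ (fun j => ?_) j
      · simpa using hv
      · simpa using h j
    · rw [Fin.sum_univ_succ]
      simp only [Fin.cons_zero, Fin.cons_succ]
    · simp [word_succ]

theorem IsHomWord.mem_symDeg {m : ℕ} {d : ℤ} {X : Sym 𝓛} (hX : IsHomWord 𝓛 m d X) :
    X ∈ symDeg 𝓛 d := by
  obtain ⟨γ, κ, h, hd, rfl⟩ := hX.exists_word
  exact Submodule.subset_span ⟨m, γ, κ, h, hd, rfl⟩

theorem map_mem_of_mem_symDeg {W : Type*} [AddCommGroup W] [Module k W] {U : Submodule k W}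
    {f : Sym 𝓛 →ₗ[k] W} {d : ℤ} (h : ∀ m X, IsHomWord 𝓛 m d X → f X ∈ U) {X : Sym 𝓛}
    (hX : X ∈ symDeg 𝓛 d) : f X ∈ U := by
  have : symDeg 𝓛 d ≤ U.comap f := by
    refine Submodule.span_le.2 ?_
    rintro _ ⟨n, γ, κ, hγ, rfl, rfl⟩
    exact h n _ (isHomWord_word hγ)
  exact this hX

theorem mul_mem_symDeg {d e : ℤ} {X Y : Sym 𝓛} (hX : X ∈ symDeg 𝓛 d) (hY : Y ∈ symDeg 𝓛 e) :
    X * Y ∈ symDeg 𝓛 (d + e) := by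
  refine map_mem_of_mem_symDeg (f := LinearMap.mulRight k Y) (fun m X hX => ?_) hX
  rw [LinearMap.mulRight_apply]
  refine map_mem_of_mem_symDeg (f := LinearMap.mulLeft k X) (fun n Y hY => ?_) hY
  rw [LinearMap.mulLeft_apply]
  suffices h : IsHomWord 𝓛 (m + n) (d + e) (X * Y) from h.mem_symDeg
  clear * - hX hY
  induction hX with
  | one => simpa using hY
  | mul hv hX ih =>
    rw [mul_assoc]
    convert IsHomWord.mul hv ih using 1
    · omega
    · ring

theorem ι_mem_symDeg {i : ℤ} {v : L} (hv : v ∈ 𝓛 i) : ι 𝓛 v ∈ symDeg 𝓛 (i - 1) := by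
  simpa using (IsHomWord.mul hv .one).mem_symDeg

variable [DirectSum.Decomposition 𝓛]

theorem isHomWord_ext {W : Type*} [AddCommGroup W] [Module k W] {f g : Sym 𝓛 →ₗ[k] W}
    (h : ∀ m d X, IsHomWord 𝓛 m d X → f X = g X) : f = g := by
  have key : ∀ X : Sym 𝓛, X ∈ Submodule.span k {X | ∃ m d, IsHomWord 𝓛 m d X} := by
    intro X
    induction X using sym_induction with
    | one => exact Submodule.subset_span ⟨0, 0, .one⟩
    | add X Y hX hY => exact add_mem hX hY
    | smul c X hX => exact Submodule.smul_mem _ c hX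
    | mul i v hv X hX =>
      have : Submodule.span k {X | ∃ m d, IsHomWord 𝓛 m d X} ≤
          (Submodule.span k {X | ∃ m d, IsHomWord 𝓛 m d X}).comap
            (LinearMap.mulLeft k (ι 𝓛 v)) := by
        refine Submodule.span_le.2 ?_
        rintro Y ⟨m, d, hY⟩
        exact Submodule.subset_span ⟨_, _, .mul hv hY⟩
      exact this hX
  exact LinearMap.ext_on_range (v := fun X : {X | ∃ m d, IsHomWord 𝓛 m d X} => (X : Sym 𝓛))
    (by rw [Subtype.range_coe]; exact Submodule.eq_top_iff'.2 key) fun ⟨X, m, d, hX⟩ => h m d X hX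

/-- Membership in a subspace passes from homogeneous letters to arbitrary ones by expanding one
letter at a time. -/
theorem map_word_mem {W : Type*} [AddCommGroup W] [Module k W] {U : Submodule k W} {m : ℕ}
    {f : Sym 𝓛 →ₗ[k] W} (h : ∀ d X, IsHomWord 𝓛 m d X → f X ∈ U) (γ : Fin m → L) :
    f (word 𝓛 γ) ∈ U := by
  induction m generalizing f with
  | zero => simpa using h 0 1 .one
  | succ m ih =>
    rw [word_succ]
    induction γ 0 using generator_induction (𝓛 := 𝓛) with
    | add x y hx hy => rw [map_add, add_mul, map_add]; exact add_mem hx hy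
    | hom i v hv =>
      exact ih (f := f ∘ₗ LinearMap.mulLeft k (ι 𝓛 v)) (fun d X hX => h _ _ (.mul hv hX)) _

theorem sgn_isHomWord {m : ℕ} {d : ℤ} {X : Sym 𝓛} (hX : IsHomWord 𝓛 m d X) (e : ℤ) :
    sgn 𝓛 e X = (-1 : k) ^ (e * d) • X := by
  induction hX with
  | one => simp
  | mul hv hX ih =>
    rw [map_mul, ih, sgn_ι 𝓛 e hv, smul_mul_smul_comm, ← zpow_add₀ (neg_ne_zero.2 one_ne_zero),
      mul_add]

theorem sgn_of_mem_symDeg {d : ℤ} {X : Sym 𝓛} (hX : X ∈ symDeg 𝓛 d) (e : ℤ) :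
    sgn 𝓛 e X = (-1 : k) ^ (e * d) • X := by
  have : ((sgn 𝓛 e).toLinearMap - (-1 : k) ^ (e * d) • (LinearMap.id : Sym 𝓛 →ₗ[k] Sym 𝓛)) X ∈
      (⊥ : Submodule k (Sym 𝓛)) :=
    map_mem_of_mem_symDeg (fun m X hX => by simp [sgn_isHomWord hX]) hX
  simpa [sub_eq_zero] using this

theorem symComul_isHomWord {m : ℕ} {d : ℤ} {X : Sym 𝓛} (hX : IsHomWord 𝓛 m d X) :
    symComul 𝓛 X ∈ Submodule.span k {Z | ∃ a b c e u w, IsHomWord 𝓛 a c u ∧ IsHomWord 𝓛 b e w ∧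
      a + b = m ∧ c + e = d ∧ Z = u ⊗ₜ[k] w} := by
  induction hX with
  | one => exact Submodule.subset_span ⟨0, 0, 0, 0, 1, 1, .one, .one, rfl, rfl, by simp⟩
  | @mul m d i v X hv hX ih =>
    rw [symComul_ι_mul]
    refine Submodule.mem_comap.1 ((Submodule.span_le (p := Submodule.comap (primMul 𝓛 v) _)).2 ?_ ih)
    rintro _ ⟨a, b, c, e, u, w, hu, hw, rfl, rfl, rfl⟩
    simp only [SetLike.mem_coe, Submodule.mem_comap, primMul_tmul 𝓛 hv, sgn_isHomWord hu]
    refine add_mem (Submodule.subset_span ⟨a + 1, b, _, _, _, _, .mul hv hu, hw, by omega,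
      by ring, rfl⟩) ?_
    rw [← TensorProduct.smul_tmul']
    exact Submodule.smul_mem _ _ (Submodule.subset_span ⟨a, b + 1, _, _, _, _, hu, .mul hv hw,
      by omega, by ring, rfl⟩)

variable {R : Type*} [Ring R] [Algebra k R]

theorem conv_mem {f g : Sym 𝓛 →ₗ[k] R} {U : Submodule k R} {m : ℕ} {d : ℤ} {X : Sym 𝓛}
    (hX : IsHomWord 𝓛 m d X)
    (h : ∀ a b c e u w, IsHomWord 𝓛 a c u → IsHomWord 𝓛 b e w → a + b = m → c + e = d →
      f u * g w ∈ U) : conv f g X ∈ U := by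
  refine Submodule.mem_comap.1 ((Submodule.span_le (p := Submodule.comap
    (LinearMap.mul' k R ∘ₗ TensorProduct.map f g) U)).2 ?_ (symComul_isHomWord hX))
  rintro _ ⟨a, b, c, e, u, w, hu, hw, rfl, rfl, rfl⟩
  simpa using h a b c e u w hu hw rfl rfl

/-- `f` vanishes on words of length less than `c`. -/
def VanishesBelow {W : Type*} [AddCommGroup W] [Module k W] (c : ℕ) (f : Sym 𝓛 →ₗ[k] W) : Prop :=
  ∀ m < c, ∀ d X, IsHomWord 𝓛 m d X → f X = 0

omit [DirectSum.Decomposition 𝓛] in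
theorem VanishesBelow.mono {W : Type*} [AddCommGroup W] [Module k W] {c c' : ℕ} (h : c' ≤ c)
    {f : Sym 𝓛 →ₗ[k] W} (hf : VanishesBelow c f) : VanishesBelow c' f :=
  fun m hm => hf m (hm.trans_le h)

omit [DirectSum.Decomposition 𝓛] in
theorem VanishesBelow.add {W : Type*} [AddCommGroup W] [Module k W] {c : ℕ}
    {f g : Sym 𝓛 →ₗ[k] W} (hf : VanishesBelow c f) (hg : VanishesBelow c g) :
    VanishesBelow c (f + g) :=
  fun m hm d X hX => by rw [LinearMap.add_apply, hf m hm d X hX, hg m hm d X hX, add_zero]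

omit [DirectSum.Decomposition 𝓛] in
theorem VanishesBelow.comp {W W' : Type*} [AddCommGroup W] [Module k W] [AddCommGroup W']
    [Module k W'] {c : ℕ} {f : Sym 𝓛 →ₗ[k] W} (hf : VanishesBelow c f) (g : W →ₗ[k] W') :
    VanishesBelow c (g ∘ₗ f) :=
  fun m hm d X hX => by rw [LinearMap.comp_apply, hf m hm d X hX, map_zero]

theorem VanishesBelow.comp_parity {W : Type*} [AddCommGroup W] [Module k W] {c : ℕ}
    {f : Sym 𝓛 →ₗ[k] W} (hf : VanishesBelow c f) : VanishesBelow c (f ∘ₗ parity 𝓛) :=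
  fun m hm d X hX => by
    rw [LinearMap.comp_apply, parity_apply, sgn_isHomWord hX, map_smul, hf m hm d X hX, smul_zero]

/-- The coproduct preserves total word length, and a splitting of a length below `a + b` has a first
part below `a` or a second part below `b`. -/
theorem VanishesBelow.conv {a b : ℕ} {f g : Sym 𝓛 →ₗ[k] R} (hf : VanishesBelow a f)
    (hg : VanishesBelow b g) : VanishesBelow (a + b) (conv f g) := by
  intro m hm d X hX
  rw [← Submodule.mem_bot (R := k)]
  refine conv_mem hX fun a' b' c e u w hu hw hab _ => ?_
  by_cases ha : a' < a
  · simp [hf a' ha c u hu]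
  · simp [hg b' (by omega) e w hw]

omit [DirectSum.Decomposition 𝓛] in
theorem vanishesBelow_zero {W : Type*} [AddCommGroup W] [Module k W] (f : Sym 𝓛 →ₗ[k] W) :
    VanishesBelow 0 f := fun m hm => absurd hm (Nat.not_lt_zero m)

omit [DirectSum.Decomposition 𝓛] in
theorem vanishesBelow_one {W : Type*} [AddCommGroup W] [Module k W] {f : Sym 𝓛 →ₗ[k] W}
    (hf : f 1 = 0) : VanishesBelow 1 f := by
  intro m hm d X hX
  cases hX with
  | one => exact hf
  | mul => omega

theorem VanishesBelow.map_word {W : Type*} [AddCommGroup W] [Module k W] {c m : ℕ}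
    {f : Sym 𝓛 →ₗ[k] W} (hf : VanishesBelow c f) (hm : m < c) (γ : Fin m → L) :
    f (word 𝓛 γ) = 0 := by
  rw [← Submodule.mem_bot (R := k)]
  exact map_word_mem (fun d X hX => by simp [hf m hm d X hX]) γ

/-- Every element is a finite combination of words, so its word lengths are bounded. This makes all
series below finite on each element. -/
theorem VanishesBelow.eventually {W : Type*} [AddCommGroup W] [Module k W]
    {f : ℕ → Sym 𝓛 →ₗ[k] W} (hf : ∀ j, VanishesBelow j (f j)) (X : Sym 𝓛) :
    ∃ N, ∀ j ≥ N, f j X = 0 := by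
  have key : ∀ X : Sym 𝓛, X ∈ Submodule.span k {X | ∃ m d, IsHomWord 𝓛 m d X} := by
    intro X
    have : (Submodule.span k {X | ∃ m d, IsHomWord 𝓛 m d X}).mkQ = 0 :=
      isHomWord_ext fun m d X hX => by
        rw [LinearMap.zero_apply, Submodule.mkQ_apply, Submodule.Quotient.mk_eq_zero]
        exact Submodule.subset_span ⟨m, d, hX⟩
    rw [← Submodule.Quotient.mk_eq_zero, ← Submodule.mkQ_apply, this, LinearMap.zero_apply]
  induction key X using Submodule.span_induction with
  | mem X hX =>
    obtain ⟨m, d, hX⟩ := hX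
    exact ⟨m + 1, fun j hj => hf j m (by omega) d X hX⟩
  | zero => exact ⟨0, fun j _ => map_zero _⟩
  | add X Y _ _ hX hY =>
    obtain ⟨N, hN⟩ := hX
    obtain ⟨M, hM⟩ := hY
    exact ⟨N + M, fun j hj => by rw [map_add, hN j (by omega), hM j (by omega), add_zero]⟩
  | smul c X _ hX =>
    obtain ⟨N, hN⟩ := hX
    exact ⟨N, fun j hj => by rw [map_smul, hN j hj, smul_zero]⟩

end Words

/-! ### The identity as the convolution exponential of the generator projection -/

section Euler

variable {k : Type*} [Field k] {L : Type*} [AddCommGroup L] [Module k L]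
variable (𝓛 : ℤ → Submodule k L)

/-- The projection of `S(s⁻¹L)` onto the words of length one, as an endomorphism. -/
def genProj : Sym 𝓛 →ₗ[k] Sym 𝓛 := ι 𝓛 ∘ₗ symProj 𝓛

variable {𝓛}

theorem genProj_apply (X : Sym 𝓛) : genProj 𝓛 X = ι 𝓛 (symProj 𝓛 X) := rfl

@[simp] theorem genProj_one : genProj 𝓛 1 = 0 := by simp [genProj_apply]

theorem genProj_ι_mul (v : L) (X : Sym 𝓛) : genProj 𝓛 (ι 𝓛 v * X) = aug 𝓛 X • ι 𝓛 v := by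
  rw [genProj_apply, symProj_ι_mul, map_smul]

variable [DirectSum.Decomposition 𝓛]

theorem genProj_sgn (e : ℤ) (X : Sym 𝓛) : genProj 𝓛 (sgn 𝓛 e X) = sgn 𝓛 e (genProj 𝓛 X) := by
  suffices h : genProj 𝓛 ∘ₗ (sgn 𝓛 e).toLinearMap = (sgn 𝓛 e).toLinearMap ∘ₗ genProj 𝓛 from
    DFunLike.congr_fun h X
  refine sym_linearMap_ext (by simp) fun i v hv X _ => ?_
  simp only [LinearMap.comp_apply, AlgHom.toLinearMap_apply, map_mul, sgn_ι 𝓛 e hv,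
    smul_mul_assoc, map_smul, genProj_ι_mul, aug_sgn]
  rw [smul_comm]

theorem sgn_ι_mul_ι {i : ℤ} {v : L} (hv : v ∈ 𝓛 i) (x : L) :
    sgn 𝓛 (i - 1) (ι 𝓛 x) * ι 𝓛 v = ι 𝓛 v * ι 𝓛 x := by
  rcases generator_parity hv with ⟨he, -, h, -⟩ | ⟨he, -, h, -⟩
  · rw [sgn_of_even he, h]
  · rw [sgn_of_odd he, h]

/-- The letter `v` lands in one of the `m + 1` convolution factors. Bringing it to the front cancels
the sign produced by the coproduct, so all `m + 1` contributions agree. -/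
theorem convPow_genProj_ι_mul (m : ℕ) (v : L) (X : Sym 𝓛) :
    convPow (genProj 𝓛) (m + 1) (ι 𝓛 v * X) =
      (m + 1 : k) • (ι 𝓛 v * convPow (genProj 𝓛) m X) := by
  induction v using generator_induction (𝓛 := 𝓛) with
  | add x y hx hy => simp only [map_add, add_mul, smul_add, hx, hy]
  | hom i v hv =>
  induction m generalizing X with
  | zero =>
    rw [convPow, convPow, convPow, conv_convOne, genProj_ι_mul, convOne_apply, Algebra.algebraMap_eq_smul_one]
    simp
  | succ m ih =>
    rw [convPow, conv_apply]
    -- The term with `convOne` has `v` in the first factor, the term with coefficient `m + 1` has it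
    -- in the remaining ones.
    have h := apply_symComul_ι_mul
      (LinearMap.mul' k _ ∘ₗ TensorProduct.map (genProj 𝓛) (convPow (genProj 𝓛) (m + 1)))
      (LinearMap.mul' k _ ∘ₗ
        (TensorProduct.map (convOne 𝓛 _) (convPow (genProj 𝓛) (m + 1)) +
          (m + 1 : k) • TensorProduct.map (genProj 𝓛) (convPow (genProj 𝓛) m)))
      (LinearMap.mulLeft k (ι 𝓛 v)) v X (by
      intro a b
      simp only [primMul_tmul 𝓛 hv, LinearMap.comp_apply, map_add, TensorProduct.map_tmul,
        LinearMap.mul'_apply, ih, genProj_ι_mul, genProj_sgn, LinearMap.mulLeft_apply,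
        LinearMap.add_apply, LinearMap.smul_apply, map_smul, convOne_apply]
      congr 1
      · rw [Algebra.algebraMap_eq_smul_one]; simp
      · rw [mul_smul_comm, ← mul_assoc, genProj_apply, sgn_ι_mul_ι hv, mul_assoc])
    simp only [LinearMap.comp_apply] at h
    rw [h]
    have h1 := DFunLike.congr_fun (convOne_conv (convPow (genProj 𝓛) (m + 1))) X
    rw [conv_apply] at h1
    have h2 : conv _ _ X = convPow (genProj 𝓛) (m + 1) X := rfl
    rw [conv_apply] at h2
    simp only [LinearMap.add_apply, LinearMap.smul_apply, map_add, map_smul, h1, h2,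
      LinearMap.mulLeft_apply]
    push_cast
    module

theorem convPow_genProj_succ_one (m : ℕ) : convPow (genProj 𝓛) (m + 1) 1 = 0 := by
  simp [convPow]

variable [CharZero k]

variable (𝓛) in
/-- The projection onto words of length `m`. -/
def wordProj (m : ℕ) : Sym 𝓛 →ₗ[k] Sym 𝓛 := (m.factorial : k)⁻¹ • convPow (genProj 𝓛) m

theorem wordProj_succ_ι_mul (m : ℕ) (v : L) (X : Sym 𝓛) :
    wordProj 𝓛 (m + 1) (ι 𝓛 v * X) = ι 𝓛 v * wordProj 𝓛 m X := by
  have h : (m + 1 : k) ≠ 0 := by exact_mod_cast m.succ_ne_zero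
  simp only [wordProj, LinearMap.smul_apply, convPow_genProj_ι_mul, mul_smul_comm, smul_smul]
  congr 1
  rw [Nat.factorial_succ]
  push_cast
  rw [mul_inv, mul_comm _ (m + 1 : k), ← mul_assoc, mul_inv_cancel₀ h, one_mul]

theorem wordProj_isHomWord {m : ℕ} {d : ℤ} {X : Sym 𝓛} (hX : IsHomWord 𝓛 m d X) (j : ℕ) :
    wordProj 𝓛 j X = if j = m then X else 0 := by
  induction hX generalizing j with
  | one =>
    cases j with
    | zero => simp [wordProj, convPow, convOne_apply]
    | succ j => simp [wordProj, convPow_genProj_succ_one]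
  | mul hv hX ih =>
    cases j with
    | zero => simp [wordProj, convPow, convOne_apply]
    | succ j => simp [wordProj_succ_ι_mul, ih]

/-- Since `wordProj` is the divided convolution power of `genProj`, this decomposition by length
says that the identity is the exponential of `genProj`. -/
theorem sum_wordProj (X : Sym 𝓛) : SumsTo (fun m => wordProj 𝓛 m X) X := by
  induction X using sym_induction with
  | one => exact ⟨1, fun M hM => by simp [wordProj_isHomWord .one, Finset.sum_ite_eq']; omega⟩
  | add X Y hX hY =>
    obtain ⟨N, hN⟩ := hX
    obtain ⟨N', hN'⟩ := hY
    exact ⟨N + N', fun M hM => by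
      simp only [map_add, Finset.sum_add_distrib]
      rw [hN M (by omega), hN' M (by omega)]⟩
  | smul c X hX =>
    obtain ⟨N, hN⟩ := hX
    exact ⟨N, fun M hM => by simp only [map_smul, ← Finset.smul_sum, hN M hM]⟩
  | mul i v hv X hX =>
    obtain ⟨N, hN⟩ := hX
    refine ⟨N + 1, fun M hM => ?_⟩
    obtain ⟨M, rfl⟩ : ∃ M', M = M' + 1 := ⟨M - 1, by omega⟩
    rw [Finset.sum_range_succ']
    simp only [wordProj_succ_ι_mul, ← Finset.mul_sum, hN M (by omega)]
    simp [wordProj, convPow, convOne_apply]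

end Euler

/-! ### Coderivations and word length; the length-preserving part -/

section Coderivation

variable {k : Type*} [Field k] {L : Type*} [AddCommGroup L] [Module k L]
variable {𝓛 : ℤ → Submodule k L} [DirectSum.Decomposition 𝓛]

theorem vanishesBelow_convPow_genProj (j : ℕ) : VanishesBelow j (convPow (genProj 𝓛) j) := by
  induction j with
  | zero => exact vanishesBelow_zero _
  | succ j ih =>
    rw [convPow, add_comm]
    exact (vanishesBelow_one genProj_one).conv ih

theorem vanishesBelow_convPow_genProj_comp {D : Sym 𝓛 →ₗ[k] Sym 𝓛}
    (hD : symComul 𝓛 ∘ₗ D =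
      (TensorProduct.map D LinearMap.id + TensorProduct.map (parity 𝓛) D) ∘ₗ symComul 𝓛)
    (hD1 : D 1 = 0) (j : ℕ) : VanishesBelow j (convPow (genProj 𝓛) j ∘ₗ D) := by
  induction j with
  | zero => exact vanishesBelow_zero _
  | succ j ih =>
    rw [convPow, conv_comp_coderivation hD, add_comm j]
    exact ((vanishesBelow_one (by simp [hD1])).conv (vanishesBelow_convPow_genProj j)).add
      ((vanishesBelow_one genProj_one).comp_parity.conv ih)

/-- A coderivation killing `1` never lengthens words: expanding `genProj * ⋯ * genProj` after `D` by
the Leibniz rule, every one of the `j` factors still kills constants. -/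
theorem vanishesBelow_wordProj_comp [CharZero k] {D : Sym 𝓛 →ₗ[k] Sym 𝓛}
    (hD : symComul 𝓛 ∘ₗ D =
      (TensorProduct.map D LinearMap.id + TensorProduct.map (parity 𝓛) D) ∘ₗ symComul 𝓛)
    (hD1 : D 1 = 0) (j : ℕ) : VanishesBelow j (wordProj 𝓛 j ∘ₗ D) := fun m hm d X hX => by
  have := vanishesBelow_convPow_genProj_comp hD hD1 j m hm d X hX
  rw [LinearMap.comp_apply] at this
  simp [wordProj, this]

theorem VanishesBelow.map_eq_zero [CharZero k] {W : Type*} [AddCommGroup W] [Module k W] {c : ℕ}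
    {f : Sym 𝓛 →ₗ[k] W} (hf : VanishesBelow c f) {Z : Sym 𝓛}
    (hZ : ∀ j ≥ c, wordProj 𝓛 j Z = 0) : f Z = 0 := by
  have h : ∀ j, f (wordProj 𝓛 j Z) = 0 := by
    intro j
    by_cases hj : j < c
    · have : f ∘ₗ wordProj 𝓛 j = 0 := isHomWord_ext fun m d X hX => by
        rw [LinearMap.comp_apply, wordProj_isHomWord hX]
        split_ifs with h
        · simp [hf m (h ▸ hj) d X hX]
        · simp
      exact DFunLike.congr_fun this Z
    · rw [hZ j (by omega), map_zero]
  obtain ⟨N, hN⟩ := sum_wordProj Z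
  rw [← hN N le_rfl, map_sum]
  exact Finset.sum_eq_zero fun j _ => h j

/-- On a word shorter than `c`, the image under `D` has only components shorter than `c`. -/
theorem VanishesBelow.comp_coderivation [CharZero k] {W : Type*} [AddCommGroup W] [Module k W]
    {c : ℕ} {f : Sym 𝓛 →ₗ[k] W} (hf : VanishesBelow c f) {D : Sym 𝓛 →ₗ[k] Sym 𝓛}
    (hD : symComul 𝓛 ∘ₗ D =
      (TensorProduct.map D LinearMap.id + TensorProduct.map (parity 𝓛) D) ∘ₗ symComul 𝓛)
    (hD1 : D 1 = 0) : VanishesBelow c (f ∘ₗ D) := fun m hm d X hX =>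
  hf.map_eq_zero fun j hj => vanishesBelow_wordProj_comp hD hD1 j m (by omega) d X hX

/-- On words of length `j`, this is `j!` times the derivation extending `q`. -/
def linearPart (q : L →ₗ[k] L) : ℕ → (Sym 𝓛 →ₗ[k] Sym 𝓛)
  | 0 => 0
  | j + 1 => conv (ι 𝓛 ∘ₗ q ∘ₗ symProj 𝓛) (convPow (genProj 𝓛) j) +
      conv (genProj 𝓛 ∘ₗ parity 𝓛) (linearPart q j)

/-- By `hq` the corestriction of `D` is `q` up to terms needing two letters. Replacing it by `q`
inside a product with `j - 1` further generator projections causes an error only on words of more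
than `j` letters. -/
theorem vanishesBelow_sub_linearPart {D : Sym 𝓛 →ₗ[k] Sym 𝓛}
    (hD : symComul 𝓛 ∘ₗ D =
      (TensorProduct.map D LinearMap.id + TensorProduct.map (parity 𝓛) D) ∘ₗ symComul 𝓛)
    (hD1 : D 1 = 0) {q : L →ₗ[k] L}
    (hq : VanishesBelow 2 (genProj 𝓛 ∘ₗ D - ι 𝓛 ∘ₗ q ∘ₗ symProj 𝓛)) (j : ℕ) :
    VanishesBelow (j + 1) (convPow (genProj 𝓛) j ∘ₗ D - linearPart q j) := by
  induction j with
  | zero => exact vanishesBelow_one (by simp [linearPart, hD1])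
  | succ j ih =>
    have h : convPow (genProj 𝓛) (j + 1) ∘ₗ D - linearPart q (j + 1) =
        conv (genProj 𝓛 ∘ₗ D - ι 𝓛 ∘ₗ q ∘ₗ symProj 𝓛) (convPow (genProj 𝓛) j) +
          conv (genProj 𝓛 ∘ₗ parity 𝓛) (convPow (genProj 𝓛) j ∘ₗ D - linearPart q j) := by
      rw [convPow, conv_comp_coderivation hD, linearPart, conv_sub_left, conv_sub_right]
      abel
    rw [h]
    exact ((hq.conv (vanishesBelow_convPow_genProj j)).mono (by omega)).add
      (((vanishesBelow_one genProj_one).comp_parity.conv ih).mono (by omega))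

/-- The counting of `convPow_genProj_ι_mul` again: each of `j + 1` factors may receive `v`, and `q`
either hits `v` or passes it with the sign of an odd operator. -/
theorem linearPart_ι_mul {q : L →ₗ[k] L} (hq : ∀ i, ∀ v ∈ 𝓛 i, q v ∈ 𝓛 (i + 1)) (j : ℕ)
    {i : ℤ} {v : L} (hv : v ∈ 𝓛 i) (X : Sym 𝓛) :
    linearPart q (j + 1) (ι 𝓛 v * X) = (j + 1 : k) • (ι 𝓛 (q v) * convPow (genProj 𝓛) j X +
      sgn 𝓛 1 (ι 𝓛 v) * linearPart q j X) := by
  have hqp : ∀ a, ι 𝓛 (q (symProj 𝓛 (sgn 𝓛 1 a))) = -sgn 𝓛 1 (ι 𝓛 (q (symProj 𝓛 a))) := by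
    intro a
    have : ι 𝓛 ∘ₗ q ∘ₗ symProj 𝓛 ∘ₗ parity 𝓛 = -(parity 𝓛 ∘ₗ ι 𝓛 ∘ₗ q ∘ₗ symProj 𝓛) := by
      refine sym_linearMap_ext (by simp [parity_apply]) fun i v hv X _ => ?_
      simp only [LinearMap.comp_apply, parity_apply, map_mul, sgn_ι 𝓛 1 hv, smul_mul_assoc,
        map_smul, symProj_ι_mul, LinearMap.neg_apply, sgn_ι 𝓛 1 (hq i v hv), aug_sgn]
      rw [smul_comm, ← smul_neg, ← neg_smul]
      congr 2
      rw [one_mul, one_mul, add_sub_right_comm, zpow_add_one₀ (neg_ne_zero.2 one_ne_zero)]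
      ring
    exact DFunLike.congr_fun this a
  have hcomm : ∀ a, ι 𝓛 (q (symProj 𝓛 (sgn 𝓛 (i - 1) a))) * ι 𝓛 v =
      sgn 𝓛 1 (ι 𝓛 v) * ι 𝓛 (q (symProj 𝓛 a)) := by
    intro a
    rcases generator_parity hv with ⟨he, hs, h, -⟩ | ⟨he, hs, h, -⟩
    · rw [sgn_of_even he, hs, h]
    · rw [sgn_of_odd he, hs, hqp, neg_mul, h, neg_mul]
  have hcomm' : ∀ a, genProj 𝓛 (sgn 𝓛 1 (sgn 𝓛 (i - 1) a)) * ι 𝓛 (q v) =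
      ι 𝓛 (q v) * genProj 𝓛 a := by
    intro a
    have := sgn_ι_mul_ι (hq i v hv) (symProj 𝓛 a)
    rwa [show i + 1 - 1 = 1 + (i - 1) by ring, ← sgn_sgn, ← genProj_apply, ← genProj_sgn,
      ← genProj_sgn] at this
  have hcomm'' : ∀ a, genProj 𝓛 (sgn 𝓛 1 (sgn 𝓛 (i - 1) a)) * sgn 𝓛 1 (ι 𝓛 v) =
      sgn 𝓛 1 (ι 𝓛 v) * genProj 𝓛 (sgn 𝓛 1 a) := by
    intro a
    rw [genProj_sgn, genProj_sgn, genProj_sgn, ← map_mul, genProj_apply, sgn_ι_mul_ι hv, map_mul]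
  have haug : ∀ (a : Sym 𝓛) (x : L) (Y : Sym 𝓛), aug 𝓛 a • ι 𝓛 x * Y =
      ι 𝓛 x * (convOne 𝓛 (Sym 𝓛) a * Y) := by
    intro a x Y
    rw [convOne_apply, Algebra.algebraMap_eq_smul_one]
    simp
  -- The first factor carries `q`: it either receives `v`, giving `q v`, or lets `v` pass to `g`.
  have hA : ∀ (X : Sym 𝓛) (g g' : Sym 𝓛 →ₗ[k] Sym 𝓛) (c : k),
      (∀ b, g (ι 𝓛 v * b) = c • (ι 𝓛 v * g' b)) →
      conv (ι 𝓛 ∘ₗ q ∘ₗ symProj 𝓛) g (ι 𝓛 v * X) =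
        ι 𝓛 (q v) * g X + c • (sgn 𝓛 1 (ι 𝓛 v) * conv (ι 𝓛 ∘ₗ q ∘ₗ symProj 𝓛) g' X) := by
    intro X g g' c hg
    have h := apply_symComul_ι_mul
      (LinearMap.mul' k _ ∘ₗ TensorProduct.map (ι 𝓛 ∘ₗ q ∘ₗ symProj 𝓛) g)
      (LinearMap.mulLeft k (ι 𝓛 (q v)) ∘ₗ LinearMap.mul' k _ ∘ₗ TensorProduct.map (convOne 𝓛 _) g +
        c • LinearMap.mulLeft k (sgn 𝓛 1 (ι 𝓛 v)) ∘ₗ LinearMap.mul' k _ ∘ₗ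
          TensorProduct.map (ι 𝓛 ∘ₗ q ∘ₗ symProj 𝓛) g') LinearMap.id v X (by
      intro a b
      simp only [primMul_tmul 𝓛 hv, LinearMap.comp_apply, map_add, TensorProduct.map_tmul,
        LinearMap.mul'_apply, hg, symProj_ι_mul, LinearMap.mulLeft_apply, LinearMap.id_apply,
        LinearMap.add_apply, LinearMap.smul_apply, map_smul]
      congr 1
      · exact haug a _ _
      · rw [mul_smul_comm, ← mul_assoc, hcomm, mul_assoc])
    have h1 := DFunLike.congr_fun (convOne_conv g) X
    rw [conv_apply] at h1
    simp only [LinearMap.comp_apply, LinearMap.add_apply, LinearMap.smul_apply, h1,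
      LinearMap.mulLeft_apply, LinearMap.id_apply] at h
    exact h
  -- The first factor is a plain letter that `q` has already passed: it is either `v` itself, or `v`
  -- goes to `g`, where `q` may or may not hit it.
  have hB : ∀ (X : Sym 𝓛) (g g' g'' : Sym 𝓛 →ₗ[k] Sym 𝓛) (c : k),
      (∀ b, g (ι 𝓛 v * b) = c • (ι 𝓛 (q v) * g' b + sgn 𝓛 1 (ι 𝓛 v) * g'' b)) →
      conv (genProj 𝓛 ∘ₗ parity 𝓛) g (ι 𝓛 v * X) =
        sgn 𝓛 1 (ι 𝓛 v) * g X + c • (ι 𝓛 (q v) * conv (genProj 𝓛) g' X +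
          sgn 𝓛 1 (ι 𝓛 v) * conv (genProj 𝓛 ∘ₗ parity 𝓛) g'' X) := by
    intro X g g' g'' c hg
    have h := apply_symComul_ι_mul
      (LinearMap.mul' k _ ∘ₗ TensorProduct.map (genProj 𝓛 ∘ₗ parity 𝓛) g)
      (LinearMap.mulLeft k (sgn 𝓛 1 (ι 𝓛 v)) ∘ₗ LinearMap.mul' k _ ∘ₗ
          TensorProduct.map (convOne 𝓛 _) g +
        c • (LinearMap.mulLeft k (ι 𝓛 (q v)) ∘ₗ LinearMap.mul' k _ ∘ₗ
            TensorProduct.map (genProj 𝓛) g' +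
          LinearMap.mulLeft k (sgn 𝓛 1 (ι 𝓛 v)) ∘ₗ LinearMap.mul' k _ ∘ₗ
            TensorProduct.map (genProj 𝓛 ∘ₗ parity 𝓛) g'')) LinearMap.id v X (by
      intro a b
      simp only [primMul_tmul 𝓛 hv, LinearMap.comp_apply, map_add, TensorProduct.map_tmul,
        LinearMap.mul'_apply, hg, LinearMap.mulLeft_apply, LinearMap.id_apply,
        LinearMap.add_apply, LinearMap.smul_apply, parity_apply]
      congr 1
      · rw [genProj_sgn, genProj_ι_mul, map_smul, sgn_ι 𝓛 1 hv, ← map_smul, ← map_smul]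
        simpa using haug a ((-1 : k) ^ (1 * (i - 1)) • v) (g b)
      · rw [mul_smul_comm, mul_add, ← mul_assoc, ← mul_assoc, hcomm', hcomm'', mul_assoc,
          mul_assoc])
    have h1 := DFunLike.congr_fun (convOne_conv g) X
    rw [conv_apply] at h1
    simp only [LinearMap.comp_apply, LinearMap.add_apply, LinearMap.smul_apply, h1,
      LinearMap.mulLeft_apply, LinearMap.id_apply] at h
    exact h
  induction j generalizing X with
  | zero =>
    simp only [linearPart, convPow, conv_zero_right, add_zero]
    rw [hA X (convOne 𝓛 _) 0 0 (by simp [convOne_apply])]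
    simp
  | succ j ih =>
    rw [linearPart, LinearMap.add_apply, hA _ _ _ _ (convPow_genProj_ι_mul j v), hB _ _ _ _ _ ih]
    have h2 : linearPart q (j + 1) X = conv (ι 𝓛 ∘ₗ q ∘ₗ symProj 𝓛) (convPow (genProj 𝓛) j) X +
      conv (genProj 𝓛 ∘ₗ parity 𝓛) (linearPart q j) X := rfl
    have h3 : conv (genProj 𝓛) (convPow (genProj 𝓛) j) X = convPow (genProj 𝓛) (j + 1) X := rfl
    rw [h2, h3]
    push_cast
    simp only [mul_add]
    module

end Coderivation

/-! ### The infinitesimal gauge transformation on coalgebra maps -/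

section Flow

variable {k : Type*} [Field k] {L : Type*} [AddCommGroup L] [Module k L]
variable {𝓛 : ℤ → Submodule k L} [DirectSum.Decomposition 𝓛]
variable {L' : Type*} [AddCommGroup L'] [Module k L']
variable {𝓛' : ℤ → Submodule k L'} [DirectSum.Decomposition 𝓛']

/-- The coderivation along `Φ` with corestriction `ξ`, for `ξ` of degree `-1`. -/
def coderAlong (ξ : Sym 𝓛 →ₗ[k] L') : (Sym 𝓛 →ₗ[k] Sym 𝓛') →ₗ[k] (Sym 𝓛 →ₗ[k] Sym 𝓛') where
  -- The map `ξ` stands last, as in the bracket; the parity is the Koszul sign for moving the odd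
  -- `ξ` past the argument of `Φ`.
  toFun Φ := conv (Φ ∘ₗ parity 𝓛) (ι 𝓛' ∘ₗ ξ)
  map_add' Φ Ψ := by rw [LinearMap.add_comp, conv_add_left]
  map_smul' c Φ := by rw [LinearMap.smul_comp, conv_smul_left, RingHom.id_apply]

omit [DirectSum.Decomposition 𝓛'] in
theorem coderAlong_apply (ξ : Sym 𝓛 →ₗ[k] L') (Φ : Sym 𝓛 →ₗ[k] Sym 𝓛') :
    coderAlong ξ Φ = conv (Φ ∘ₗ parity 𝓛) (ι 𝓛' ∘ₗ ξ) := rfl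

/-- Coderivation rule for a `Φ` whose coproduct is a sum of maps `f i ⊗ g i`. This generality is
needed because the Taylor coefficients of the flow are not comultiplicative one by one. -/
theorem symComul_coderAlong [CharZero k] {ξ : Sym 𝓛 →ₗ[k] L'}
    (hξ : ∀ X, sgn 𝓛' 1 (ι 𝓛' (ξ X)) = -ι 𝓛' (ξ (sgn 𝓛 1 X))) {σ : Type*} {s : Finset σ}
    {f g : σ → Sym 𝓛 →ₗ[k] Sym 𝓛'} {Φ : Sym 𝓛 →ₗ[k] Sym 𝓛'}
    (hg : ∀ i ∈ s, ∀ X, sgn 𝓛' 1 (g i X) = g i (sgn 𝓛 1 X))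
    (hΦ : ∀ X, symComul 𝓛' (Φ X) = ∑ i ∈ s, TensorProduct.map (f i) (g i) (symComul 𝓛 X))
    (X : Sym 𝓛) :
    symComul 𝓛' (coderAlong ξ Φ X) =
      ∑ i ∈ s, (TensorProduct.map (coderAlong ξ (f i)) (g i) (symComul 𝓛 X) +
        TensorProduct.map (f i ∘ₗ parity 𝓛) (coderAlong ξ (g i)) (symComul 𝓛 X)) := by
  have h1 : ∀ Z : Sym 𝓛 ⊗[k] Sym 𝓛,
      symComul 𝓛' (LinearMap.mul' k _ (TensorProduct.map (Φ ∘ₗ parity 𝓛) (ι 𝓛' ∘ₗ ξ) Z)) =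
      ∑ i ∈ s, rightPrimMul 𝓛' (TensorProduct.map (TensorProduct.map (f i ∘ₗ parity 𝓛)
        (g i ∘ₗ parity 𝓛)) ξ ((symComul 𝓛).rTensor _ Z)) := by
    intro Z
    induction Z using TensorProduct.induction_on with
    | zero => simp
    | add Z Z' hZ hZ' => simp only [map_add, hZ, hZ', Finset.sum_add_distrib]
    | tmul a b =>
      simp only [TensorProduct.map_tmul, LinearMap.mul'_apply, LinearMap.comp_apply,
        symComul_mul_ι, parity_apply, hΦ, LinearMap.rTensor_tmul, symComul_sgn,
        TensorProduct.sum_tmul, map_sum, TensorProduct.map_comp]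
      rfl
  rw [coderAlong_apply, conv_apply, h1]
  refine Finset.sum_congr rfl fun i hi => ?_
  -- Multiplying by the primitive element on the right puts `ξ` in the first tensor factor (`A₁`,
  -- after a flip past `g i`) or in the second (`A₂`).
  let A₁ : Sym 𝓛 ⊗[k] (Sym 𝓛 ⊗[k] Sym 𝓛) →ₗ[k] Sym 𝓛' ⊗[k] Sym 𝓛' :=
    (LinearMap.mul' k (Sym 𝓛')).rTensor _ ∘ₗ (TensorProduct.assoc k _ _ _).symm.toLinearMap ∘ₗ
      TensorProduct.map (f i ∘ₗ parity 𝓛) (TensorProduct.map (ι 𝓛' ∘ₗ ξ) (g i))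
  let A₂ : Sym 𝓛 ⊗[k] (Sym 𝓛 ⊗[k] Sym 𝓛) →ₗ[k] Sym 𝓛' ⊗[k] Sym 𝓛' :=
    TensorProduct.map (f i ∘ₗ parity 𝓛)
      (LinearMap.mul' k _ ∘ₗ TensorProduct.map (g i ∘ₗ parity 𝓛) (ι 𝓛' ∘ₗ ξ))
  have h2 : rightPrimMul 𝓛' ∘ₗ
      TensorProduct.map (TensorProduct.map (f i ∘ₗ parity 𝓛) (g i ∘ₗ parity 𝓛)) ξ =
      (A₁ ∘ₗ (gradedFlip 𝓛).lTensor _ + A₂) ∘ₗ (TensorProduct.assoc k _ _ _).toLinearMap := by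
    refine TensorProduct.ext_threefold fun a b c => ?_
    have := gradedFlip_map (f := ι 𝓛' ∘ₗ ξ) (g := g i) hξ (hg i hi) b c
    simp only [LinearMap.comp_apply] at this
    simp [A₁, A₂, rightPrimMul, parity_apply, this]
  have h3 : ∀ Z : Sym 𝓛 ⊗[k] Sym 𝓛,
      A₁ (TensorProduct.assoc k _ _ _ ((symComul 𝓛).rTensor _ Z)) =
        TensorProduct.map (coderAlong ξ (f i)) (g i) Z := by
    intro Z
    induction Z using TensorProduct.induction_on with
    | zero => simp
    | add Z Z' hZ hZ' => simp only [map_add, hZ, hZ']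
    | tmul a c =>
      rw [LinearMap.rTensor_tmul, TensorProduct.map_tmul, coderAlong_apply, conv_apply]
      induction symComul 𝓛 a using TensorProduct.induction_on with
      | zero => simp
      | add Z Z' hZ hZ' => simp only [map_add, TensorProduct.add_tmul, hZ, hZ']
      | tmul a b => simp [A₁]
  have h4 : ∀ Z : Sym 𝓛 ⊗[k] Sym 𝓛, A₂ ((symComul 𝓛).lTensor _ Z) =
        TensorProduct.map (f i ∘ₗ parity 𝓛) (coderAlong ξ (g i)) Z := by
    intro Z
    rw [← LinearMap.comp_apply]
    congr 1
    exact TensorProduct.ext' fun a b => by simp [A₂, coderAlong_apply, conv_apply]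
  -- Cocommutativity absorbs the flip left over from moving `ξ` past `g i`.
  have h5 : (gradedFlip 𝓛).lTensor (Sym 𝓛) ((symComul 𝓛).lTensor _ (symComul 𝓛 X)) =
      (symComul 𝓛).lTensor _ (symComul 𝓛 X) := by
    rw [← LinearMap.lTensor_comp_apply]
    congr 2
    ext X
    exact symComul_cocomm X
  rw [← LinearMap.comp_apply, h2, LinearMap.comp_apply, LinearEquiv.coe_coe, symComul_coassoc,
    LinearMap.add_apply, LinearMap.comp_apply, h5, h4, ← symComul_coassoc, h3]

/-- The degree `d` component is mapped to the degree `d + e` component. -/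
def RaisesDegree (e : ℤ) (Φ : Sym 𝓛 →ₗ[k] Sym 𝓛') : Prop :=
  ∀ d, ∀ X ∈ symDeg 𝓛 d, Φ X ∈ symDeg 𝓛' (d + e)

omit [DirectSum.Decomposition 𝓛] [DirectSum.Decomposition 𝓛'] in
theorem raisesDegree_of_isHomWord {e : ℤ} {Φ : Sym 𝓛 →ₗ[k] Sym 𝓛'}
    (h : ∀ m d X, IsHomWord 𝓛 m d X → Φ X ∈ symDeg 𝓛' (d + e)) : RaisesDegree e Φ :=
  fun d _ hX => map_mem_of_mem_symDeg (fun m X hX => h m d X hX) hX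

omit [DirectSum.Decomposition 𝓛'] in
theorem RaisesDegree.comp_parity {e : ℤ} {Φ : Sym 𝓛 →ₗ[k] Sym 𝓛'} (h : RaisesDegree e Φ) :
    RaisesDegree e (Φ ∘ₗ parity 𝓛) := fun d X hX => by
  rw [LinearMap.comp_apply, parity_apply, sgn_of_mem_symDeg hX, map_smul]
  exact Submodule.smul_mem _ _ (h d X hX)

omit [DirectSum.Decomposition 𝓛'] in
theorem RaisesDegree.conv {e e' : ℤ} {f g : Sym 𝓛 →ₗ[k] Sym 𝓛'} (hf : RaisesDegree e f)
    (hg : RaisesDegree e' g) : RaisesDegree (e + e') (conv f g) :=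
  raisesDegree_of_isHomWord fun m d X hX => conv_mem hX fun a b c c' u w hu hw _ hd => by
    have := mul_mem_symDeg (hf c u hu.mem_symDeg) (hg c' w hw.mem_symDeg)
    rwa [add_add_add_comm, hd] at this

theorem RaisesDegree.parity_apply {e : ℤ} {Φ : Sym 𝓛 →ₗ[k] Sym 𝓛'} (h : RaisesDegree e Φ)
    (X : Sym 𝓛) : sgn 𝓛' 1 (Φ X) = (-1 : k) ^ e • Φ (sgn 𝓛 1 X) := by
  suffices H : (sgn 𝓛' 1).toLinearMap ∘ₗ Φ = (-1 : k) ^ e • Φ ∘ₗ (sgn 𝓛 1).toLinearMap from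
    DFunLike.congr_fun H X
  refine isHomWord_ext fun m d X hX => ?_
  simp only [LinearMap.comp_apply, AlgHom.toLinearMap_apply, LinearMap.smul_apply,
    sgn_isHomWord hX, map_smul, sgn_of_mem_symDeg (h d X hX.mem_symDeg), smul_smul, one_mul]
  rw [zpow_add₀ (neg_ne_zero.2 one_ne_zero), mul_comm]

theorem RaisesDegree.even {Φ : Sym 𝓛 →ₗ[k] Sym 𝓛'} (h : RaisesDegree 0 Φ) (X : Sym 𝓛) :
    sgn 𝓛' 1 (Φ X) = Φ (sgn 𝓛 1 X) := by simp [h.parity_apply]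

variable (𝓛) in
/-- A codifferential on `S(s⁻¹L)`, vanishing on the constants. -/
structure IsCodifferential (Q : Sym 𝓛 →ₗ[k] Sym 𝓛) : Prop where
  one : Q 1 = 0
  aug : ∀ X, aug 𝓛 (Q X) = 0
  comul : symComul 𝓛 ∘ₗ Q =
    (TensorProduct.map Q LinearMap.id + TensorProduct.map (parity 𝓛) Q) ∘ₗ symComul 𝓛
  sq : ∀ X, Q (Q X) = 0
  degree : RaisesDegree 1 Q

theorem IsCodifferential.parity {Q : Sym 𝓛 →ₗ[k] Sym 𝓛} (h : IsCodifferential 𝓛 Q) (X : Sym 𝓛) :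
    sgn 𝓛 1 (Q X) = -Q (sgn 𝓛 1 X) := by simp [h.degree.parity_apply]

/-- The infinitesimal gauge transformation, extended to all linear maps. -/
def gaugeOp (Q : Sym 𝓛 →ₗ[k] Sym 𝓛) (Q' : Sym 𝓛' →ₗ[k] Sym 𝓛') (ξ : Sym 𝓛 →ₗ[k] L') :
    (Sym 𝓛 →ₗ[k] Sym 𝓛') →ₗ[k] (Sym 𝓛 →ₗ[k] Sym 𝓛') where
  toFun Φ := Q' ∘ₗ coderAlong ξ Φ + coderAlong ξ Φ ∘ₗ Q
  map_add' Φ Ψ := by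
    rw [map_add, LinearMap.comp_add, LinearMap.add_comp]
    abel
  map_smul' c Φ := by
    rw [map_smul, LinearMap.comp_smul, LinearMap.smul_comp, RingHom.id_apply, smul_add]

omit [DirectSum.Decomposition 𝓛'] in
theorem gaugeOp_apply (Q : Sym 𝓛 →ₗ[k] Sym 𝓛) (Q' : Sym 𝓛' →ₗ[k] Sym 𝓛') (ξ : Sym 𝓛 →ₗ[k] L')
    (Φ : Sym 𝓛 →ₗ[k] Sym 𝓛') (X : Sym 𝓛) :
    gaugeOp Q Q' ξ Φ X = Q' (coderAlong ξ Φ X) + coderAlong ξ Φ (Q X) := rfl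

variable {Q : Sym 𝓛 →ₗ[k] Sym 𝓛} {Q' : Sym 𝓛' →ₗ[k] Sym 𝓛'} {ξ : Sym 𝓛 →ₗ[k] L'}

/-- Both sides equal `Q' h(Φ) Q`, because the other term contains a square of a codifferential. -/
theorem gaugeOp_commutes (hQ : IsCodifferential 𝓛 Q) (hQ' : IsCodifferential 𝓛' Q')
    (Φ : Sym 𝓛 →ₗ[k] Sym 𝓛') (X : Sym 𝓛) :
    Q' (gaugeOp Q Q' ξ Φ X) = gaugeOp Q Q' ξ Φ (Q X) := by
  simp [gaugeOp_apply, hQ.sq, hQ'.sq]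

omit [DirectSum.Decomposition 𝓛'] in
theorem coderAlong_degree (hξ : RaisesDegree (-1) (ι 𝓛' ∘ₗ ξ)) {Φ : Sym 𝓛 →ₗ[k] Sym 𝓛'}
    (hΦ : RaisesDegree 0 Φ) : RaisesDegree (-1) (coderAlong ξ Φ) := by
  simpa [coderAlong_apply] using hΦ.comp_parity.conv hξ

theorem gaugeOp_degree (hQ : IsCodifferential 𝓛 Q) (hQ' : IsCodifferential 𝓛' Q')
    (hξ : RaisesDegree (-1) (ι 𝓛' ∘ₗ ξ)) {Φ : Sym 𝓛 →ₗ[k] Sym 𝓛'} (hΦ : RaisesDegree 0 Φ) :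
    RaisesDegree 0 (gaugeOp Q Q' ξ Φ) := fun d X hX => by
  have h := coderAlong_degree hξ hΦ
  refine add_mem ?_ ?_
  · simpa using hQ'.degree _ _ (h d X hX)
  · simpa using h _ _ (hQ.degree d X hX)

theorem aug_gaugeOp (hQ' : IsCodifferential 𝓛' Q') (Φ : Sym 𝓛 →ₗ[k] Sym 𝓛') (X : Sym 𝓛) :
    aug 𝓛' (gaugeOp Q Q' ξ Φ X) = 0 := by
  have h : (aug 𝓛').toLinearMap ∘ₗ coderAlong ξ Φ = 0 := by
    rw [coderAlong_apply, algHom_comp_conv, ← LinearMap.comp_assoc (g := ι 𝓛')]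
    have : (aug 𝓛').toLinearMap ∘ₗ ι 𝓛' = 0 := LinearMap.ext fun x => aug_ι (𝓛 := 𝓛') x
    rw [this, LinearMap.zero_comp, conv_zero_right]
  rw [gaugeOp_apply, map_add, hQ'.aug, zero_add]
  exact DFunLike.congr_fun h (Q X)

omit [DirectSum.Decomposition 𝓛'] in
theorem vanishesBelow_gaugeOp [CharZero k] (hQ : IsCodifferential 𝓛 Q) {n c : ℕ}
    (hξ : VanishesBelow n ξ) {Φ : Sym 𝓛 →ₗ[k] Sym 𝓛'} (hΦ : VanishesBelow c Φ) :
    VanishesBelow (c + n) (gaugeOp Q Q' ξ Φ) :=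
  have h : VanishesBelow (c + n) (coderAlong ξ Φ) := hΦ.comp_parity.conv (hξ.comp (ι 𝓛'))
  (h.comp Q').add (h.comp_coderivation hQ.comul hQ.one)

/-- Expanding `Q' h + h Q` with the two coderivation rules, the mixed terms cancel in pairs: `h(f
i)` and `Q` are odd, and `f i` and `g i` intertwine the codifferentials. What remains is an unsigned
Leibniz rule for the even operator `gaugeOp`. -/
theorem symComul_gaugeOp [CharZero k] (hQ : IsCodifferential 𝓛 Q) (hQ' : IsCodifferential 𝓛' Q')
    (hξ : RaisesDegree (-1) (ι 𝓛' ∘ₗ ξ)) {σ : Type*} {s : Finset σ}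
    {f g : σ → Sym 𝓛 →ₗ[k] Sym 𝓛'} {Φ : Sym 𝓛 →ₗ[k] Sym 𝓛'}
    (hf : ∀ i ∈ s, RaisesDegree 0 (f i)) (hg : ∀ i ∈ s, RaisesDegree 0 (g i))
    (hfQ : ∀ i ∈ s, ∀ X, Q' (f i X) = f i (Q X)) (hgQ : ∀ i ∈ s, ∀ X, Q' (g i X) = g i (Q X))
    (hΦ : ∀ X, symComul 𝓛' (Φ X) = ∑ i ∈ s, TensorProduct.map (f i) (g i) (symComul 𝓛 X))
    (X : Sym 𝓛) :
    symComul 𝓛' (gaugeOp Q Q' ξ Φ X) =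
      ∑ i ∈ s, (TensorProduct.map (gaugeOp Q Q' ξ (f i)) (g i) (symComul 𝓛 X) +
        TensorProduct.map (f i) (gaugeOp Q Q' ξ (g i)) (symComul 𝓛 X)) := by
  have hh := symComul_coderAlong (fun X => by simpa using hξ.parity_apply X)
    (fun i hi => (hg i hi).even) hΦ
  have h1 : ∀ Y, symComul 𝓛' (Q' Y) = _ := DFunLike.congr_fun hQ'.comul
  have h2 : ∀ Y, symComul 𝓛 (Q Y) = _ := DFunLike.congr_fun hQ.comul
  rw [gaugeOp_apply, map_add, h1, hh, LinearMap.comp_apply, hh, h2, map_sum,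
    ← Finset.sum_add_distrib]
  refine Finset.sum_congr rfl fun i hi => ?_
  rw [LinearMap.comp_apply]
  induction symComul 𝓛 X using TensorProduct.induction_on with
  | zero => simp
  | add Z Z' hZ hZ' =>
    simp only [map_add] at hZ hZ' ⊢
    rw [add_add_add_comm (TensorProduct.map (gaugeOp Q Q' ξ (f i)) (g i) Z), ← hZ, ← hZ']
    abel
  | tmul a b =>
    have e1 : sgn 𝓛' 1 (coderAlong ξ (f i) a) = -coderAlong ξ (f i) (sgn 𝓛 1 a) := by
      simpa using (coderAlong_degree hξ (hf i hi)).parity_apply a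
    simp only [map_add, TensorProduct.map_tmul, LinearMap.add_apply, LinearMap.comp_apply,
      LinearMap.id_apply, parity_apply, e1, gaugeOp_apply, TensorProduct.add_tmul,
      TensorProduct.tmul_add, hgQ i hi, hfQ i hi, (hf i hi).even, hQ.parity, map_neg,
      TensorProduct.neg_tmul, parity_parity]
    abel

end Flow

/-! ### Locally finite sums -/

section LocallyFinite

variable {k : Type*} [Field k] {M W W' : Type*} [AddCommGroup M] [Module k M] [AddCommGroup W]
  [Module k W] [AddCommGroup W'] [Module k W']

omit [Module k W] in
theorem sumsTo_of_vanish {a : ℕ → W} {N : ℕ} (h : ∀ j ≥ N, a j = 0) :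
    SumsTo a (∑ j ∈ Finset.range N, a j) :=
  ⟨N, fun M hM => (Finset.sum_subset (Finset.range_mono hM) fun j _ hj =>
    h j (by simpa using hj)).symm⟩

omit [Module k W] in
theorem SumsTo.unique {a : ℕ → W} {v w : W} (hv : SumsTo a v) (hw : SumsTo a w) : v = w := by
  obtain ⟨N, hN⟩ := hv
  obtain ⟨N', hN'⟩ := hw
  rw [← hN (N + N') (by omega), hN' (N + N') (by omega)]

omit [Module k W] in
theorem SumsTo.congr {a b : ℕ → W} {v : W} (h : SumsTo a v) (hab : ∀ j, b j = a j) :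
    SumsTo b v := funext hab ▸ h

omit [Module k W] in
theorem SumsTo.add {a b : ℕ → W} {v w : W} (hv : SumsTo a v) (hw : SumsTo b w) :
    SumsTo (fun j => a j + b j) (v + w) := by
  obtain ⟨N, hN⟩ := hv
  obtain ⟨N', hN'⟩ := hw
  exact ⟨N + N', fun M hM => by
    rw [Finset.sum_add_distrib, hN M (by omega), hN' M (by omega)]⟩

theorem SumsTo.map {a : ℕ → W} {v : W} (hv : SumsTo a v) (f : W →ₗ[k] W') :
    SumsTo (fun j => f (a j)) (f v) := by
  obtain ⟨N, hN⟩ := hv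
  exact ⟨N, fun M hM => by rw [← map_sum, hN M hM]⟩

omit [Module k W] in
theorem sumsTo_zero : SumsTo (fun _ => (0 : W)) 0 := ⟨0, fun _ _ => by simp⟩

omit [Module k W] in
theorem sumsTo_single (v : W) : SumsTo (fun j => if j = 0 then v else 0) v := by
  simpa using sumsTo_of_vanish (a := fun j => if j = 0 then v else 0) (N := 1)
    fun j hj => if_neg (by omega)

omit [Module k W] in
theorem SumsTo.succ {a : ℕ → W} {v : W} (h : SumsTo a v) : SumsTo (fun j => a (j + 1)) (v - a 0) := by
  obtain ⟨N, hN⟩ := h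
  exact ⟨N, fun M hM => by rw [← hN (M + 1) (by omega), Finset.sum_range_succ', add_sub_cancel_right]⟩

/-- The sum of a locally finite family of linear maps. -/
def locSum (f : ℕ → M →ₗ[k] W) (hf : ∀ X, ∃ N, ∀ j ≥ N, f j X = 0) : M →ₗ[k] W where
  toFun X := ∑ j ∈ Finset.range (hf X).choose, f j X
  map_add' X Y := by
    refine (sumsTo_of_vanish (hf (X + Y)).choose_spec).unique ?_
    simpa using (sumsTo_of_vanish (hf X).choose_spec).add (sumsTo_of_vanish (hf Y).choose_spec)
  map_smul' c X := by
    refine (sumsTo_of_vanish (hf (c • X)).choose_spec).unique ?_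
    simpa [← Finset.smul_sum] using
      (sumsTo_of_vanish (hf X).choose_spec).map (LinearMap.lsmul k W c)

theorem sumsTo_locSum (f : ℕ → M →ₗ[k] W) (hf : ∀ X, ∃ N, ∀ j ≥ N, f j X = 0) (X : M) :
    SumsTo (fun j => f j X) (locSum f hf X) :=
  sumsTo_of_vanish (hf X).choose_spec

theorem sumsTo_antidiagonal {a : ℕ → W} {b : ℕ → W'} {v : W} {w : W'} {N N' : ℕ}
    (ha : ∀ j ≥ N, a j = 0) (hb : ∀ j ≥ N', b j = 0) (hv : SumsTo a v) (hw : SumsTo b w) :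
    SumsTo (fun j => ∑ p ∈ Finset.HasAntidiagonal.antidiagonal j, a p.1 ⊗ₜ[k] b p.2) (v ⊗ₜ[k] w) := by
  rw [hv.unique (sumsTo_of_vanish ha), hw.unique (sumsTo_of_vanish hb)]
  refine ⟨N + N', fun M hM => ?_⟩
  -- The triangle below the antidiagonal `M ≥ N + N'` contains the rectangle `N × N'`, outside of
  -- which all terms vanish.
  let s := (Finset.range M ×ˢ Finset.range M).filter fun p => p.1 + p.2 < M
  have h1 : ∀ j ∈ Finset.range M, Finset.HasAntidiagonal.antidiagonal j = s.filter fun p => p.1 + p.2 = j := by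
    intro j hj
    ext p
    simp only [s, Finset.HasAntidiagonal.mem_antidiagonal, Finset.mem_filter, Finset.mem_product,
      Finset.mem_range] at hj ⊢
    omega
  have h2 := Finset.sum_congr (rfl : Finset.range M = _) fun j hj =>
    congrArg (fun u => ∑ p ∈ u, a p.1 ⊗ₜ[k] b p.2) (h1 j hj)
  rw [h2, Finset.sum_fiberwise_of_maps_to (fun p hp => by
      simp only [s, Finset.mem_filter] at hp
      exact Finset.mem_range.2 hp.2), TensorProduct.sum_tmul]
  simp only [TensorProduct.tmul_sum]
  rw [← Finset.sum_product']
  refine (Finset.sum_subset (fun p hp => ?_) fun p _ hp => ?_).symm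
  · simp only [s, Finset.mem_filter, Finset.mem_product, Finset.mem_range] at hp ⊢
    omega
  · simp only [Finset.mem_product, Finset.mem_range, not_and_or, not_lt] at hp
    rcases hp with hp | hp
    · rw [ha _ hp, TensorProduct.zero_tmul]
    · rw [hb _ hp, TensorProduct.tmul_zero]

end LocallyFinite

/-! ### Integration of the gauge flow -/

section Flow

variable {k : Type*} [Field k] [CharZero k] {L : Type*} [AddCommGroup L] [Module k L]
variable {𝓛 : ℤ → Submodule k L} [DirectSum.Decomposition 𝓛]
variable {L' : Type*} [AddCommGroup L'] [Module k L']
variable {𝓛' : ℤ → Submodule k L'} [DirectSum.Decomposition 𝓛']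

omit [CharZero k] in
theorem sumsTo_conv_left {R : Type*} [Ring R] [Algebra k R] {f : ℕ → Sym 𝓛 →ₗ[k] R}
    {Φ : Sym 𝓛 →ₗ[k] R} (h : ∀ X, SumsTo (fun j => f j X) (Φ X)) (g : Sym 𝓛 →ₗ[k] R)
    (X : Sym 𝓛) : SumsTo (fun j => conv (f j) g X) (conv Φ g X) := by
  simp only [conv_apply]
  induction symComul 𝓛 X using TensorProduct.induction_on with
  | zero => simpa using sumsTo_zero
  | add Z Z' hZ hZ' => simpa only [map_add] using hZ.add hZ'
  | tmul a b => simpa using (h a).map (LinearMap.mulRight k (g b))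

/-- `Φ` is a morphism of differential graded coalgebras preserving the units. -/
structure IsDGMorphism (Q : Sym 𝓛 →ₗ[k] Sym 𝓛) (Q' : Sym 𝓛' →ₗ[k] Sym 𝓛')
    (Φ : Sym 𝓛 →ₗ[k] Sym 𝓛') : Prop where
  one : Φ 1 = 1
  aug : ∀ X, LInfty.aug 𝓛' (Φ X) = LInfty.aug 𝓛 X
  comul : symComul 𝓛' ∘ₗ Φ = TensorProduct.map Φ Φ ∘ₗ symComul 𝓛
  commutes : ∀ X, Q' (Φ X) = Φ (Q X)
  degree : RaisesDegree 0 Φ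

/-- Convolution powers pull back along coalgebra morphisms, so the exponential formula for the
identity becomes one that recovers `Φ` from its corestriction. -/
theorem IsDGMorphism.sumsTo {Q : Sym 𝓛 →ₗ[k] Sym 𝓛} {Q' : Sym 𝓛' →ₗ[k] Sym 𝓛'}
    {Φ : Sym 𝓛 →ₗ[k] Sym 𝓛'} (h : IsDGMorphism Q Q' Φ) (X : Sym 𝓛) :
    SumsTo (fun m => ((m.factorial : k)⁻¹ • convPow (genProj 𝓛' ∘ₗ Φ) m) X) (Φ X) := by
  simp only [← convPow_comp_of_comul h.comul h.aug]
  exact sum_wordProj (Φ X)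

/-- The coefficients of the solution of the equation `dΦ/dt = gaugeOp Φ`. -/
def gaugeCoeff (Q : Sym 𝓛 →ₗ[k] Sym 𝓛) (Q' : Sym 𝓛' →ₗ[k] Sym 𝓛') (ξ : Sym 𝓛 →ₗ[k] L')
    (Φ : Sym 𝓛 →ₗ[k] Sym 𝓛') : ℕ → (Sym 𝓛 →ₗ[k] Sym 𝓛')
  | 0 => Φ
  | j + 1 => (j + 1 : k)⁻¹ • gaugeOp Q Q' ξ (gaugeCoeff Q Q' ξ Φ j)

variable {Q : Sym 𝓛 →ₗ[k] Sym 𝓛} {Q' : Sym 𝓛' →ₗ[k] Sym 𝓛'} {ξ : Sym 𝓛 →ₗ[k] L'}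
variable {Φ : Sym 𝓛 →ₗ[k] Sym 𝓛'}

omit [DirectSum.Decomposition 𝓛'] in
theorem smul_gaugeCoeff_succ (j : ℕ) :
    (j + 1 : k) • gaugeCoeff Q Q' ξ Φ (j + 1) = gaugeOp Q Q' ξ (gaugeCoeff Q Q' ξ Φ j) := by
  have h : (j + 1 : k) ≠ 0 := by exact_mod_cast j.succ_ne_zero
  rw [gaugeCoeff, smul_smul, mul_inv_cancel₀ h, one_smul]

omit [DirectSum.Decomposition 𝓛'] in
theorem vanishesBelow_gaugeCoeff (hQ : IsCodifferential 𝓛 Q) {n : ℕ} (hξ : VanishesBelow n ξ)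
    (j : ℕ) : VanishesBelow (j * n) (gaugeCoeff Q Q' ξ Φ j) := by
  induction j with
  | zero => rw [zero_mul]; exact vanishesBelow_zero _
  | succ j ih =>
    rw [Nat.succ_mul, gaugeCoeff]
    exact (vanishesBelow_gaugeOp hQ hξ ih).comp (LinearMap.lsmul k _ (j + 1 : k)⁻¹)

omit [CharZero k] in
theorem gaugeCoeff_degree (hQ : IsCodifferential 𝓛 Q) (hQ' : IsCodifferential 𝓛' Q')
    (hξ : RaisesDegree (-1) (ι 𝓛' ∘ₗ ξ)) (hΦ : IsDGMorphism Q Q' Φ) (j : ℕ) :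
    RaisesDegree 0 (gaugeCoeff Q Q' ξ Φ j) := by
  induction j with
  | zero => exact hΦ.degree
  | succ j ih =>
    exact fun d X hX => Submodule.smul_mem _ _ (gaugeOp_degree hQ hQ' hξ ih d X hX)

omit [CharZero k] in
theorem gaugeCoeff_commutes (hQ : IsCodifferential 𝓛 Q) (hQ' : IsCodifferential 𝓛' Q')
    (hΦ : IsDGMorphism Q Q' Φ) (j : ℕ) (X : Sym 𝓛) :
    Q' (gaugeCoeff Q Q' ξ Φ j X) = gaugeCoeff Q Q' ξ Φ j (Q X) := by
  cases j with
  | zero => exact hΦ.commutes X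
  | succ j => simp only [gaugeCoeff, LinearMap.smul_apply, map_smul, gaugeOp_commutes hQ hQ']

/-- The iterated Leibniz rule: dividing by factorials turns the binomial formula into a Cauchy
product. -/
theorem symComul_gaugeCoeff (hQ : IsCodifferential 𝓛 Q) (hQ' : IsCodifferential 𝓛' Q')
    (hξ : RaisesDegree (-1) (ι 𝓛' ∘ₗ ξ)) (hΦ : IsDGMorphism Q Q' Φ) (j : ℕ) (X : Sym 𝓛) :
    symComul 𝓛' (gaugeCoeff Q Q' ξ Φ j X) = ∑ p ∈ Finset.HasAntidiagonal.antidiagonal j,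
      TensorProduct.map (gaugeCoeff Q Q' ξ Φ p.1) (gaugeCoeff Q Q' ξ Φ p.2) (symComul 𝓛 X) := by
  induction j generalizing X with
  | zero => simpa [gaugeCoeff] using DFunLike.congr_fun hΦ.comul X
  | succ j ih =>
    have hj : (j + 1 : k) ≠ 0 := by exact_mod_cast j.succ_ne_zero
    have h := symComul_gaugeOp hQ hQ' hξ
      (fun p (_ : p ∈ Finset.HasAntidiagonal.antidiagonal j) => gaugeCoeff_degree hQ hQ' hξ hΦ p.1)
      (fun p (_ : p ∈ Finset.HasAntidiagonal.antidiagonal j) => gaugeCoeff_degree hQ hQ' hξ hΦ p.2)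
      (fun p _ => gaugeCoeff_commutes hQ hQ' hΦ p.1)
      (fun p _ => gaugeCoeff_commutes hQ hQ' hΦ p.2) ih X
    let G : ℕ × ℕ → Sym 𝓛' ⊗[k] Sym 𝓛' := fun p =>
      TensorProduct.map (gaugeCoeff Q Q' ξ Φ p.1) (gaugeCoeff Q Q' ξ Φ p.2) (symComul 𝓛 X)
    -- After reindexing, the two halves of the Leibniz rule weight `G p` by `p.1` and `p.2`, which
    -- add up to `j + 1`.
    have h1 : ∑ p ∈ Finset.HasAntidiagonal.antidiagonal j, ((p.1 : k) + 1) • G (p.1 + 1, p.2) =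
        ∑ p ∈ Finset.HasAntidiagonal.antidiagonal (j + 1), (p.1 : k) • G p := by
      simp [Finset.Nat.sum_antidiagonal_succ]
    have h2 : ∑ p ∈ Finset.HasAntidiagonal.antidiagonal j, ((p.2 : k) + 1) • G (p.1, p.2 + 1) =
        ∑ p ∈ Finset.HasAntidiagonal.antidiagonal (j + 1), (p.2 : k) • G p := by
      simp [Finset.Nat.sum_antidiagonal_succ']
    rw [← smul_gaugeCoeff_succ, LinearMap.smul_apply, map_smul] at h
    have h3 : (j + 1 : k) • ∑ p ∈ Finset.HasAntidiagonal.antidiagonal (j + 1), G p =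
        ∑ p ∈ Finset.HasAntidiagonal.antidiagonal (j + 1), (p.1 : k) • G p +
        ∑ p ∈ Finset.HasAntidiagonal.antidiagonal (j + 1), (p.2 : k) • G p := by
      rw [Finset.smul_sum, ← Finset.sum_add_distrib]
      refine Finset.sum_congr rfl fun p hp => ?_
      rw [← add_smul, ← Nat.cast_add, Finset.HasAntidiagonal.mem_antidiagonal.1 hp]
      push_cast
      rfl
    refine smul_right_injective _ hj ?_
    simp only
    rw [h, h3, ← h1, ← h2, ← Finset.sum_add_distrib]
    refine Finset.sum_congr rfl fun p _ => ?_
    simp only [G, ← smul_gaugeCoeff_succ, TensorProduct.map_smul_left,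
      TensorProduct.map_smul_right, LinearMap.smul_apply]

omit [DirectSum.Decomposition 𝓛'] in
theorem gaugeCoeff_locallyFinite (hQ : IsCodifferential 𝓛 Q) {n : ℕ} (hn : 1 ≤ n)
    (hξ : VanishesBelow n ξ) (t : k) (X : Sym 𝓛) :
    ∃ N, ∀ j ≥ N, (t ^ j • gaugeCoeff Q Q' ξ Φ j) X = 0 :=
  VanishesBelow.eventually (fun j => (((vanishesBelow_gaugeCoeff hQ hξ j).mono
    (Nat.le_mul_of_pos_right j hn)).comp (LinearMap.lsmul k _ (t ^ j)))) X

/-- The solution at time `t` of the equation `dΦ/dt = gaugeOp Φ` with initial value `Φ`. -/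
def gaugeFlow (hQ : IsCodifferential 𝓛 Q) (Q' : Sym 𝓛' →ₗ[k] Sym 𝓛') {n : ℕ} (hn : 1 ≤ n)
    (hξ : VanishesBelow n ξ) (Φ : Sym 𝓛 →ₗ[k] Sym 𝓛') (t : k) : Sym 𝓛 →ₗ[k] Sym 𝓛' :=
  locSum (fun j => t ^ j • gaugeCoeff Q Q' ξ Φ j) (gaugeCoeff_locallyFinite hQ hn hξ t)

variable (hQ : IsCodifferential 𝓛 Q) {n : ℕ} (hn : 1 ≤ n) (hξn : VanishesBelow n ξ)

omit [DirectSum.Decomposition 𝓛'] in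
theorem sumsTo_gaugeFlow (t : k) (X : Sym 𝓛) :
    SumsTo (fun j => t ^ j • gaugeCoeff Q Q' ξ Φ j X) (gaugeFlow hQ Q' hn hξn Φ t X) :=
  sumsTo_locSum _ (gaugeCoeff_locallyFinite hQ hn hξn t) X

omit [DirectSum.Decomposition 𝓛'] in
theorem gaugeFlow_zero : gaugeFlow hQ Q' hn hξn Φ 0 = Φ := by
  ext X
  refine (sumsTo_gaugeFlow hQ hn hξn 0 X).unique ?_
  refine (sumsTo_single (Φ X)).congr fun j => ?_
  split_ifs with h
  · simp [h, gaugeCoeff]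
  · simp [h]

omit [DirectSum.Decomposition 𝓛'] in
/-- On words of length `m < N n` only the first `N` coefficients of the flow matter. -/
theorem gaugeFlow_word (t : k) {N m : ℕ} (hm : m < N * n) (γ : Fin m → L) :
    gaugeFlow hQ Q' hn hξn Φ t (word 𝓛 γ) =
      ∑ j ∈ Finset.range N, t ^ j • gaugeCoeff Q Q' ξ Φ j (word 𝓛 γ) := by
  refine (sumsTo_gaugeFlow hQ hn hξn t _).unique (sumsTo_of_vanish fun j hj => ?_)
  rw [(vanishesBelow_gaugeCoeff hQ hξn j).map_word
    (hm.trans_le (Nat.mul_le_mul_right n hj)), smul_zero]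

/-- The Cauchy product relation for the coefficients says that their generating series is
comultiplicative. -/
theorem symComul_gaugeFlow (hQ' : IsCodifferential 𝓛' Q') (hξ : RaisesDegree (-1) (ι 𝓛' ∘ₗ ξ))
    (hΦ : IsDGMorphism Q Q' Φ) (t : k) (X : Sym 𝓛) :
    symComul 𝓛' (gaugeFlow hQ Q' hn hξn Φ t X) =
      TensorProduct.map (gaugeFlow hQ Q' hn hξn Φ t) (gaugeFlow hQ Q' hn hξn Φ t)
        (symComul 𝓛 X) := by
  refine ((sumsTo_gaugeFlow hQ hn hξn t X).map (symComul 𝓛')).unique ?_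
  simp only [map_smul, symComul_gaugeCoeff hQ hQ' hξ hΦ, Finset.smul_sum]
  induction symComul 𝓛 X using TensorProduct.induction_on with
  | zero => simpa using sumsTo_zero
  | add Z Z' hZ hZ' => simpa only [map_add, smul_add, Finset.sum_add_distrib] using hZ.add hZ'
  | tmul a b =>
    obtain ⟨N, hN⟩ := gaugeCoeff_locallyFinite hQ hn hξn (Q' := Q') (Φ := Φ) t a
    obtain ⟨N', hN'⟩ := gaugeCoeff_locallyFinite hQ hn hξn (Q' := Q') (Φ := Φ) t b
    have := sumsTo_antidiagonal (k := k) hN hN' (sumsTo_gaugeFlow hQ hn hξn t a)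
      (sumsTo_gaugeFlow hQ hn hξn t b)
    refine this.congr fun j => Finset.sum_congr rfl fun p hp => ?_
    rw [← Finset.HasAntidiagonal.mem_antidiagonal.1 hp, TensorProduct.map_tmul,
      LinearMap.smul_apply, LinearMap.smul_apply, TensorProduct.smul_tmul_smul, pow_add]

theorem isDGMorphism_gaugeFlow (hQ' : IsCodifferential 𝓛' Q')
    (hξ : RaisesDegree (-1) (ι 𝓛' ∘ₗ ξ)) (hΦ : IsDGMorphism Q Q' Φ) (t : k) :
    IsDGMorphism Q Q' (gaugeFlow hQ Q' hn hξn Φ t) where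
  one := by
    have := gaugeFlow_word hQ hn hξn (Q' := Q') (Φ := Φ) t (N := 1) (m := 0) (by omega) Fin.elim0
    simpa [gaugeCoeff, hΦ.one] using this
  aug X := by
    refine ((sumsTo_gaugeFlow hQ hn hξn t X).map (aug 𝓛').toLinearMap).unique
      ((sumsTo_single (aug 𝓛 X)).congr fun j => ?_)
    cases j with
    | zero => simp [gaugeCoeff, hΦ.aug]
    | succ j => simp [gaugeCoeff, aug_gaugeOp hQ']
  comul := LinearMap.ext fun X => symComul_gaugeFlow hQ hn hξn hQ' hξ hΦ t X
  commutes X := by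
    refine ((sumsTo_gaugeFlow hQ hn hξn t X).map Q').unique ?_
    exact (sumsTo_gaugeFlow hQ hn hξn t (Q X)).congr fun j => by
      rw [map_smul, gaugeCoeff_commutes hQ hQ' hΦ]
  degree d X hX := by
    obtain ⟨N, hN⟩ := sumsTo_gaugeFlow hQ hn hξn (Q' := Q') (Φ := Φ) t X
    rw [← hN N le_rfl]
    exact Submodule.sum_mem _ fun j _ =>
      Submodule.smul_mem _ _ (gaugeCoeff_degree hQ hQ' hξ hΦ j d X hX)

omit [CharZero k] [DirectSum.Decomposition 𝓛'] in
theorem sumsTo_gaugeOp {f : ℕ → Sym 𝓛 →ₗ[k] Sym 𝓛'} {Ψ : Sym 𝓛 →ₗ[k] Sym 𝓛'}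
    (h : ∀ X, SumsTo (fun j => f j X) (Ψ X)) (X : Sym 𝓛) :
    SumsTo (fun j => gaugeOp Q Q' ξ (f j) X) (gaugeOp Q Q' ξ Ψ X) := by
  have h' := fun X => sumsTo_conv_left (f := fun j => f j ∘ₗ parity 𝓛) (Φ := Ψ ∘ₗ parity 𝓛)
    (fun X => h _) (ι 𝓛' ∘ₗ ξ) X
  exact ((h' X).map Q').add (h' (Q X))

omit [DirectSum.Decomposition 𝓛'] in
/-- The differential equation satisfied by the flow. -/
theorem sumsTo_deriv_gaugeFlow (t : k) (X : Sym 𝓛) :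
    SumsTo (fun j => ((j + 1 : k) * t ^ j) • gaugeCoeff Q Q' ξ Φ (j + 1) X)
      (gaugeOp Q Q' ξ (gaugeFlow hQ Q' hn hξn Φ t) X) := by
  convert sumsTo_gaugeOp (Q := Q) (Q' := Q') (ξ := ξ)
    (f := fun j => t ^ j • gaugeCoeff Q Q' ξ Φ j) (sumsTo_gaugeFlow hQ hn hξn t) X using 2 with j
  rw [map_smul, ← smul_gaugeCoeff_succ, smul_smul, mul_comm]
  rfl

omit [CharZero k] in
-- Projecting a product to the generators forces one factor to be constant; `ι ξ` has no constant
-- part, so only the counit of `Φ` contributes.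
theorem symProj_coderAlong (hΦ : ∀ X, aug 𝓛' (Φ X) = aug 𝓛 X) (X : Sym 𝓛) :
    symProj 𝓛' (coderAlong ξ Φ X) = ξ X := by
  have h : ∀ Z : Sym 𝓛 ⊗[k] Sym 𝓛, symProj 𝓛' (LinearMap.mul' k _ (TensorProduct.map
      (Φ ∘ₗ parity 𝓛) (ι 𝓛' ∘ₗ ξ) Z)) =
      ξ (TensorProduct.lid k _ ((aug 𝓛).toLinearMap.rTensor _ Z)) := by
    intro Z
    induction Z using TensorProduct.induction_on with
    | zero => simp
    | add Z Z' hZ hZ' => simp only [map_add, hZ, hZ']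
    | tmul a b => simp [symProj_mul, hΦ, parity_apply]
  rw [coderAlong_apply, conv_apply, h, rTensor_aug_symComul]

omit [CharZero k] in
theorem symProj_gaugeOp (hΦ : ∀ X, aug 𝓛' (Φ X) = aug 𝓛 X) (X : Sym 𝓛) :
    symProj 𝓛' (gaugeOp Q Q' ξ Φ X) = symProj 𝓛' (Q' (coderAlong ξ Φ X)) + ξ (Q X) := by
  rw [gaugeOp_apply, map_add, symProj_coderAlong hΦ]

/-- Expanding `Φ` as an exponential turns `h(Φ)` into the products of copies of the corestriction of
`Φ` with one `ξ` that occur in the twisted differential. -/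
theorem sumsTo_coderAlong (hΦ : IsDGMorphism Q Q' Φ) (X : Sym 𝓛) :
    SumsTo (fun m => (m.factorial : k)⁻¹ •
      conv (convPow (genProj 𝓛' ∘ₗ Φ ∘ₗ parity 𝓛) m) (ι 𝓛' ∘ₗ ξ) X) (coderAlong ξ Φ X) := by
  have hp : symComul 𝓛 ∘ₗ parity 𝓛 = TensorProduct.map (parity 𝓛) (parity 𝓛) ∘ₗ symComul 𝓛 :=
    LinearMap.ext fun X => symComul_sgn 1 X
  refine (sumsTo_conv_left
    (f := fun m => ((m.factorial : k)⁻¹ • convPow (genProj 𝓛' ∘ₗ Φ) m) ∘ₗ parity 𝓛)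
    (Φ := Φ ∘ₗ parity 𝓛) (fun X => hΦ.sumsTo (parity 𝓛 X)) (ι 𝓛' ∘ₗ ξ) X).congr fun m => ?_
  rw [← LinearMap.comp_assoc, ← convPow_comp_of_comul hp (aug_sgn 1), ← LinearMap.smul_apply,
    ← conv_smul_left, LinearMap.smul_comp]

end Flow

/-! ### Comparison of `C(L)` with the unital coalgebra -/

section Reduced

variable {k : Type*} [Field k] {L : Type*} [AddCommGroup L] [Module k L]
variable {𝓛 : ℤ → Submodule k L}

theorem incl_red (X : Sym 𝓛) : incl 𝓛 (red 𝓛 X) = X - algebraMap k _ (aug 𝓛 X) := rfl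

@[simp] theorem red_incl (X : C 𝓛) : red 𝓛 (incl 𝓛 X) = X := by
  have h : aug 𝓛 (incl 𝓛 X) = 0 := X.2
  apply Subtype.ext
  change incl 𝓛 (red 𝓛 (incl 𝓛 X)) = incl 𝓛 X
  rw [incl_red, h, map_zero, sub_zero]

@[simp] theorem aug_incl (X : C 𝓛) : aug 𝓛 (incl 𝓛 X) = 0 := X.2

theorem incl_red_of_aug {X : Sym 𝓛} (hX : aug 𝓛 X = 0) : incl 𝓛 (red 𝓛 X) = X := by
  rw [incl_red, hX, map_zero, sub_zero]

@[simp] theorem red_one : red 𝓛 1 = 0 := by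
  apply Subtype.ext
  change incl 𝓛 (red 𝓛 1) = 0
  simp [incl_red]

theorem eq_incl_red_add (X : Sym 𝓛) : X = incl 𝓛 (red 𝓛 X) + aug 𝓛 X • 1 := by
  rw [incl_red, Algebra.algebraMap_eq_smul_one, sub_add_cancel]

theorem linearMap_ext_incl {W : Type*} [AddCommGroup W] [Module k W] {f g : Sym 𝓛 →ₗ[k] W}
    (one : f 1 = g 1) (h : ∀ X : C 𝓛, f (incl 𝓛 X) = g (incl 𝓛 X)) : f = g := by
  ext X
  rw [eq_incl_red_add X, map_add, map_add, map_smul, map_smul, one, h]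

theorem pr_apply (X : C 𝓛) : pr 𝓛 X = symProj 𝓛 (incl 𝓛 X) := rfl

theorem IsHomWord.incl_red {m : ℕ} {d : ℤ} {X : Sym 𝓛} (hX : IsHomWord 𝓛 m d X) :
    incl 𝓛 (red 𝓛 X) = if m = 0 then 0 else X := by
  cases hX with
  | one => simp
  | mul hv hX => rw [if_neg (by omega), incl_red_of_aug (by simp)]

theorem incl_red_mem_symDeg {d : ℤ} {X : Sym 𝓛} (hX : X ∈ symDeg 𝓛 d) :
    incl 𝓛 (red 𝓛 X) ∈ symDeg 𝓛 d := by
  refine map_mem_of_mem_symDeg (f := incl 𝓛 ∘ₗ red 𝓛) (fun m X hX => ?_) hX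
  rw [LinearMap.comp_apply, hX.incl_red]
  split_ifs
  · exact zero_mem _
  · exact hX.mem_symDeg

theorem symProj_mem {d : ℤ} {X : Sym 𝓛} (hX : X ∈ symDeg 𝓛 d) : symProj 𝓛 X ∈ 𝓛 (d + 1) := by
  refine map_mem_of_mem_symDeg (fun m X hX => ?_) hX
  cases hX with
  | one => simp
  | mul hv hY =>
    rw [symProj_ι_mul]
    cases hY with
    | one => simpa using hv
    | mul _ _ => simp

variable [DirectSum.Decomposition 𝓛]

theorem csgn_red (e : ℤ) (X : Sym 𝓛) : csgn 𝓛 e (red 𝓛 X) = red 𝓛 (sgn 𝓛 e X) := by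
  change red 𝓛 (sgn 𝓛 e (incl 𝓛 (red 𝓛 X))) = _
  rw [incl_red, Algebra.algebraMap_eq_smul_one]
  simp

theorem incl_csgn (e : ℤ) (X : C 𝓛) : incl 𝓛 (csgn 𝓛 e X) = sgn 𝓛 e (incl 𝓛 X) :=
  incl_red_of_aug (by simp)

theorem comul_red (X : Sym 𝓛) :
    comul 𝓛 (red 𝓛 X) = TensorProduct.map (red 𝓛) (red 𝓛) (symComul 𝓛 X) := by
  change TensorProduct.map _ _ (symComul 𝓛 (incl 𝓛 (red 𝓛 X))) = _
  rw [incl_red, Algebra.algebraMap_eq_smul_one]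
  simp

theorem symComul_incl (X : C 𝓛) : symComul 𝓛 (incl 𝓛 X) =
    TensorProduct.map (incl 𝓛) (incl 𝓛) (comul 𝓛 X) + incl 𝓛 X ⊗ₜ 1 + 1 ⊗ₜ incl 𝓛 X := by
  have h : ∀ Z : Sym 𝓛 ⊗[k] Sym 𝓛, Z + aug 𝓛 (TensorProduct.lid k _
      ((aug 𝓛).toLinearMap.rTensor _ Z)) • (1 ⊗ₜ[k] 1) =
      TensorProduct.map (incl 𝓛) (incl 𝓛) (TensorProduct.map (red 𝓛) (red 𝓛) Z) +
      TensorProduct.rid k _ ((aug 𝓛).toLinearMap.lTensor _ Z) ⊗ₜ[k] 1 +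
      1 ⊗ₜ[k] TensorProduct.lid k _ ((aug 𝓛).toLinearMap.rTensor _ Z) := by
    intro Z
    induction Z using TensorProduct.induction_on with
    | zero => simp
    | add Z Z' hZ hZ' =>
      simp only [map_add, TensorProduct.tmul_add, TensorProduct.add_tmul, add_smul]
      rw [add_add_add_comm, hZ, hZ']
      abel
    | tmul a b =>
      simp only [TensorProduct.map_tmul, incl_red, LinearMap.rTensor_tmul, LinearMap.lTensor_tmul,
        TensorProduct.lid_tmul, TensorProduct.rid_tmul, AlgHom.toLinearMap_apply,
        Algebra.algebraMap_eq_smul_one, map_smul, TensorProduct.sub_tmul, TensorProduct.tmul_sub,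
        TensorProduct.tmul_smul, ← TensorProduct.smul_tmul', smul_eq_mul]
      module
  have := h (symComul 𝓛 (incl 𝓛 X))
  rwa [rTensor_aug_symComul, lTensor_aug_symComul, aug_incl, zero_smul, add_zero] at this

end Reduced

/-! ### Passing `L∞`-structures and morphisms to the unital coalgebra and back -/

section Extension

variable {k : Type*} [Field k] {L : Type*} [AddCommGroup L] [Module k L]
variable {L' : Type*} [AddCommGroup L'] [Module k L']
variable {𝓛 : ℤ → Submodule k L} [DirectSum.Decomposition 𝓛]
variable {𝓛' : ℤ → Submodule k L'} [DirectSum.Decomposition 𝓛']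

/-- The extension of the codifferential to `S(s⁻¹L)`, by zero on the constants. -/
def LInfinityAlgebra.ext (A : LInfinityAlgebra 𝓛) : Sym 𝓛 →ₗ[k] Sym 𝓛 := incl 𝓛 ∘ₗ A.Q ∘ₗ red 𝓛

theorem LInfinityAlgebra.ext_apply (A : LInfinityAlgebra 𝓛) (X : Sym 𝓛) :
    A.ext X = incl 𝓛 (A.Q (red 𝓛 X)) := rfl

theorem LInfinityAlgebra.isCodifferential (A : LInfinityAlgebra 𝓛) :
    IsCodifferential 𝓛 A.ext where
  one := by simp [A.ext_apply]
  aug X := by simp [A.ext_apply]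
  comul := by
    refine linearMap_ext_incl (by simp [A.ext_apply]) fun X => ?_
    simp only [LinearMap.comp_apply, A.ext_apply, red_incl, symComul_incl]
    have h := DFunLike.congr_fun A.coderivation X
    simp only [LinearMap.comp_apply] at h
    rw [h, map_add, map_add]
    have h' : ∀ Z, TensorProduct.map (incl 𝓛) (incl 𝓛)
        ((TensorProduct.map A.Q LinearMap.id + TensorProduct.map (csgn 𝓛 1) A.Q :
          C 𝓛 ⊗[k] C 𝓛 →ₗ[k] C 𝓛 ⊗[k] C 𝓛) Z) =
        (TensorProduct.map A.ext LinearMap.id + TensorProduct.map (parity 𝓛) A.ext :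
          Sym 𝓛 ⊗[k] Sym 𝓛 →ₗ[k] Sym 𝓛 ⊗[k] Sym 𝓛)
          (TensorProduct.map (incl 𝓛) (incl 𝓛) Z) := by
      intro Z
      induction Z using TensorProduct.induction_on with
      | zero => simp
      | add Z Z' hZ hZ' => simp only [map_add, hZ, hZ']
      | tmul a b => simp [A.ext_apply, incl_csgn, parity_apply]
    rw [h']
    simp [A.ext_apply, parity_apply]
  sq X := by
    rw [A.ext_apply, A.ext_apply, red_incl]
    have := DFunLike.congr_fun A.square_zero (red 𝓛 X)
    rw [LinearMap.comp_apply] at this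
    rw [this, LinearMap.zero_apply, map_zero]
  degree d X hX := A.degree_one d _ (incl_red_mem_symDeg hX)

variable {A : LInfinityAlgebra 𝓛} {B : LInfinityAlgebra 𝓛'}

/-- The extension of an `L∞`-morphism to `S(s⁻¹L)`, by the identity on the constants. -/
def LInfinityMorphism.ext (F : LInfinityMorphism A B) : Sym 𝓛 →ₗ[k] Sym 𝓛' :=
  incl 𝓛' ∘ₗ F.map ∘ₗ red 𝓛 + convOne 𝓛 (Sym 𝓛')

theorem LInfinityMorphism.ext_apply (F : LInfinityMorphism A B) (X : Sym 𝓛) :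
    F.ext X = incl 𝓛' (F.map (red 𝓛 X)) + aug 𝓛 X • 1 := by
  rw [← Algebra.algebraMap_eq_smul_one]
  rfl

theorem LInfinityMorphism.isDGMorphism (F : LInfinityMorphism A B) :
    IsDGMorphism A.ext B.ext F.ext where
  one := by simp [F.ext_apply]
  aug X := by simp [F.ext_apply]
  comul := by
    refine linearMap_ext_incl (by simp [F.ext_apply]) fun X => ?_
    simp only [LinearMap.comp_apply, F.ext_apply, red_incl, symComul_incl, aug_incl, zero_smul,
      add_zero]
    have h := DFunLike.congr_fun F.comul_map X
    simp only [LinearMap.comp_apply] at h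
    rw [h, map_add, map_add]
    have h' : ∀ Z, TensorProduct.map (incl 𝓛') (incl 𝓛') (TensorProduct.map F.map F.map Z) =
        TensorProduct.map F.ext F.ext (TensorProduct.map (incl 𝓛) (incl 𝓛) Z) := by
      intro Z
      induction Z using TensorProduct.induction_on with
      | zero => simp
      | add Z Z' hZ hZ' => simp only [map_add, hZ, hZ']
      | tmul a b => simp [F.ext_apply]
    rw [h']
    simp [F.ext_apply]
  commutes X := by
    have := DFunLike.congr_fun F.Q_map (red 𝓛 X)
    simp only [LinearMap.comp_apply] at this
    simp [F.ext_apply, A.ext_apply, B.ext_apply, this]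
  degree := raisesDegree_of_isHomWord fun m d X hX => by
    rw [add_zero, F.ext_apply]
    refine add_mem (F.degree_zero d _ (incl_red_mem_symDeg hX.mem_symDeg)) ?_
    cases hX with
    | one => simpa using (IsHomWord.one (𝓛 := 𝓛')).mem_symDeg
    | mul => simp

/-- The `L∞`-morphism given by a morphism of differential graded coalgebras which preserves the
units. -/
def IsDGMorphism.toLInfinityMorphism {Φ : Sym 𝓛 →ₗ[k] Sym 𝓛'}
    (h : IsDGMorphism A.ext B.ext Φ) : LInfinityMorphism A B where
  map := red 𝓛' ∘ₗ Φ ∘ₗ incl 𝓛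
  degree_zero d X hX := by
    have := incl_red_mem_symDeg (h.degree d _ hX)
    rwa [add_zero] at this
  comul_map := by
    ext X
    simp only [LinearMap.comp_apply, comul_red]
    -- As `Φ 1 = 1`, the constants contribute nothing after reduction, so the reduced map depends
    -- only on the reduced argument.
    have h1 : red 𝓛' ∘ₗ Φ = (red 𝓛' ∘ₗ Φ ∘ₗ incl 𝓛) ∘ₗ red 𝓛 :=
      linearMap_ext_incl (by simp [h.one]) fun X => by simp
    have h2 := DFunLike.congr_fun h.comul (incl 𝓛 X)
    simp only [LinearMap.comp_apply] at h2
    rw [h2, ← LinearMap.comp_apply, ← TensorProduct.map_comp, h1, TensorProduct.map_comp]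
    rfl
  Q_map := by
    ext X
    have := h.commutes (incl 𝓛 X)
    rw [A.ext_apply, B.ext_apply, red_incl] at this
    simp only [LinearMap.comp_apply, ← this, red_incl]

theorem IsDGMorphism.ext_toLInfinityMorphism {Φ : Sym 𝓛 →ₗ[k] Sym 𝓛'}
    (h : IsDGMorphism A.ext B.ext Φ) : h.toLInfinityMorphism.ext = Φ := by
  refine linearMap_ext_incl (by simp [LInfinityMorphism.ext_apply, h.one]) fun X => ?_
  rw [LInfinityMorphism.ext_apply, red_incl, aug_incl, zero_smul, add_zero]
  exact incl_red_of_aug ((h.aug _).trans (aug_incl X))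

theorem LInfinityMorphism.ext_injective {F G : LInfinityMorphism A B} (h : F.ext = G.ext) :
    F = G := by
  have : F.map = G.map := by
    ext X
    have := congrArg (red 𝓛') (DFunLike.congr_fun h (incl 𝓛 X))
    simpa [LInfinityMorphism.ext_apply] using this
  cases F
  cases G
  subst this
  rfl

theorem LInfinityMorphism.proj_apply (F : LInfinityMorphism A B) (X : C 𝓛) :
    F.proj X = symProj 𝓛' (F.ext (incl 𝓛 X)) := by
  simp [F.ext_apply, LInfinityMorphism.proj, pr_apply]

theorem LInfinityMorphism.proj_red (F : LInfinityMorphism A B) (X : Sym 𝓛) :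
    F.proj (red 𝓛 X) = symProj 𝓛' (F.ext X) := by
  simp [F.ext_apply, LInfinityMorphism.proj, pr_apply]

theorem LInfinityMorphism.structureMap_eq (F : LInfinityMorphism A B) (m : ℕ) (γ : Fin m → L) :
    F.structureMap m γ = symProj 𝓛' (F.ext (word 𝓛 fun j =>
      shiftSign 𝓛 ((m : ℤ) - 1 - (j : ℕ)) (γ j))) :=
  F.proj_red _

theorem LInfinityAlgebra.structureMap_eq (A : LInfinityAlgebra 𝓛) (m : ℕ) (γ : Fin m → L) :
    A.structureMap m γ = symProj 𝓛 (A.ext (word 𝓛 fun j =>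
      shiftSign 𝓛 ((m : ℤ) - 1 - (j : ℕ)) (γ j))) := rfl

theorem shiftSign_zero (x : L) : shiftSign 𝓛 0 x = x := by
  induction x using generator_induction (𝓛 := 𝓛) with
  | add x y hx hy => rw [map_add, hx, hy]
  | hom i v hv => simp [shiftSign_of_mem 𝓛 0 hv]

theorem word_one_shiftSign (x : L) :
    (word 𝓛 fun j : Fin 1 => shiftSign 𝓛 (((1 : ℕ) : ℤ) - 1 - (j : ℕ)) x) = ι 𝓛 x := by
  rw [word_succ, word_zero, mul_one]
  simp [shiftSign_zero]

theorem LInfinityAlgebra.Q₁_eq (A : LInfinityAlgebra 𝓛) (x : L) :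
    A.Q₁ x = symProj 𝓛 (A.ext (ι 𝓛 x)) := by
  rw [LInfinityAlgebra.Q₁, A.structureMap_eq, word_one_shiftSign]

end Extension

/-! ### The convolution brackets as corestrictions -/

section Bracket

variable {k : Type*} [Field k] {L : Type*} [AddCommGroup L] [Module k L]
variable {L' : Type*} [AddCommGroup L'] [Module k L']
variable {𝓛 : ℤ → Submodule k L} [DirectSum.Decomposition 𝓛]
variable {𝓛' : ℤ → Submodule k L'} [DirectSum.Decomposition 𝓛']

omit [DirectSum.Decomposition 𝓛'] in
theorem mul'_map_comul_red (f g : C 𝓛 →ₗ[k] Sym 𝓛') (X : Sym 𝓛) :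
    LinearMap.mul' k _ (TensorProduct.map f g (comul 𝓛 (red 𝓛 X))) =
      conv (f ∘ₗ red 𝓛) (g ∘ₗ red 𝓛) X := by
  rw [comul_red, conv_apply, TensorProduct.map_comp]
  rfl

omit [DirectSum.Decomposition 𝓛'] in
theorem convProd_cons_red (p : ℤ × (C 𝓛 →ₗ[k] L')) {l : List (ℤ × (C 𝓛 →ₗ[k] L'))} (hl : l ≠ [])
    (X : Sym 𝓛) : convProd 𝓛 𝓛' (p :: l) (red 𝓛 X) =
      conv (ι 𝓛' ∘ₗ p.2 ∘ₗ red 𝓛 ∘ₗ (sgn 𝓛 (l.map fun r => r.1 - 1).sum).toLinearMap)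
        (convProd 𝓛 𝓛' l ∘ₗ red 𝓛) X := by
  cases l with
  | nil => exact absurd rfl hl
  | cons q l =>
    rw [convProd, LinearMap.comp_apply, LinearMap.comp_apply, mul'_map_comul_red]
    congr 2
    ext Y
    simp [csgn_red]

omit [DirectSum.Decomposition 𝓛'] in
-- An element of degree one in `U` is even after the shift, so no Koszul signs appear.
theorem convProd_replicate_red (π : C 𝓛 →ₗ[k] L') (m : ℕ) :
    convProd 𝓛 𝓛' (List.replicate (m + 1) (1, π)) ∘ₗ red 𝓛 =
      convPow (ι 𝓛' ∘ₗ π ∘ₗ red 𝓛) (m + 1) := by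
  induction m with
  | zero => rw [convPow, convPow, conv_convOne]; rfl
  | succ m ih =>
    ext X
    rw [LinearMap.comp_apply, List.replicate_succ, convProd_cons_red _ (by simp), ih, convPow]
    congr 2
    ext Y
    simp [sgn_of_even]

omit [DirectSum.Decomposition 𝓛'] in
-- The tail after each `π` has shifted degree `-1`, owing to the single `ξ` at the end, so each `π`
-- acquires exactly one parity.
theorem convProd_replicate_append_red (π ξ : C 𝓛 →ₗ[k] L') (m : ℕ) :
    convProd 𝓛 𝓛' (List.replicate m (1, π) ++ [(0, ξ)]) ∘ₗ red 𝓛 =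
      conv (convPow (ι 𝓛' ∘ₗ π ∘ₗ red 𝓛 ∘ₗ parity 𝓛) m) (ι 𝓛' ∘ₗ ξ ∘ₗ red 𝓛) := by
  induction m with
  | zero => rw [convPow, convOne_conv]; rfl
  | succ m ih =>
    ext X
    rw [LinearMap.comp_apply, List.replicate_succ, List.cons_append,
      convProd_cons_red _ (by simp), ih, convPow, conv_assoc]
    congr 2
    ext Y
    simp [sgn_of_odd, parity_apply]

theorem decalage_replicate_append {W : Type*} (a b : W) (m : ℕ) :
    decalage (List.replicate m (1, a) ++ [((0 : ℤ), b)]) = 0 := by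
  induction m with
  | zero => simp [decalage]
  | succ m ih => simp [List.replicate_succ, decalage, ih]

theorem decalage_replicate {W : Type*} (a : W) (m : ℕ) :
    decalage (List.replicate m ((1 : ℤ), a)) = 0 := by
  induction m with
  | zero => simp [decalage]
  | succ m ih => simp [List.replicate_succ, decalage, ih]

variable (A : LInfinityAlgebra 𝓛) (B : LInfinityAlgebra 𝓛')

theorem bracket_singleton (κ : ℤ) (f : C 𝓛 →ₗ[k] L') :
    bracket A B [(κ, f)] = (-1 : k) ^ decalage [(κ, f)] •
      (pr 𝓛' ∘ₗ B.Q ∘ₗ red 𝓛' ∘ₗ convProd 𝓛 𝓛' [(κ, f)]) - (-1 : k) ^ (κ - 1) • (f ∘ₗ A.Q) := rfl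

theorem bracket_cons_cons (p q : ℤ × (C 𝓛 →ₗ[k] L')) (l : List (ℤ × (C 𝓛 →ₗ[k] L'))) :
    bracket A B (p :: q :: l) = (-1 : k) ^ decalage (p :: q :: l) •
      (pr 𝓛' ∘ₗ B.Q ∘ₗ red 𝓛' ∘ₗ convProd 𝓛 𝓛' (p :: q :: l)) := sub_zero _

theorem bracket_replicate (π : C 𝓛 →ₗ[k] L') (m : ℕ) (X : C 𝓛) :
    bracket A B (List.replicate (m + 1) (1, π)) X =
      symProj 𝓛' (B.ext (convPow (ι 𝓛' ∘ₗ π ∘ₗ red 𝓛) (m + 1) (incl 𝓛 X))) -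
        if m = 0 then π (A.Q X) else 0 := by
  rw [← convProd_replicate_red, LinearMap.comp_apply, red_incl]
  have hd := decalage_replicate π (m + 1)
  cases m with
  | zero =>
    rw [List.replicate_one] at hd ⊢
    rw [bracket_singleton, hd]
    simp [B.ext_apply, pr_apply]
  | succ m =>
    rw [List.replicate_succ, List.replicate_succ] at hd ⊢
    rw [bracket_cons_cons, hd]
    simp [B.ext_apply, pr_apply]

theorem bracket_replicate_append (π ξ : C 𝓛 →ₗ[k] L') (m : ℕ) (X : C 𝓛) :
    bracket A B (List.replicate m (1, π) ++ [(0, ξ)]) X =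
      symProj 𝓛' (B.ext (conv (convPow (ι 𝓛' ∘ₗ π ∘ₗ red 𝓛 ∘ₗ parity 𝓛) m)
        (ι 𝓛' ∘ₗ ξ ∘ₗ red 𝓛) (incl 𝓛 X))) + if m = 0 then ξ (A.Q X) else 0 := by
  rw [← convProd_replicate_append_red, LinearMap.comp_apply, red_incl]
  have hd := decalage_replicate_append π ξ m
  rcases m with _ | _ | m
  · rw [List.replicate_zero, List.nil_append] at hd ⊢
    rw [bracket_singleton, hd]
    simp [B.ext_apply, pr_apply]
  · rw [zero_add, List.replicate_one, List.cons_append, List.nil_append] at hd ⊢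
    rw [bracket_cons_cons, hd]
    simp [B.ext_apply, pr_apply]
  · rw [List.replicate_succ, List.replicate_succ, List.cons_append, List.cons_append] at hd ⊢
    rw [bracket_cons_cons, hd]
    simp [B.ext_apply, pr_apply]

variable {A B}

theorem ι_proj_red (F : LInfinityMorphism A B) :
    ι 𝓛' ∘ₗ F.proj ∘ₗ red 𝓛 = genProj 𝓛' ∘ₗ F.ext :=
  LinearMap.ext fun X => congrArg (ι 𝓛') (F.proj_red X)

/-- The Maurer-Cartan equation is the corestriction of `Q' F = F Q`, with `F` expanded as the
exponential of its projection. -/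
theorem LInfinityMorphism.isMaurerCartan [CharZero k] (F : LInfinityMorphism A B) :
    IsMaurerCartan A B F.proj := by
  refine ⟨fun d X hX => ?_, fun X => ?_⟩
  · rw [F.proj_apply]
    have := symProj_mem (F.isDGMorphism.degree d _ hX)
    rwa [add_zero] at this
  -- The shift drops the zeroth convolution power, which vanishes on `C(L)`; the term with `A.Q`
  -- belongs to the unary bracket alone.
  · have h := ((F.isDGMorphism.sumsTo (incl 𝓛 X)).succ.map (symProj 𝓛' ∘ₗ B.ext)).add
      (sumsTo_single (-F.proj (A.Q X)))
    convert h.congr fun m => ?_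
    · rw [LinearMap.comp_apply, map_sub, map_sub, F.isDGMorphism.commutes, F.proj_apply,
        A.ext_apply, red_incl]
      simp [convPow, convOne_apply]
    · rw [bracket_replicate, ι_proj_red]
      cases m <;> simp [sub_eq_add_neg]

/-- The corestriction of `Q' h(F)` yields the brackets of `L'`, and that of `h(F) Q` is `ξ Q`, which
belongs to the unary bracket. -/
theorem LInfinityMorphism.isTwistedDifferential [CharZero k] (F : LInfinityMorphism A B)
    (ξ : C 𝓛 →ₗ[k] L') :
    IsTwistedDifferential A B F.proj ξ
      (symProj 𝓛' ∘ₗ gaugeOp A.ext B.ext (ξ ∘ₗ red 𝓛) F.ext ∘ₗ incl 𝓛) := by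
  intro X
  have h := ((sumsTo_coderAlong (ξ := ξ ∘ₗ red 𝓛) F.isDGMorphism (incl 𝓛 X)).map
    (symProj 𝓛' ∘ₗ B.ext)).add (sumsTo_single (ξ (A.Q X)))
  convert h.congr fun m => ?_
  · simp only [LinearMap.comp_apply]
    rw [symProj_gaugeOp F.isDGMorphism.aug]
    simp [A.ext_apply]
  · have := congrArg (fun f => f ∘ₗ parity 𝓛) (ι_proj_red F)
    simp only [LinearMap.comp_assoc] at this
    rw [bracket_replicate_append, this]
    cases m <;> simp

end Bracket

/-! ### Multilinear maps on the exterior power as linear maps on `S(s⁻¹L)` -/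

section MultilinearToSym

variable {k : Type*} [Field k] {L : Type*} [AddCommGroup L] [Module k L]
variable {L' : Type*} [AddCommGroup L'] [Module k L']
variable {𝓛 : ℤ → Submodule k L}

/-- A linear map on the tensor algebra which does not see the defining relations descends to
`S(s⁻¹L)`. -/
theorem exists_desc {W : Type*} [AddCommGroup W] [Module k W] (f : TensorAlgebra k L →ₗ[k] W)
    (hf : ∀ a b, Rel 𝓛 a b → ∀ c d, f (c * a * d) = f (c * b * d)) :
    ∃ g : Sym 𝓛 →ₗ[k] W, ∀ a, g (mk 𝓛 a) = f a := by
  -- Quantifying over both outer factors makes indistinguishability under `f` a ring congruence; it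
  -- contains the relations, hence `symCon`.
  let r : RingCon (TensorAlgebra k L) :=
    { r := fun a b => ∀ c d, f (c * a * d) = f (c * b * d)
      iseqv := ⟨fun _ _ _ => rfl, fun h c d => (h c d).symm, fun h h' c d => (h c d).trans (h' c d)⟩
      mul' := fun {a b a' b'} h h' c d => by
        have h1 := h c (a' * d)
        have h2 := h' (c * b) d
        simp only [mul_assoc] at h1 h2 ⊢
        exact h1.trans h2
      add' := fun {a b a' b'} h h' c d => by
        simp only [mul_add, add_mul, map_add, h c d, h' c d] }
  have hr : symCon 𝓛 ≤ r := RingCon.ringConGen_le.2 fun a b h => hf a b h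
  have key : ∀ a b, mk 𝓛 a = mk 𝓛 b → f a = f b := by
    intro a b h
    have h' : r a b := hr (Quotient.exact h)
    simpa using h' 1 1
  have hker : LinearMap.ker (mk 𝓛).toLinearMap ≤ LinearMap.ker f := by
    intro a ha
    rw [LinearMap.mem_ker] at ha ⊢
    rw [key a 0 (by simpa using ha), map_zero]
  have hsurj : Function.Surjective (mk 𝓛).toLinearMap := mk_surjective
  refine ⟨(LinearMap.ker (mk 𝓛).toLinearMap).liftQ f hker ∘ₗ
    ((mk 𝓛).toLinearMap.quotKerEquivOfSurjective hsurj).symm.toLinearMap, fun a => ?_⟩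
  have h : ((mk 𝓛).toLinearMap.quotKerEquivOfSurjective hsurj).symm (mk 𝓛 a) =
      Submodule.Quotient.mk a := by
    rw [LinearEquiv.symm_apply_eq]
    rfl
  rw [LinearMap.comp_apply, LinearEquiv.coe_coe, h, Submodule.liftQ_apply]

theorem mk_tprod {m : ℕ} (γ : Fin m → L) : mk 𝓛 (TensorAlgebra.tprod k L m γ) = word 𝓛 γ := by
  rw [TensorAlgebra.tprod_apply, map_list_prod, List.map_ofFn]
  rfl

/-- The linear map on the tensor algebra which is a given multilinear map on words of length `n`
and zero on the others. -/
def tensorMap {n : ℕ} (H : MultilinearMap k (fun _ : Fin n => L) L') :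
    TensorAlgebra k L →ₗ[k] L' :=
  PiTensorProduct.lift H ∘ₗ DirectSum.component k ℕ _ n ∘ₗ
    (TensorAlgebra.toDirectSum (R := k) (M := L)).toLinearMap

theorem tensorMap_tprod {n : ℕ} (H : MultilinearMap k (fun _ : Fin n => L) L') (γ : Fin n → L) :
    tensorMap H (TensorAlgebra.tprod k L n γ) = H γ := by
  rw [tensorMap, LinearMap.comp_apply, LinearMap.comp_apply, AlgHom.toLinearMap_apply,
    TensorAlgebra.toDirectSum_tensorPower_tprod, ← DirectSum.lof_eq_of k,
    DirectSum.component.of, dif_pos rfl]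
  exact PiTensorProduct.lift.tprod γ

theorem tensorMap_tprod_of_ne {n m : ℕ} (h : m ≠ n)
    (H : MultilinearMap k (fun _ : Fin n => L) L') (γ : Fin m → L) :
    tensorMap H (TensorAlgebra.tprod k L m γ) = 0 := by
  rw [tensorMap, LinearMap.comp_apply, LinearMap.comp_apply, AlgHom.toLinearMap_apply,
    TensorAlgebra.toDirectSum_tensorPower_tprod, ← DirectSum.lof_eq_of k,
    DirectSum.component.of, dif_neg h, map_zero]

theorem tensorMap_list {n : ℕ} (H : MultilinearMap k (fun _ : Fin n => L) L') (l : List L) :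
    tensorMap H (l.map (TensorAlgebra.ι k)).prod =
      if l.length = n then H (fun i => l.getD i 0) else 0 := by
  have h : (l.map (TensorAlgebra.ι k)).prod = TensorAlgebra.tprod k L l.length l.get := by
    rw [TensorAlgebra.tprod_apply]
    congr 1
    conv_lhs => rw [← List.ofFn_get l, List.map_ofFn]
    rfl
  rw [h]
  split_ifs with hl
  · subst hl
    rw [tensorMap_tprod]
    congr 1
    ext i
    simp
  · exact tensorMap_tprod_of_ne hl H _

variable [DirectSum.Decomposition 𝓛]

variable (𝓛) in
theorem tensorAlgebra_ext {W : Type*} [AddCommGroup W] [Module k W]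
    {f g : TensorAlgebra k L →ₗ[k] W}
    (h : ∀ l : List (Σ i, 𝓛 i), f (l.map fun p => TensorAlgebra.ι k (p.2 : L)).prod =
      g (l.map fun p => TensorAlgebra.ι k (p.2 : L)).prod) : f = g := by
  -- The maps `f` and `g` vary in the induction so that the product case can precompose them with a
  -- left multiplication.
  have key : ∀ (a : TensorAlgebra k L) (l : List (Σ i, 𝓛 i)) (f g : TensorAlgebra k L →ₗ[k] W),
      (∀ l : List (Σ i, 𝓛 i), f (l.map fun p => TensorAlgebra.ι k (p.2 : L)).prod =
        g (l.map fun p => TensorAlgebra.ι k (p.2 : L)).prod) →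
      f (a * (l.map fun p => TensorAlgebra.ι k (p.2 : L)).prod) =
        g (a * (l.map fun p => TensorAlgebra.ι k (p.2 : L)).prod) := by
    intro a
    induction a using TensorAlgebra.induction with
    | algebraMap c =>
      intro l f g h
      rw [← Algebra.smul_def, map_smul, map_smul, h]
    | ι x =>
      intro l f g h
      induction x using generator_induction (𝓛 := 𝓛) with
      | add x y hx hy => simp only [map_add, add_mul, hx, hy]
      | hom i v hv => simpa using h (⟨i, v, hv⟩ :: l)
    | mul a b ha hb =>
      intro l f g h
      rw [mul_assoc]
      exact hb l (f ∘ₗ LinearMap.mulLeft k a) (g ∘ₗ LinearMap.mulLeft k a)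
        fun l => ha l f g h
    | add a b ha hb =>
      intro l f g h
      simp only [add_mul, map_add, ha l f g h, hb l f g h]
  ext a
  simpa using key a [] f g h

theorem getD_swap {α : Type*} (l₁ l₂ : List α) (x y d : α)
    (q : Fin (l₁.length + l₂.length + 2)) :
    (l₁ ++ x :: y :: l₂).getD (Equiv.swap (⟨l₁.length, by omega⟩ : Fin _)
      ⟨l₁.length + 1, by omega⟩ q : Fin (l₁.length + l₂.length + 2)) d =
        (l₁ ++ y :: x :: l₂).getD q d := by
  rw [Equiv.swap_apply_def]
  simp only [Fin.ext_iff, List.getD_eq_getElem?_getD]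
  split_ifs with h1 h2
  · simp [h1]
  · simp [h2]
  · rcases lt_or_gt_of_ne h1 with h | h
    · rw [List.getElem?_append_left h, List.getElem?_append_left h]
    · obtain ⟨m, hm⟩ : ∃ m, (q : ℕ) = l₁.length + (m + 2) := ⟨q - l₁.length - 2, by omega⟩
      rw [hm, List.getElem?_append_right (by omega), List.getElem?_append_right (by omega)]
      simp

variable (𝓛) in
/-- `f(…, x, y, …) = (-1)^(|x||y|) f(…, y, x, …)` for the degrees of `s⁻¹L`. -/
def IsShiftedSymmetric {n : ℕ} (f : MultilinearMap k (fun _ : Fin n => L) L') : Prop :=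
  ∀ (γ : Fin n → L) (κ : Fin n → ℤ), (∀ i, γ i ∈ 𝓛 (κ i)) →
    ∀ i j : Fin n, (i : ℕ) + 1 = j →
      f γ = (-1 : k) ^ ((κ i - 1) * (κ j - 1)) • f (γ ∘ Equiv.swap i j)

theorem IsShiftedSymmetric.exists_linearMap {n : ℕ} {H : MultilinearMap k (fun _ : Fin n => L) L'}
    (hH : IsShiftedSymmetric 𝓛 H) :
    ∃ f : Sym 𝓛 →ₗ[k] L', (∀ γ : Fin n → L, f (word 𝓛 γ) = H γ) ∧
      ∀ m ≠ n, ∀ γ : Fin m → L, f (word 𝓛 γ) = 0 := by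
  obtain ⟨f, hf⟩ := exists_desc (𝓛 := 𝓛) (tensorMap H) (by
    rintro _ _ ⟨i, j, x, y, hx, hy⟩ c d
    let ι' := TensorAlgebra.ι k (M := L)
    let M : TensorAlgebra k L → TensorAlgebra k L →
        TensorAlgebra k L →ₗ[k] L' := fun c a => tensorMap H ∘ₗ LinearMap.mulLeft k (c * a)
    let N : TensorAlgebra k L → TensorAlgebra k L →
        TensorAlgebra k L →ₗ[k] L' := fun a d => tensorMap H ∘ₗ LinearMap.mulRight k (a * d)
    -- For words `c` and `d` of homogeneous letters, both sides compare `H` on two words differing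
    -- by an adjacent transposition, or are zero when the length is not `n`.
    have key : ∀ l₁ l₂ : List (Σ i, 𝓛 i),
        tensorMap H ((l₁.map fun p => ι' (p.2 : L)).prod * (ι' x * ι' y) *
          (l₂.map fun p => ι' (p.2 : L)).prod) =
        tensorMap H ((l₁.map fun p => ι' (p.2 : L)).prod *
          ((-1 : k) ^ ((i - 1) * (j - 1)) • (ι' y * ι' x)) *
          (l₂.map fun p => ι' (p.2 : L)).prod) := by
      intro l₁ l₂
      let X : Σ i, 𝓛 i := ⟨i, x, hx⟩
      let Y : Σ i, 𝓛 i := ⟨j, y, hy⟩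
      have h1 : ∀ X Y : Σ i, 𝓛 i, (l₁.map fun p => ι' (p.2 : L)).prod * (ι' X.2 * ι' Y.2) *
          (l₂.map fun p => ι' (p.2 : L)).prod =
          (((l₁ ++ X :: Y :: l₂).map fun p => (p.2 : L)).map ι').prod := by
        intro X Y
        simp [mul_assoc, Function.comp_def]
      have h2 := h1 X Y
      have h3 := h1 Y X
      simp only [X, Y] at h2 h3
      rw [mul_smul_comm, smul_mul_assoc, map_smul, h2, h3, tensorMap_list, tensorMap_list]
      have hlen : ∀ X Y : Σ i, 𝓛 i, ((l₁ ++ X :: Y :: l₂).map fun p => (p.2 : L)).length =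
          l₁.length + l₂.length + 2 := by
        intro X Y
        simp only [List.length_map, List.length_append, List.length_cons]
        omega
      rw [hlen, hlen]
      split_ifs with hn
      · subst hn
        -- The default `⟨0, 0⟩` has letter `0`, matching the default letter in `tensorMap_list`.
        have hget : ∀ (l : List (Σ i, 𝓛 i)) (p : ℕ), (l.map fun p => (p.2 : L)).getD p 0 =
            ((l.getD p ⟨0, 0⟩).2 : L) := by
          intro l p
          exact List.getD_map _ (⟨0, 0⟩ : Σ i, 𝓛 i) (fun p : Σ i, 𝓛 i => (p.2 : L))
        simp only [hget]
        have hs := hH (fun p => ((l₁ ++ X :: Y :: l₂).getD p ⟨0, 0⟩).2)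
          (fun p => ((l₁ ++ X :: Y :: l₂).getD p ⟨0, 0⟩).1) (fun p => Subtype.property _)
          ⟨l₁.length, by omega⟩ ⟨l₁.length + 1, by omega⟩ rfl
        have e1 : (l₁ ++ X :: Y :: l₂).getD l₁.length ⟨0, 0⟩ = X := by simp
        have e2 : (l₁ ++ X :: Y :: l₂).getD (l₁.length + 1) ⟨0, 0⟩ = Y := by simp
        simp only [e1, e2] at hs
        rw [hs]
        congr 2
        ext p
        exact congrArg (fun Z : Σ i, 𝓛 i => (Z.2 : L)) (getD_swap l₁ l₂ X Y _ p)
      · simp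
    -- The outer factors are freed from being words one at a time, first the left one and then the
    -- right one.
    have h1 : ∀ l₂ : List (Σ i, 𝓛 i), N (ι' x * ι' y) (l₂.map fun p => ι' (p.2 : L)).prod =
        N ((-1 : k) ^ ((i - 1) * (j - 1)) • (ι' y * ι' x))
          (l₂.map fun p => ι' (p.2 : L)).prod := by
      intro l₂
      refine tensorAlgebra_ext 𝓛 fun l₁ => ?_
      simpa only [N, LinearMap.comp_apply, LinearMap.mulRight_apply, mul_assoc] using key l₁ l₂
    have h2 : M c (ι' x * ι' y) = M c ((-1 : k) ^ ((i - 1) * (j - 1)) • (ι' y * ι' x)) := by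
      refine tensorAlgebra_ext 𝓛 fun l₂ => ?_
      simpa only [M, N, LinearMap.comp_apply, LinearMap.mulRight_apply, LinearMap.mulLeft_apply,
        mul_assoc] using DFunLike.congr_fun (h1 l₂) c
    exact DFunLike.congr_fun h2 d)
  refine ⟨f, fun γ => ?_, fun m hm γ => ?_⟩
  · rw [← mk_tprod, hf, tensorMap_tprod]
  · rw [← mk_tprod, hf, tensorMap_tprod_of_ne hm]

theorem neg_one_zpow_congr {a b : ℤ} (h : Even (a - b)) : (-1 : k) ^ a = (-1 : k) ^ b := by
  rw [← sub_add_cancel a b, zpow_add₀ (neg_ne_zero.2 one_ne_zero), h.neg_one_zpow, one_mul]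

theorem shiftSign_shiftSign (e : ℤ) (x : L) : shiftSign 𝓛 e (shiftSign 𝓛 e x) = x := by
  induction x using generator_induction (𝓛 := 𝓛) with
  | add x y hx hy => rw [map_add, map_add, hx, hy]
  | hom i v hv =>
    rw [shiftSign_of_mem 𝓛 e hv, map_smul, shiftSign_of_mem 𝓛 e hv, smul_smul,
      ← zpow_add₀ (neg_ne_zero.2 one_ne_zero), Even.neg_one_zpow ⟨_, rfl⟩, one_smul]

theorem shiftSign_mem (e : ℤ) {i : ℤ} {x : L} (hx : x ∈ 𝓛 i) : shiftSign 𝓛 e x ∈ 𝓛 i := by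
  rw [shiftSign_of_mem 𝓛 e hx]
  exact Submodule.smul_mem _ _ hx

/-- The décalage: an adjacent swap changes the exponent of the twist by `(κ i - 1) - (κ j - 1)`, and
`κ i κ j + 1 + κ i - κ j` is congruent to `(κ i - 1)(κ j - 1)` modulo 2. -/
theorem IsAntisymmetric.isShiftedSymmetric {n : ℕ} {H : MultilinearMap k (fun _ : Fin n => L) L'}
    (hH : IsAntisymmetric 𝓛 H) : IsShiftedSymmetric 𝓛
      (H.compLinearMap fun j : Fin n => shiftSign 𝓛 ((n : ℤ) - 1 - (j : ℕ))) := by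
  intro γ κ hγ i j hij
  have hval : ∀ (γ : Fin n → L) (κ : Fin n → ℤ), (∀ i, γ i ∈ 𝓛 (κ i)) →
      H.compLinearMap (fun j : Fin n => shiftSign 𝓛 ((n : ℤ) - 1 - (j : ℕ))) γ =
        (-1 : k) ^ (∑ l : Fin n, ((n : ℤ) - 1 - (l : ℕ)) * (κ l - 1)) • H γ := by
    intro γ κ hγ
    have h1 : (-1 : k) ^ (∑ l : Fin n, ((n : ℤ) - 1 - (l : ℕ)) * (κ l - 1)) =
        ∏ l : Fin n, (-1 : k) ^ (((n : ℤ) - 1 - (l : ℕ)) * (κ l - 1)) := by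
      induction (Finset.univ : Finset (Fin n)) using Finset.induction_on with
      | empty => simp
      | insert a s ha ih =>
        rw [Finset.sum_insert ha, Finset.prod_insert ha, zpow_add₀ (neg_ne_zero.2 one_ne_zero), ih]
    rw [MultilinearMap.compLinearMap_apply, h1, ← MultilinearMap.map_smul_univ]
    congr 1
    ext l
    exact shiftSign_of_mem 𝓛 _ (hγ l)
  have hne : i ≠ j := by
    rintro rfl
    omega
  rw [hval γ κ hγ, hval (γ ∘ Equiv.swap i j) (κ ∘ Equiv.swap i j) (fun l => hγ _),
    hH γ κ hγ i j hij, ← neg_smul, smul_smul, smul_smul,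
    ← zpow_add₀ (neg_ne_zero.2 one_ne_zero)]
  congr 1
  rw [show -(-1 : k) ^ (κ i * κ j) = (-1) ^ (κ i * κ j + 1) by
    rw [zpow_add_one₀ (neg_ne_zero.2 one_ne_zero), mul_neg_one],
    ← zpow_add₀ (neg_ne_zero.2 one_ne_zero)]
  apply neg_one_zpow_congr
  have h2 : ∑ l : Fin n, ((n : ℤ) - 1 - (l : ℕ)) * ((κ ∘ Equiv.swap i j) l - 1) =
      ∑ l : Fin n, ((n : ℤ) - 1 - (Equiv.swap i j l : ℕ)) * (κ l - 1) := by
    rw [← Equiv.sum_comp (Equiv.swap i j)]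
    simp
  have h3 : ∑ l : Fin n, ((n : ℤ) - 1 - (l : ℕ)) * (κ l - 1) -
      ∑ l : Fin n, ((n : ℤ) - 1 - (Equiv.swap i j l : ℕ)) * (κ l - 1) =
      (κ i - 1) - (κ j - 1) := by
    rw [← Finset.sum_sub_distrib, Fintype.sum_eq_add i j hne]
    · rw [Equiv.swap_apply_left, Equiv.swap_apply_right, ← hij]
      push_cast
      ring
    · rintro l ⟨hi, hj⟩
      rw [Equiv.swap_apply_of_ne_of_ne hi hj, sub_self]
  rw [h2, show ∀ a b c d : ℤ, a + (b + 1) - (c + d) = (a - d) + (b + 1 - c) by intros; ring, h3]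
  exact ⟨κ i, by ring⟩

end MultilinearToSym

/-! ### The derivation extending `Q₁` on words -/

section LinearPart

variable {k : Type*} [Field k] [CharZero k] {L : Type*} [AddCommGroup L] [Module k L]
variable {𝓛 : ℤ → Submodule k L} [DirectSum.Decomposition 𝓛]

theorem factorial_inv_smul_linearPart_ι_mul {q : L →ₗ[k] L}
    (hq : ∀ i, ∀ v ∈ 𝓛 i, q v ∈ 𝓛 (i + 1)) (m : ℕ) {i : ℤ} {v : L} (hv : v ∈ 𝓛 i) (X : Sym 𝓛) :
    ((m + 1).factorial : k)⁻¹ • linearPart q (m + 1) (ι 𝓛 v * X) =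
      ι 𝓛 (q v) * wordProj 𝓛 m X +
        (-1 : k) ^ (i - 1) • (ι 𝓛 v * ((m.factorial : k)⁻¹ • linearPart q m X)) := by
  have h : (m + 1 : k) ≠ 0 := by exact_mod_cast m.succ_ne_zero
  have h' : ((m + 1).factorial : k)⁻¹ * (m + 1) = (m.factorial : k)⁻¹ := by
    rw [Nat.factorial_succ]
    push_cast
    rw [mul_inv, mul_right_comm, inv_mul_cancel₀ h, one_mul]
  rw [linearPart_ι_mul hq m hv, smul_smul, h', sgn_ι 𝓛 1 hv, one_mul, wordProj,
    LinearMap.smul_apply, smul_add, smul_mul_assoc, mul_smul_comm, mul_smul_comm]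
  congr 1
  rw [smul_comm]

theorem linearPart_word {q : L →ₗ[k] L} (hq : ∀ i, ∀ v ∈ 𝓛 i, q v ∈ 𝓛 (i + 1)) {m : ℕ}
    {γ : Fin m → L} {κ : Fin m → ℤ} (hγ : ∀ j, γ j ∈ 𝓛 (κ j)) :
    (m.factorial : k)⁻¹ • linearPart q m (word 𝓛 γ) = ∑ i : Fin m,
      (-1 : k) ^ (∑ j : Fin m, if j < i then κ j - 1 else 0) •
        word 𝓛 (Function.update γ i (q (γ i))) := by
  induction m with
  | zero => simp [linearPart]
  | succ m ih =>
    rw [word_succ, factorial_inv_smul_linearPart_ι_mul hq m (hγ 0),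
      wordProj_isHomWord (isHomWord_word fun j => hγ j.succ), if_pos rfl,
      ih fun j => hγ j.succ, Fin.sum_univ_succ]
    congr 1
    · rw [word_succ]
      simp
    · rw [Finset.mul_sum, Finset.smul_sum]
      refine Finset.sum_congr rfl fun i _ => ?_
      rw [mul_smul_comm, smul_smul, ← zpow_add₀ (neg_ne_zero.2 one_ne_zero), Fin.sum_univ_succ,
        word_succ]
      have h : (fun j : Fin m => Function.update γ i.succ (q (γ i.succ)) j.succ) =
          Function.update (fun j : Fin m => γ j.succ) i (q (γ i.succ)) := by
        ext j
        simp only [Function.update_apply, Fin.succ_inj]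
      simp [h, Function.update_of_ne (Fin.succ_ne_zero i).symm]

theorem map_comp_wordProj {W : Type*} [AddCommGroup W] [Module k W] {n : ℕ} {f : Sym 𝓛 →ₗ[k] W}
    (hf : ∀ m ≠ n, ∀ γ : Fin m → L, f (word 𝓛 γ) = 0) (X : Sym 𝓛) :
    f (wordProj 𝓛 n X) = f X := by
  suffices h : f ∘ₗ wordProj 𝓛 n = f from DFunLike.congr_fun h X
  refine isHomWord_ext fun m d X hX => ?_
  rw [LinearMap.comp_apply, wordProj_isHomWord hX]
  split_ifs with h
  · rfl
  · obtain ⟨γ, -, -, -, rfl⟩ := hX.exists_word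
    rw [map_zero, hf m (Ne.symm h)]

end LinearPart

/-! ### First-order effect of the flow, quasi-isomorphisms and the gauge path -/

section Main

variable {k : Type*} [Field k] {L : Type*} [AddCommGroup L] [Module k L]
variable {L' : Type*} [AddCommGroup L'] [Module k L']
variable {𝓛 : ℤ → Submodule k L} [DirectSum.Decomposition 𝓛]
variable {𝓛' : ℤ → Submodule k L'} [DirectSum.Decomposition 𝓛']
variable {A : LInfinityAlgebra 𝓛} {B : LInfinityAlgebra 𝓛'}

/-- The differential as a linear map. -/
def LInfinityAlgebra.linQ₁ (A : LInfinityAlgebra 𝓛) : L →ₗ[k] L :=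
  symProj 𝓛 ∘ₗ A.ext ∘ₗ ι 𝓛

theorem LInfinityAlgebra.linQ₁_apply (A : LInfinityAlgebra 𝓛) (x : L) : A.linQ₁ x = A.Q₁ x :=
  (A.Q₁_eq x).symm

theorem LInfinityAlgebra.linQ₁_mem (A : LInfinityAlgebra 𝓛) (i : ℤ) (v : L) (hv : v ∈ 𝓛 i) :
    A.linQ₁ v ∈ 𝓛 (i + 1) := by
  have := symProj_mem (A.isCodifferential.degree _ _ (ι_mem_symDeg hv))
  rwa [sub_add_cancel] at this

/-- Since `f` sees only length `n`, it detects only the length-preserving part of the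
codifferential, which is the derivation extending `Q₁`. -/
theorem LInfinityAlgebra.map_ext_word [CharZero k] (A : LInfinityAlgebra 𝓛) {W : Type*}
    [AddCommGroup W] [Module k W] {n : ℕ} {f : Sym 𝓛 →ₗ[k] W}
    (hf : ∀ m ≠ n, ∀ γ : Fin m → L, f (word 𝓛 γ) = 0) {γ : Fin n → L} {κ : Fin n → ℤ}
    (hγ : ∀ j, γ j ∈ 𝓛 (κ j)) :
    f (A.ext (word 𝓛 γ)) = ∑ i : Fin n, (-1 : k) ^ (∑ j : Fin n, if j < i then κ j - 1 else 0) •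
      f (word 𝓛 (Function.update γ i (A.linQ₁ (γ i)))) := by
  have hq : VanishesBelow 2 (genProj 𝓛 ∘ₗ A.ext - ι 𝓛 ∘ₗ A.linQ₁ ∘ₗ symProj 𝓛) := by
    intro m hm d X hX
    cases hX with
    | one => simp [A.isCodifferential.one]
    | mul hv hX =>
      cases hX with
      | one => simp [LInfinityAlgebra.linQ₁, genProj_apply]
      | mul => omega
  have h := (vanishesBelow_sub_linearPart A.isCodifferential.comul A.isCodifferential.one hq n).map_word
    (Nat.lt_succ_self n) γ
  rw [LinearMap.sub_apply, LinearMap.comp_apply, sub_eq_zero] at h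
  rw [← map_comp_wordProj hf, wordProj, LinearMap.smul_apply, h, linearPart_word A.linQ₁_mem hγ,
    map_sum]
  simp only [map_smul]

omit [DirectSum.Decomposition 𝓛'] in
-- Up to the constants `Φ` is the convolution unit; the difference kills `1`, so its convolution
-- with `ξ` needs at least `n + 1` letters.
theorem coderAlong_word {ξ : Sym 𝓛 →ₗ[k] L'} {n : ℕ} (hξ : VanishesBelow n ξ)
    {Φ : Sym 𝓛 →ₗ[k] Sym 𝓛'} (hΦ : Φ 1 = 1) (γ : Fin n → L) :
    coderAlong ξ Φ (word 𝓛 γ) = ι 𝓛' (ξ (word 𝓛 γ)) := by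
  have h1 : coderAlong ξ Φ - ι 𝓛' ∘ₗ ξ = coderAlong ξ (Φ - convOne 𝓛 _) := by
    have : convOne 𝓛 (Sym 𝓛') ∘ₗ parity 𝓛 = convOne 𝓛 _ :=
      LinearMap.ext fun X => by simp [convOne_apply, parity_apply]
    rw [map_sub, coderAlong_apply ξ (convOne _ _), this, convOne_conv]
  have h2 : VanishesBelow (1 + n) (coderAlong ξ (Φ - convOne 𝓛 (Sym 𝓛'))) :=
    (vanishesBelow_one (by simp [hΦ, convOne_apply])).comp_parity.conv (hξ.comp (ι 𝓛'))
  have h3 := h2.map_word (by omega) γ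
  rwa [← h1, LinearMap.sub_apply, sub_eq_zero] at h3

/-- On cocycles the two linear components differ by the coboundary of `h x`, so primitives are
corrected by `h x`. -/
theorem LInfinityMorphism.IsQuasiIso.of_homotopy {F G : LInfinityMorphism A B} (hF : F.IsQuasiIso)
    (h : L →ₗ[k] L') (hdeg : ∀ i, ∀ x ∈ 𝓛 i, h x ∈ 𝓛' (i - 1))
    (hFG : ∀ i, ∀ x ∈ 𝓛 i, (G.structureMap 1 fun _ => x) =
      (F.structureMap 1 fun _ => x) + B.Q₁ (h x) + h (A.Q₁ x)) : G.IsQuasiIso := by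
  intro i
  constructor
  · rintro x hx hAx ⟨y, hy, hyx⟩
    refine (hF i).1 x hx hAx ⟨y - h x, sub_mem hy (hdeg i x hx), ?_⟩
    rw [hFG i x hx, hAx, map_zero, add_zero] at hyx
    rw [← B.linQ₁_apply, map_sub, B.linQ₁_apply, B.linQ₁_apply, hyx, add_sub_cancel_right]
  · intro x' hx' hBx'
    obtain ⟨x, hx, hAx, y, hy, rfl⟩ := (hF i).2 x' hx' hBx'
    refine ⟨x, hx, hAx, y - h x, sub_mem hy (hdeg i x hx), ?_⟩
    rw [hFG i x hx, hAx, map_zero, add_zero, ← B.linQ₁_apply (y - h x), map_sub, B.linQ₁_apply,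
      B.linQ₁_apply]
    abel

/-- The linear map on `S(s⁻¹L)` given by a graded antisymmetric multilinear map. -/
theorem IsAntisymmetric.exists_linearMap {n : ℕ} {H : MultilinearMap k (fun _ : Fin n => L) L'}
    (hH : IsAntisymmetric 𝓛 H) :
    ∃ f : Sym 𝓛 →ₗ[k] L',
      (∀ γ : Fin n → L, f (word 𝓛 γ) = H fun j => shiftSign 𝓛 ((n : ℤ) - 1 - (j : ℕ)) (γ j)) ∧
      ∀ m ≠ n, ∀ γ : Fin m → L, f (word 𝓛 γ) = 0 :=
  hH.isShiftedSymmetric.exists_linearMap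

omit [DirectSum.Decomposition 𝓛'] in
theorem raisesDegree_of_hasDegree {n : ℕ} {H : MultilinearMap k (fun _ : Fin n => L) L'}
    (hH : HasDegree 𝓛 𝓛' H (-(n : ℤ))) {f : Sym 𝓛 →ₗ[k] L'}
    (hf : ∀ γ : Fin n → L, f (word 𝓛 γ) = H fun j => shiftSign 𝓛 ((n : ℤ) - 1 - (j : ℕ)) (γ j))
    (hf' : ∀ m ≠ n, ∀ γ : Fin m → L, f (word 𝓛 γ) = 0) : RaisesDegree (-1) (ι 𝓛' ∘ₗ f) := by
  refine raisesDegree_of_isHomWord fun m d X hX => ?_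
  obtain ⟨γ, κ, hγ, rfl, rfl⟩ := hX.exists_word
  rw [LinearMap.comp_apply]
  by_cases h : m = n
  · subst h
    rw [hf]
    have := ι_mem_symDeg (hH (fun j => shiftSign 𝓛 ((m : ℤ) - 1 - (j : ℕ)) (γ j)) κ
      fun j => shiftSign_mem _ (hγ j))
    rwa [show ∑ i, κ i + -(m : ℤ) - 1 = ∑ i, (κ i - 1) + -1 by
      rw [Finset.sum_sub_distrib]
      simp
      ring] at this
  · rw [hf' m h, map_zero]
    exact zero_mem _

/-- The component of `f ∘ Q` on `∧ⁿL`, for `f` concentrated on `∧ⁿL`. -/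
theorem LInfinityAlgebra.map_ext_word_shiftSign [CharZero k] (A : LInfinityAlgebra 𝓛) {n : ℕ}
    {H : MultilinearMap k (fun _ : Fin n => L) L'} {f : Sym 𝓛 →ₗ[k] L'}
    (hf : ∀ γ : Fin n → L, f (word 𝓛 γ) = H fun j => shiftSign 𝓛 ((n : ℤ) - 1 - (j : ℕ)) (γ j))
    (hf' : ∀ m ≠ n, ∀ γ : Fin m → L, f (word 𝓛 γ) = 0)
    {γ : Fin n → L} {κ : Fin n → ℤ} (hγ : ∀ j, γ j ∈ 𝓛 (κ j)) :
    f (A.ext (word 𝓛 fun j => shiftSign 𝓛 ((n : ℤ) - 1 - (j : ℕ)) (γ j))) =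
      -∑ i : Fin n, (-1 : k) ^ ((n : ℤ) + ∑ j ∈ Finset.Iio i, κ j) •
        H (Function.update γ i (A.Q₁ (γ i))) := by
  rw [A.map_ext_word hf' (fun j => shiftSign_mem _ (hγ j)), ← Finset.sum_neg_distrib]
  refine Finset.sum_congr rfl fun i _ => ?_
  -- In slot `i` the twist acts before `Q₁` in degree `κ i` and after it in degree `κ i + 1`,
  -- leaving `(-1)^(n-1-i)`; in every other slot it cancels.
  have h1 : (fun j : Fin n => shiftSign 𝓛 ((n : ℤ) - 1 - (j : ℕ))
      (Function.update (fun j : Fin n => shiftSign 𝓛 ((n : ℤ) - 1 - (j : ℕ)) (γ j)) i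
        (A.linQ₁ (shiftSign 𝓛 ((n : ℤ) - 1 - (i : ℕ)) (γ i))) j)) =
      Function.update γ i ((-1 : k) ^ ((n : ℤ) - 1 - (i : ℕ)) • A.Q₁ (γ i)) := by
    ext j
    by_cases h : j = i
    · subst h
      rw [Function.update_self, Function.update_self, shiftSign_of_mem 𝓛 _ (hγ j), map_smul,
        map_smul, shiftSign_of_mem 𝓛 _ (A.linQ₁_mem _ _ (hγ j)), smul_smul, A.linQ₁_apply,
        ← zpow_add₀ (neg_ne_zero.2 one_ne_zero)]
      congr 1
      apply neg_one_zpow_congr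
      exact ⟨((n : ℤ) - 1 - (j : ℕ)) * (κ j - 1), by ring⟩
    · rw [Function.update_of_ne h, Function.update_of_ne h, shiftSign_shiftSign]
  rw [hf, h1, MultilinearMap.map_update_smul, smul_smul, ← zpow_add₀ (neg_ne_zero.2 one_ne_zero),
    ← neg_smul]
  congr 1
  rw [show -(-1 : k) ^ ((n : ℤ) + ∑ j ∈ Finset.Iio i, κ j) =
    (-1) ^ ((n : ℤ) + ∑ j ∈ Finset.Iio i, κ j + 1) by
      rw [zpow_add_one₀ (neg_ne_zero.2 one_ne_zero), mul_neg_one]]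
  apply neg_one_zpow_congr
  have h2 : (∑ j : Fin n, if j < i then κ j - 1 else 0) = ∑ j ∈ Finset.Iio i, κ j - (i : ℕ) := by
    rw [← Finset.sum_filter, Finset.filter_gt_eq_Iio, Finset.sum_sub_distrib]
    simp
  rw [h2]
  exact ⟨-(i : ℕ) - 1, by ring⟩

/-- The endpoints of the gauge flow generated by a map concentrated on `∧ⁿL`. -/
theorem isGaugeFlow_gaugeFlow [CharZero k] (F : LInfinityMorphism A B) {n : ℕ} (hn : 1 ≤ n)
    {f : Sym 𝓛 →ₗ[k] L'} (hf1 : f 1 = 0) (hfn : VanishesBelow n f)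
    (hΦ : ∀ t, IsDGMorphism A.ext B.ext (gaugeFlow A.isCodifferential B.ext hn hfn F.ext t)) :
    IsGaugeFlow A B (f ∘ₗ incl 𝓛) (fun t => (hΦ t).toLInfinityMorphism.proj) := by
  have hf : (f ∘ₗ incl 𝓛) ∘ₗ red 𝓛 = f := linearMap_ext_incl (by simp [hf1]) fun X => by simp
  refine ⟨fun t => LInfinityMorphism.isMaurerCartan _,
    fun j => symProj 𝓛' ∘ₗ gaugeCoeff A.ext B.ext f F.ext j ∘ₗ incl 𝓛, fun m => ⟨m + 1,
      fun j hj γ => ?_⟩, fun t X => ?_, fun t => ⟨_, fun X => ?_,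
      LInfinityMorphism.isTwistedDifferential _ _⟩⟩
  · have h := (vanishesBelow_gaugeCoeff (Q' := B.ext) (Φ := F.ext) A.isCodifferential hfn j).mono
      (Nat.le_mul_of_pos_right j hn)
    -- Reduction subtracts a multiple of `1`, so vanishing on the empty word is needed besides
    -- vanishing on words of length `m < j`.
    have h1 : gaugeCoeff A.ext B.ext f F.ext j 1 = 0 := h 0 (by omega) 0 1 .one
    simp only [LinearMap.comp_apply, incl_red, map_sub, h.map_word (show m < j by omega) γ,
      Algebra.algebraMap_eq_smul_one, map_smul, h1, smul_zero, sub_zero, map_zero]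
  · rw [LInfinityMorphism.proj_apply, IsDGMorphism.ext_toLInfinityMorphism]
    exact ((sumsTo_gaugeFlow A.isCodifferential hn hfn t (incl 𝓛 X)).map (symProj 𝓛')).congr
      fun j => by rw [map_smul]; rfl
  · rw [IsDGMorphism.ext_toLInfinityMorphism, hf]
    exact ((sumsTo_deriv_gaugeFlow A.isCodifferential hn hfn t (incl 𝓛 X)).map (symProj 𝓛')).congr
      fun j => by rw [map_smul]; rfl

end Main

end LInfty

end

/-! ### Assembly of the gauge flow statement -/

theorem lemma1 {k : Type*} [Field k] [CharZero k]
    {L : Type*} [AddCommGroup L] [Module k L]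
    {L' : Type*} [AddCommGroup L'] [Module k L']
    (𝓛 : ℤ → Submodule k L) [DirectSum.Decomposition 𝓛]
    (𝓛' : ℤ → Submodule k L') [DirectSum.Decomposition 𝓛']
    (A : LInfty.LInfinityAlgebra 𝓛) (B : LInfty.LInfinityAlgebra 𝓛')
    (F : LInfty.LInfinityMorphism A B) (hF : F.IsQuasiIso)
    (n : ℕ) (hn : 1 ≤ n)
    (H : MultilinearMap k (fun _ : Fin n => L) L')
    (hH : LInfty.IsAntisymmetric 𝓛 H) (hHdeg : LInfty.HasDegree 𝓛 𝓛' H (-(n : ℤ))) :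
    ∃ G : LInfty.LInfinityMorphism A B,
      G.IsQuasiIso ∧
      (∀ m < n, ∀ γ : Fin m → L, G.structureMap m γ = F.structureMap m γ) ∧
      (∀ (γ : Fin n → L) (κ : Fin n → ℤ), (∀ i, γ i ∈ 𝓛 (κ i)) →
        G.structureMap n γ = F.structureMap n γ + B.Q₁ (H γ) -
          ∑ i : Fin n, (-1 : k) ^ ((n : ℤ) + ∑ j ∈ Finset.Iio i, κ j) •
            H (Function.update γ i (A.Q₁ (γ i)))) ∧
      ∃ (ξ : LInfty.C 𝓛 →ₗ[k] L') (Φ : k → LInfty.LInfinityMorphism A B),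
        (∀ γ : Fin n → L, LInfty.component 𝓛 ξ n γ = H γ) ∧
        (∀ m ≠ n, ∀ γ : Fin m → L, LInfty.component 𝓛 ξ m γ = 0) ∧
        LInfty.IsGaugeFlow A B ξ (fun t => (Φ t).proj) ∧
        Φ 0 = F ∧ Φ 1 = G := by
  open LInfty in
  obtain ⟨f, hf, hf'⟩ := hH.exists_linearMap
  have hf1 : f 1 = 0 := by simpa using hf' 0 (by omega) Fin.elim0
  have hfn : VanishesBelow n f := fun m hm d X hX => by
    obtain ⟨γ, -, -, -, rfl⟩ := hX.exists_word
    exact hf' m hm.ne γ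
  have hfshift : ∀ γ : Fin n → L,
      f (word 𝓛 fun j => shiftSign 𝓛 ((n : ℤ) - 1 - (j : ℕ)) (γ j)) = H γ := by
    intro γ
    simp only [hf, shiftSign_shiftSign]
  have hred : ∀ X, f (incl 𝓛 (red 𝓛 X)) = f X := fun X => by
    rw [incl_red, Algebra.algebraMap_eq_smul_one, map_sub, map_smul, hf1, smul_zero, sub_zero]
  have hΦ := isDGMorphism_gaugeFlow A.isCodifferential hn hfn B.isCodifferential
    (raisesDegree_of_hasDegree hHdeg hf hf') F.isDGMorphism
  have hlow : ∀ m < n, ∀ γ : Fin m → L,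
      (hΦ 1).toLInfinityMorphism.structureMap m γ = F.structureMap m γ := by
    intro m hm γ
    rw [LInfinityMorphism.structureMap_eq, LInfinityMorphism.structureMap_eq,
      IsDGMorphism.ext_toLInfinityMorphism,
      -- Below length `n` only the constant term of the flow survives.
      gaugeFlow_word A.isCodifferential hn hfn 1 (N := 1) (by omega)]
    simp [gaugeCoeff]
  have htop : ∀ (γ : Fin n → L) (κ : Fin n → ℤ), (∀ i, γ i ∈ 𝓛 (κ i)) →
      (hΦ 1).toLInfinityMorphism.structureMap n γ = F.structureMap n γ + B.Q₁ (H γ) -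
        ∑ i : Fin n, (-1 : k) ^ ((n : ℤ) + ∑ j ∈ Finset.Iio i, κ j) •
          H (Function.update γ i (A.Q₁ (γ i))) := by
    intro γ κ hγ
    rw [LInfinityMorphism.structureMap_eq, LInfinityMorphism.structureMap_eq,
      IsDGMorphism.ext_toLInfinityMorphism,
      -- As `n < 2 n`, exactly the constant and linear terms in `t` can contribute at length `n`.
      gaugeFlow_word A.isCodifferential hn hfn 1 (N := 2) (by omega), Finset.sum_range_succ,
      Finset.sum_range_one]
    simp only [gaugeCoeff, Nat.cast_zero, zero_add, inv_one, one_smul, one_pow, map_add]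
    rw [symProj_gaugeOp F.isDGMorphism.aug, coderAlong_word hfn F.isDGMorphism.one, hfshift,
      A.map_ext_word_shiftSign hf hf' hγ, ← B.Q₁_eq, ← add_assoc, ← sub_eq_add_neg]
  refine ⟨(hΦ 1).toLInfinityMorphism, ?_, hlow, htop, f ∘ₗ incl 𝓛,
    fun t => (hΦ t).toLInfinityMorphism, fun γ => ?_, fun m hm γ => ?_,
    isGaugeFlow_gaugeFlow F hn hf1 hfn hΦ, ?_, rfl⟩
  -- For `n = 1` the formula is a chain homotopy between the linear components, with homotopy `H`;
  -- for `n > 1` the linear component is unchanged.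
  · obtain rfl | hn' := hn.eq_or_lt
    · have hH1 : ∀ x, H.toLinearMap (fun _ => 0) 0 x = H fun _ => x := fun x =>
        congrArg H (funext fun j => by
          rw [Subsingleton.elim j 0, Function.update_self])
      refine hF.of_homotopy (H.toLinearMap (fun _ => 0) 0) (fun i x hx => ?_) fun i x hx => ?_
      · have := hHdeg (fun _ => x) (fun _ => i) fun _ => hx
        rw [hH1]
        simpa [← sub_eq_add_neg] using this
      · have := htop (fun _ => x) (fun _ => i) fun _ => hx
        rw [hH1, hH1, this]
        have hu : Function.update (fun _ : Fin 1 => x) 0 (A.Q₁ x) = fun _ => A.Q₁ x :=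
          funext fun j => by rw [Subsingleton.elim j 0, Function.update_self]
        simp [hu]
    · refine hF.of_homotopy 0 (fun i x _ => zero_mem _) fun i x _ => ?_
      rw [hlow 1 hn']
      simp [← B.linQ₁_apply]
  · exact (hred _).trans (hfshift γ)
  · exact (hred _).trans (hf' m hm _)
  · apply LInfinityMorphism.ext_injective
    rw [IsDGMorphism.ext_toLInfinityMorphism, gaugeFlow_zero]
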